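/- \textbf{Setting.} Let $(X,d,\ll,\le,\tau)$ be a Lorentzian pre-length space: $d$ is a metric on $X$, $\le$ is a preorder, $\ll$ is a transitive relation contained in $\le$, and $\tau:X\times X\to[0,\infty]$ is lower semicontinuous with respect to $d$, with $\tau(x,z)\ge\tau(x,y)+\tau(y,z)$ for $x\le y\le z$, with $\tau(x,y)=0$ if $x\not\le y$, and with $\tau(x,y)>0$ if and only if $x\ll y$. A (future-directed) causal curve is a Lipschitz map $\gamma:[0,1]\to X$, not constant on any non-trivial subinterval, with $\gamma(s)\le\gamma(t)$ for all $s<t$; it is timelike if $\gamma(s)\ll\gamma(t)$ for all $s<t$. Its length is the infimum of $\sum_i\tau(\gamma(t_i),\gamma(t_{i+1}))$ over all partitions of $[0,1]$, and it is a distance realizer from $x=\gamma(0)$ to $y=\gamma(1)$ if its length is $\tau(x,y)$. $X$ is strongly causal if the sets $I(x,y)=\{z: x\ll z\ll y\}$ form a subbase of the metric topology, and regular if every distance realizer between timelike related points is timelike. For $K\in\mathbb R$ let $\mathbb L^2_K$ be the simply connected two-dimensional Lorentzian space of constant curvature $K$ (the universal cover of de Sitter space of radius $1/\sqrt K$ if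 $K>0$, Minkowski space if $K=0$, the universal cover of anti-de Sitter space of radius $1/\sqrt{-K}$ if $K<0$), with time separation $\bar\tau$, and put $D_K=\pi/\sqrt{-K}$ if $K<0$ and $D_K=\infty$ if $K\ge0$. A timelike triangle in $U\subset X$ consists of points $x_0\ll x_1\ll x_2$ of $U$ with $\tau(x_0,x_2)<D_K$; a comparison triangle for it consists of points $\bar x_0,\bar x_1,\bar x_2\in\mathbb L^2_K$ with $\bar\tau(\bar x_i,\bar x_j)=\tau(x_i,x_j)$ for $i<j$. Consider the following conditions on an open set $U\subset X$. (C) $\tau$ is continuous on $(U\times U)\cap\tau^{-1}([0,D_K))$, and this set is open. (T) All $x\ll y$ in $U$ with $\tau(x,y)<D_K$ are connected by a distance realizer contained in $U$. For every timelike triangle in $U$, every point $m$ on a distance realizer in $U$ from a vertex $a$ to a vertex $b\gg a$, with $c$ the third vertex, every comparison triangle, and the comparison point $\bar m$ of $m$ on the geodesic segment from $\bar a$ to $\bar b$ (that is, $\bar\tau(\bar a,\bar m)=\tau(a,m)$ and $\bar\tau(\bar m,\bar b)=\tau(m,b)$), one has $\tau(c,m)\le\bar\tau(\bar c,\bar m)$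 and $\tau(m,c)\le\bar\tau(\bar m,\bar c)$. (F) For all $x_1\ll x_2\ll x_3\le x_4$ in $U$ with $\tau(x_1,x_4)<D_K$ and all $\bar x_1,\dots,\bar x_4\in\mathbb L^2_K$ such that $\bar\tau(\bar x_i,\bar x_j)=\tau(x_i,x_j)$ for all $i<j$ with $(i,j)\ne(3,4)$ and such that $\bar x_3,\bar x_4$ lie on opposite sides of (or on) the geodesic line through $\bar x_1,\bar x_2$, one has $\tau(x_3,x_4)\ge\bar\tau(\bar x_3,\bar x_4)$. Dually, for all $x_1\le x_2\ll x_3\ll x_4$ in $U$ with $\tau(x_1,x_4)<D_K$ and all $\bar x_1,\dots,\bar x_4$ such that these equalities hold for $(i,j)\ne(1,2)$ and $\bar x_1,\bar x_2$ lie on opposite sides of (or on) the line through $\bar x_3,\bar x_4$, one has $\tau(x_1,x_2)\ge\bar\tau(\bar x_1,\bar x_2)$. (E) For every timelike triangle in $U$ and every $\mu\in(0,1)$ there is a function $f_\mu\ge0$ with $\lim_{\varepsilon\to0}f_\mu(\varepsilon)=0$ such that the following holds. Let $a\ll b$ be two of the vertices and $c$ the third one, take a comparison triangle, and let $\bar m_\mu\in\mathbb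 L^2_K$ be the $\mu$-midpoint of $\bar a,\bar b$, that is, $\bar\tau(\bar a,\bar m_\mu)=\mu\bar\tau(\bar a,\bar b)$ and $\bar\tau(\bar m_\mu,\bar b)=(1-\mu)\bar\tau(\bar a,\bar b)$. Then for every $\varepsilon>0$ and every $\varepsilon$-$\mu$-midpoint $m\in U$ of $a,b$ (that is, $|\tau(a,m)-\mu\tau(a,b)|<\varepsilon$ and $|\tau(m,b)-(1-\mu)\tau(a,b)|<\varepsilon$) that is timelike related to $c$, one has $\tau(c,m)\le\bar\tau(\bar c,\bar m_\mu)+f_\mu(\varepsilon)$ and $\tau(m,c)\le\bar\tau(\bar m_\mu,\bar c)+f_\mu(\varepsilon)$. \textbf{Lemma.} Let $X$ be a strongly causal and regular Lorentzian pre-length space and $K\in\mathbb R$. The following are equivalent. \begin{enumerate} \item $X$ has curvature bounded below by $K$ in the sense of (one-sided, timelike) triangle comparison: every point of $X$ has an open neighbourhood $U$ satisfying (C) and (T). \item $X$ has curvature bounded below by $K$ in the sense of the four-point condition: every point of $X$ has an open neighbourhood $U$ satisfying (C) and (F). Moreover, every point of $X$ has an open neighbourhood in which any two distinct timelike related points are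 connected by a distance realizer in $X$. \item $X$ has curvature bounded below by $K$ in the sense of the $\varepsilon$-$\mu$ triangle condition: every point of $X$ has an open neighbourhood $U$ satisfying (C) and (E). Moreover, every point of $X$ has an open neighbourhood in which any two distinct timelike related points are connected by a distance realizer in $X$. \end{enumerate} -/

import Mathlib

open Set Filter Topology
open scoped ENNReal NNReal

noncomputable section

/-! ### Lorentzian pre-length spaces -/

/-- A Lorentzian pre-length space structure on a metric space `X`: the relations `≪` (`chron`) and
`≤` (`causal`) and the time separation function `τ` (`tau`). -/
structure LorentzianPreLengthSpace (X : Type*) [MetricSpace X] where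
  chron : X → X → Prop
  causal : X → X → Prop
  tau : X → X → ℝ≥0∞
  causal_refl : ∀ x, causal x x
  causal_trans : ∀ x y z, causal x y → causal y z → causal x z
  chron_trans : ∀ x y z, chron x y → chron y z → chron x z
  chron_causal : ∀ x y, chron x y → causal x y
  tau_lsc : LowerSemicontinuous (fun p : X × X => tau p.1 p.2)
  tau_triangle : ∀ x y z, causal x y → causal y z → tau x y + tau y z ≤ tau x z
  tau_eq_zero : ∀ x y, ¬ causal x y → tau x y = 0
  tau_pos_iff : ∀ x y, 0 < tau x y ↔ chron x y

namespace LorentzianPreLengthSpace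

variable {X : Type*} [MetricSpace X] (L : LorentzianPreLengthSpace X)

/-- The chronological diamond `I(x, y) = {z | x ≪ z ≪ y}`. -/
def diamond (x y : X) : Set X := {z | L.chron x z ∧ L.chron z y}

/-- Strong causality: the Alexandrov topology, for which the diamonds `I(x, y)` form a subbase, is
the metric topology. -/
def StronglyCausal : Prop :=
  TopologicalSpace.generateFrom {s : Set X | ∃ x y, s = L.diamond x y} =
    (inferInstance : TopologicalSpace X)

/-- Future-directed causal curves, parametrised on `[0, 1]` (only the values of `γ` there matter):
Lipschitz, monotone for `≤`, and not constant on any non-trivial subinterval. -/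
def IsCausalCurve (γ : ℝ → X) : Prop :=
  (∃ C : ℝ≥0, LipschitzOnWith C γ (Icc 0 1)) ∧
  (∀ s ∈ Icc (0 : ℝ) 1, ∀ t ∈ Icc (0 : ℝ) 1, s < t → L.causal (γ s) (γ t)) ∧
  (∀ s ∈ Icc (0 : ℝ) 1, ∀ t ∈ Icc (0 : ℝ) 1, s < t → ∃ r ∈ Icc s t, γ r ≠ γ s)

/-- `0 = t 0 < t 1 < ⋯ < t n = 1`. -/
def IsPartition (n : ℕ) (t : ℕ → ℝ) : Prop :=
  t 0 = 0 ∧ t n = 1 ∧ ∀ i < n, t i < t (i + 1)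

/-- The `τ`-length of a curve on `[0, 1]`: the infimum over all partitions of the sum of the time
separations of consecutive points. -/
def curveLength (γ : ℝ → X) : ℝ≥0∞ :=
  ⨅ (n : ℕ) (t : ℕ → ℝ) (_ : IsPartition n t),
    ∑ i ∈ Finset.range n, L.tau (γ (t i)) (γ (t (i + 1)))

/-- `γ` is a distance realizer from `x` to `y`. -/
def IsDistanceRealizer (γ : ℝ → X) (x y : X) : Prop :=
  L.IsCausalCurve γ ∧ γ 0 = x ∧ γ 1 = y ∧ L.curveLength γ = L.tau x y

/-- Regularity: every distance realizer between timelike related points is a timelike curve. -/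
def Regular : Prop :=
  ∀ (x y : X) (γ : ℝ → X), L.chron x y → L.IsDistanceRealizer γ x y →
    ∀ s ∈ Icc (0 : ℝ) 1, ∀ t ∈ Icc (0 : ℝ) 1, s < t → L.chron (γ s) (γ t)

end LorentzianPreLengthSpace

/-! ### The comparison spaces `𝕃²_K` -/

/-- The diameter bound `D_K`. -/
def diamBound (K : ℝ) : ℝ≥0∞ :=
  if K < 0 then ENNReal.ofReal (Real.pi / √(-K)) else ⊤

/-- Points of the simply connected two-dimensional Lorentzian space `𝕃²_K` of constant curvature `K`
in global coordinates `(t, x)` (time coordinate first). The metric is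
* `K > 0` (de Sitter): `K⁻¹ (-dt² + cosh² t dx²)`;
* `K = 0` (Minkowski): `-dt² + dx²`;
* `K < 0` (anti-de Sitter): `|K|⁻¹ (-cosh² x dt² + dx²)`. -/
abbrev ModelPlane : Type := ℝ × ℝ

namespace ModelPlane

/-- Coordinates `(u, v)` in which the metric of `𝕃²_K` is a positive multiple of `-du² + dv²`. -/
def conf (K : ℝ) (p : ModelPlane) : ℝ × ℝ :=
  if 0 < K then (Real.arctan (Real.sinh p.1), p.2)
  else if K = 0 then p
  else (p.1, Real.arctan (Real.sinh p.2))

/-- The chronological relation of `𝕃²_K`. -/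
def chron (K : ℝ) (p q : ModelPlane) : Prop :=
  |(conf K q).2 - (conf K p).2| < (conf K q).1 - (conf K p).1

/-- The causal relation of `𝕃²_K`. -/
def causal (K : ℝ) (p q : ModelPlane) : Prop :=
  |(conf K q).2 - (conf K p).2| ≤ (conf K q).1 - (conf K p).1

open Classical in
/-- The time separation function of `𝕃²_K`. For `K > 0`, points `p ≪ q` satisfy
`cosh (√K τ) = cosh t_p cosh t_q cos (x_q - x_p) - sinh t_p sinh t_q`. For `K < 0`, points `p ≪ q`
satisfy `cos (√|K| τ) = cosh x_p cosh x_q cos (t_q - t_p) - sinh x_p sinh x_q` as long as `q` is in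
the causal past of the point `(t_p + π, -x_p)`, in which the timelike geodesics from `p` refocus at
time `D_K`; all other `q ≫ p` are at infinite time separation from `p`. -/
def tau (K : ℝ) (p q : ModelPlane) : ℝ≥0∞ :=
  if chron K p q then
    if 0 < K then
      ENNReal.ofReal (Real.arcosh (Real.cosh p.1 * Real.cosh q.1 * Real.cos (q.2 - p.2)
        - Real.sinh p.1 * Real.sinh q.1) / √K)
    else if K = 0 then
      ENNReal.ofReal √((q.1 - p.1) ^ 2 - (q.2 - p.2) ^ 2)
    else if causal K q (p.1 + Real.pi, -p.2) then
      ENNReal.ofReal (Real.arccos (Real.cosh p.2 * Real.cosh q.2 * Real.cos (q.1 - p.1)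
        - Real.sinh p.2 * Real.sinh q.2) / √(-K))
    else ⊤
  else 0

/-- For `K ≠ 0` the isometric immersion of `√|K| 𝕃²_K` as a hyperquadric of a
three-dimensional semi-Euclidean space, for `K = 0` the embedding as an affine plane. The geodesics
of `𝕃²_K` are cut out by the planes through the origin. -/
def embed (K : ℝ) (p : ModelPlane) : Fin 3 → ℝ :=
  if 0 < K then
    ![Real.sinh p.1, Real.cosh p.1 * Real.cos p.2, Real.cosh p.1 * Real.sin p.2]
  else if K = 0 then ![1, p.1, p.2]
  else ![Real.cosh p.2 * Real.cos p.1, Real.cosh p.2 * Real.sin p.1, Real.sinh p.2]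

/-- The sign of `side K p q r` tells on which side of the timelike geodesic line through `p` and `q`
the point `r` lies (it is `0` on the line). -/
def side (K : ℝ) (p q r : ModelPlane) : ℝ :=
  Matrix.det (Matrix.of ![embed K p, embed K q, embed K r])

/-- `r` and `s` lie on opposite sides of the line through `p` and `q`, or one of them is on it. -/
def OppositeSides (K : ℝ) (p q r s : ModelPlane) : Prop :=
  side K p q r * side K p q s ≤ 0

end ModelPlane

namespace LorentzianPreLengthSpace

variable {X : Type*} [MetricSpace X] (L : LorentzianPreLengthSpace X)

/-! ### Curvature bounds -/

/-- `τ` is continuous on `(U × U) ∩ τ⁻¹([0, D_K))`, and this set is open. -/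
def TauContinuousBelow (K : ℝ) (U : Set X) : Prop :=
  ContinuousOn (fun p : X × X => L.tau p.1 p.2)
    ((U ×ˢ U) ∩ {p | L.tau p.1 p.2 < diamBound K}) ∧
  IsOpen ((U ×ˢ U) ∩ {p : X × X | L.tau p.1 p.2 < diamBound K})

/-- The vertices `x 0 ≪ x 1 ≪ x 2` of a timelike triangle in `U` that satisfies the size bound. -/
def IsTimelikeTriangle (K : ℝ) (U : Set X) (x : Fin 3 → X) : Prop :=
  (∀ i, x i ∈ U) ∧ L.chron (x 0) (x 1) ∧ L.chron (x 1) (x 2) ∧ L.tau (x 0) (x 2) < diamBound K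

/-- `y` is a comparison triangle in `𝕃²_K` for the triangle `x`. -/
def IsComparisonTriangle (K : ℝ) (x : Fin 3 → X) (y : Fin 3 → ModelPlane) : Prop :=
  ∀ i j, i < j → ModelPlane.tau K (y i) (y j) = L.tau (x i) (x j)

/-- `m'` is a comparison point in `𝕃²_K`, on the segment from `p'` to `q'`, for a point `m` of a
distance realizer from `p` to `q`. -/
def IsComparisonPoint (K : ℝ) (p m q : X) (p' m' q' : ModelPlane) : Prop :=
  ModelPlane.causal K p' m' ∧ ModelPlane.causal K m' q' ∧
  ModelPlane.tau K p' m' = L.tau p m ∧ ModelPlane.tau K m' q' = L.tau m q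

/-- `U` is a comparison neighbourhood for the lower curvature bound `K` in the sense of one-sided
triangle comparison. The side is `x i`, `x j`; the opposite vertex is `x k`. -/
def IsTriangleNeighbourhood (K : ℝ) (U : Set X) : Prop :=
  L.TauContinuousBelow K U ∧
  (∀ x ∈ U, ∀ y ∈ U, L.chron x y → L.tau x y < diamBound K →
    ∃ γ : ℝ → X, L.IsDistanceRealizer γ x y ∧ ∀ s ∈ Icc (0 : ℝ) 1, γ s ∈ U) ∧
  (∀ (x : Fin 3 → X) (y : Fin 3 → ModelPlane),
    L.IsTimelikeTriangle K U x → L.IsComparisonTriangle K x y →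
    ∀ i j k : Fin 3, i < j → k ≠ i → k ≠ j →
    ∀ γ : ℝ → X, L.IsDistanceRealizer γ (x i) (x j) → (∀ s ∈ Icc (0 : ℝ) 1, γ s ∈ U) →
    ∀ s ∈ Icc (0 : ℝ) 1, ∀ m' : ModelPlane,
      L.IsComparisonPoint K (x i) (γ s) (x j) (y i) m' (y j) →
      L.tau (x k) (γ s) ≤ ModelPlane.tau K (y k) m' ∧
      L.tau (γ s) (x k) ≤ ModelPlane.tau K m' (y k))

/-- Curvature bounded below by `K` in the sense of one-sided triangle comparison. -/
def TriangleCurvatureBoundedBelow (K : ℝ) : Prop :=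
  ∀ p : X, ∃ U : Set X, IsOpen U ∧ p ∈ U ∧ L.IsTriangleNeighbourhood K U

/-- `U` is a comparison neighbourhood for the lower curvature bound `K` in the sense of the
four-point condition. In the future version `y` is obtained from comparison triangles for
`(x 0, x 1, x 2)` and `(x 0, x 1, x 3)`, glued along the side from `y 0` to `y 1` on opposite sides
of it; the past version is its time reversal. -/
def IsFourPointNeighbourhood (K : ℝ) (U : Set X) : Prop :=
  L.TauContinuousBelow K U ∧
  (∀ (x : Fin 4 → X) (y : Fin 4 → ModelPlane), (∀ i, x i ∈ U) →
    L.chron (x 0) (x 1) → L.chron (x 1) (x 2) → L.causal (x 2) (x 3) →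
    L.tau (x 0) (x 3) < diamBound K →
    (∀ i j, i < j → (i, j) ≠ (2, 3) → ModelPlane.tau K (y i) (y j) = L.tau (x i) (x j)) →
    ModelPlane.OppositeSides K (y 0) (y 1) (y 2) (y 3) →
    ModelPlane.tau K (y 2) (y 3) ≤ L.tau (x 2) (x 3)) ∧
  (∀ (x : Fin 4 → X) (y : Fin 4 → ModelPlane), (∀ i, x i ∈ U) →
    L.causal (x 0) (x 1) → L.chron (x 1) (x 2) → L.chron (x 2) (x 3) →
    L.tau (x 0) (x 3) < diamBound K →
    (∀ i j, i < j → (i, j) ≠ (0, 1) → ModelPlane.tau K (y i) (y j) = L.tau (x i) (x j)) →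
    ModelPlane.OppositeSides K (y 2) (y 3) (y 0) (y 1) →
    ModelPlane.tau K (y 0) (y 1) ≤ L.tau (x 0) (x 1))

/-- Curvature bounded below by `K` in the sense of the four-point condition. -/
def FourPointCurvatureBoundedBelow (K : ℝ) : Prop :=
  ∀ p : X, ∃ U : Set X, IsOpen U ∧ p ∈ U ∧ L.IsFourPointNeighbourhood K U

/-- `m` is an `ε`-`μ`-midpoint of `a` and `b`, i.e. `|τ(a, m) - μ τ(a, b)| < ε` and
`|τ(m, b) - (1 - μ) τ(a, b)| < ε`, for `τ(a, b) < ∞`. -/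
def IsEpsMuMidpoint (ε μ : ℝ) (a b m : X) : Prop :=
  L.tau a m < ENNReal.ofReal μ * L.tau a b + ENNReal.ofReal ε ∧
  ENNReal.ofReal μ * L.tau a b < L.tau a m + ENNReal.ofReal ε ∧
  L.tau m b < ENNReal.ofReal (1 - μ) * L.tau a b + ENNReal.ofReal ε ∧
  ENNReal.ofReal (1 - μ) * L.tau a b < L.tau m b + ENNReal.ofReal ε

/-- `m` is the `μ`-midpoint of `a` and `b` in `𝕃²_K`. -/
def _root_.ModelPlane.IsMuMidpoint (K μ : ℝ) (a b m : ModelPlane) : Prop :=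
  ModelPlane.tau K a m = ENNReal.ofReal μ * ModelPlane.tau K a b ∧
  ModelPlane.tau K m b = ENNReal.ofReal (1 - μ) * ModelPlane.tau K a b

/-- `U` is a comparison neighbourhood for the lower curvature bound `K` in the sense of the
one-sided `ε`-`μ` triangle condition. The almost-midpoint belongs to the vertices `x i`, `x j`; the
remaining vertex is `x k`. -/
def IsEpsMuNeighbourhood (K : ℝ) (U : Set X) : Prop :=
  L.TauContinuousBelow K U ∧
  (∀ x : Fin 3 → X, L.IsTimelikeTriangle K U x → ∀ μ ∈ Ioo (0 : ℝ) 1,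
    ∃ f : ℝ → ℝ≥0, Tendsto f (𝓝[>] 0) (𝓝 0) ∧
      ∀ y : Fin 3 → ModelPlane, L.IsComparisonTriangle K x y →
      ∀ i j k : Fin 3, i < j → k ≠ i → k ≠ j →
      ∀ m' : ModelPlane, ModelPlane.IsMuMidpoint K μ (y i) (y j) m' →
      ∀ ε > (0 : ℝ), ∀ m ∈ U, L.IsEpsMuMidpoint ε μ (x i) (x j) m →
        (L.chron m (x k) ∨ L.chron (x k) m) →
        L.tau (x k) m ≤ ModelPlane.tau K (y k) m' + f ε ∧
        L.tau m (x k) ≤ ModelPlane.tau K m' (y k) + f ε)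

/-- Curvature bounded below by `K` in the sense of the one-sided `ε`-`μ` triangle condition. -/
def EpsMuCurvatureBoundedBelow (K : ℝ) : Prop :=
  ∀ p : X, ∃ U : Set X, IsOpen U ∧ p ∈ U ∧ L.IsEpsMuNeighbourhood K U

/-- Locally, every pair of (distinct) timelike related points is connected by a distance
realizer. -/
def LocallyTimelikeGeodesic : Prop :=
  ∀ p : X, ∃ U : Set X, IsOpen U ∧ p ∈ U ∧
    ∀ x ∈ U, ∀ y ∈ U, x ≠ y → L.chron x y → ∃ γ : ℝ → X, L.IsDistanceRealizer γ x y

end LorentzianPreLengthSpace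

end

/-! All three conditions are local and are turned into inequalities between the functions `sn` and
`md` of time separations. In the model plane `md` of the distance is an explicit function `modDist`
of the coordinates. The law of cosines says that `hingeProd K x y z` is `sn K x * sn K y` times the
signed hyperbolic cosine of the angle between the sides x and y: at least 1 if both sides have the
same time orientation at the vertex, at most -1 if they have opposite ones.

Localisation: if p ≪ p, then strong causality makes p isolated, and on {p} every condition is
vacuous because τ(p, p) = ∞. Otherwise p has arbitrarily small good neighbourhoods
(`StronglyCausal.exists_isGood`): causally convex, with τ finite, small and continuous. All
conditions restrict to them.

Triangle comparison ⇒ four points. Comparison at an interior point of a side is equivalent to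
monotonicity of comparison angles at an endpoint (`hinge_at_endpoint`,
`ComparisonSpace.hinge_mono`). For x₁ ≪ x₂ ≪ x₃ ≪ x₄, suppose first that a segment γ from x₁ runs
through x₂ and beyond. Then the continuation of γ makes with the segments to x₃ and x₄ angles at
most the comparison angles α, β of the two given hinges (`ComparisonSpace.adjacent_hinge_bound`). On
the three segments, points q, z, r are chosen at infinitesimal distances from x₂, so that in the
Minkowski plane they would lie on one timelike segment. The reverse triangle inequality τ(q, r) ≥
τ(q, z) + τ(z, r) bounds the angle at x₂ between x₃ and x₄ by α + β (`le_cosh_add_of_infinitesimal`,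
`ComparisonSpace.hinge_cos_le`). Limits remove the extra assumptions (`ComparisonSpace.fourPoint`).
The past version is time reversal. Regularity is what makes the realizers timelike.

The result is `FourPointIneq`, which says cosh ∠(x₃ x₂ x₄) ≤ cosh (α + β) without division. By a
Gram determinant identity in the quadric model (`exists_gram`), a comparison configuration with x̄₃,
x̄₄ on opposite sides satisfies it with equality, so it is equivalent to the comparison of the
remaining distance (`fourPointIneq_iff`).

Four points ⇒ almost-midpoints. If m lies exactly on a segment from a to b, the hinge a, m, b is
degenerate, one square root vanishes, and the four-point inequality collapses to triangle comparison
(`FourPointIneq.chord_le`). For almost-midpoints compactness gives the same up to an error tending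
to 0 (`exists_forall_chord_lt`).

Almost-midpoints ⇒ triangles. An interior point of a realizer is an exact μ-midpoint, hence an
ε-μ-midpoint for every ε > 0, and ε → 0 gives the comparison. -/

noncomputable section

/-! ### Generalised trigonometric functions -/

namespace Comparison

/-- The generalised sine function: the solution of `f'' = K f`, `f 0 = 0`, `f' 0 = 1`. -/
def sn (K s : ℝ) : ℝ :=
  if 0 < K then Real.sinh (√K * s) / √K
  else if K = 0 then s
  else Real.sin (√(-K) * s) / √(-K)

/-- The modified distance function: the primitive of `sn K` that vanishes at `0`. -/
def md (K s : ℝ) : ℝ :=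
  if 0 < K then (Real.cosh (√K * s) - 1) / K
  else if K = 0 then s ^ 2 / 2
  else (Real.cos (√(-K) * s) - 1) / K

theorem sn_of_pos {K : ℝ} (hK : 0 < K) (s : ℝ) : sn K s = Real.sinh (√K * s) / √K := by
  simp [sn, hK]

theorem sn_of_eq_zero (s : ℝ) : sn 0 s = s := by simp [sn]

theorem sn_of_neg {K : ℝ} (hK : K < 0) (s : ℝ) : sn K s = Real.sin (√(-K) * s) / √(-K) := by
  simp [sn, hK.not_gt, hK.ne]

theorem md_of_pos {K : ℝ} (hK : 0 < K) (s : ℝ) : md K s = (Real.cosh (√K * s) - 1) / K := by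
  simp [md, hK]

theorem md_of_eq_zero (s : ℝ) : md 0 s = s ^ 2 / 2 := by simp [md]

theorem md_of_neg {K : ℝ} (hK : K < 0) (s : ℝ) : md K s = (Real.cos (√(-K) * s) - 1) / K := by
  simp [md, hK.not_gt, hK.ne]

theorem one_add_mul_md_of_pos {K : ℝ} (hK : 0 < K) (s : ℝ) :
    1 + K * md K s = Real.cosh (√K * s) := by
  rw [md_of_pos hK]; field_simp; ring

theorem one_add_mul_md_of_neg {K : ℝ} (hK : K < 0) (s : ℝ) :
    1 + K * md K s = Real.cos (√(-K) * s) := by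
  rw [md_of_neg hK]; field_simp [hK.ne]; ring

theorem sn_zero (K : ℝ) : sn K 0 = 0 := by simp [sn]

theorem md_zero (K : ℝ) : md K 0 = 0 := by simp [md]

theorem sn_neg (K s : ℝ) : sn K (-s) = -sn K s := by
  unfold sn; split_ifs <;> simp [neg_div]

theorem md_neg (K s : ℝ) : md K (-s) = md K s := by
  unfold md; split_ifs <;> simp

theorem sn_add (K s t : ℝ) :
    sn K (s + t) = sn K s * (1 + K * md K t) + (1 + K * md K s) * sn K t := by
  rcases lt_trichotomy K 0 with h | h | h
  · rw [one_add_mul_md_of_neg h, one_add_mul_md_of_neg h]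
    simp only [sn_of_neg h, mul_add, Real.sin_add]; ring
  · subst h; simp [sn_of_eq_zero]
  · rw [one_add_mul_md_of_pos h, one_add_mul_md_of_pos h]
    simp only [sn_of_pos h, mul_add, Real.sinh_add]; ring

/-- The Pythagorean identity between sine and cosine, with `1 + K * md K s` as the cosine, written
so that it survives K = 0. -/
theorem sn_sq (K s : ℝ) : sn K s ^ 2 = 2 * md K s + K * md K s ^ 2 := by
  rcases lt_trichotomy K 0 with h | h | h
  · have h1 : √(-K) ^ 2 = -K := Real.sq_sqrt (by linarith)
    rw [sn_of_neg h, md_of_neg h, div_pow, h1, Real.sin_sq]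
    field_simp [h.ne]; ring
  · subst h; simp [sn_of_eq_zero, md_of_eq_zero]; ring
  · have h1 : √K ^ 2 = K := Real.sq_sqrt h.le
    rw [sn_of_pos h, md_of_pos h, div_pow, h1, Real.sinh_sq]
    field_simp; ring

theorem md_add (K s t : ℝ) :
    md K (s + t) = md K s + md K t + K * md K s * md K t + sn K s * sn K t := by
  rcases lt_trichotomy K 0 with h | h | h
  · have h1 : √(-K) * √(-K) = -K := Real.mul_self_sqrt (by linarith)
    have h2 : √(-K) ≠ 0 := (Real.sqrt_pos.2 (by linarith)).ne'
    have h3 : sn K s * sn K t = Real.sin (√(-K) * s) * Real.sin (√(-K) * t) / (-K) := by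
      rw [sn_of_neg h, sn_of_neg h, div_mul_div_comm, h1]
    rw [h3]
    simp only [md_of_neg h, mul_add, Real.cos_add]
    field_simp [h.ne]; ring
  · subst h; simp [sn_of_eq_zero, md_of_eq_zero]; ring
  · have h1 : √K * √K = K := Real.mul_self_sqrt h.le
    have h3 : sn K s * sn K t = Real.sinh (√K * s) * Real.sinh (√K * t) / K := by
      rw [sn_of_pos h, sn_of_pos h, div_mul_div_comm, h1]
    rw [h3]
    simp only [md_of_pos h, mul_add, Real.cosh_add]
    field_simp; ring

theorem md_sub (K s t : ℝ) :
    md K (s - t) = md K s + md K t + K * md K s * md K t - sn K s * sn K t := by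
  rw [sub_eq_add_neg, md_add, md_neg, sn_neg]; ring

theorem continuous_sn (K : ℝ) : Continuous (sn K) := by
  unfold sn; split_ifs <;> fun_prop

theorem continuous_md (K : ℝ) : Continuous (md K) := by
  unfold md; split_ifs <;> fun_prop

theorem sn_pos {K s : ℝ} (hs : 0 < s) (hK : K < 0 → √(-K) * s < Real.pi) : 0 < sn K s := by
  rcases lt_trichotomy K 0 with h | h | h
  · have h2 : 0 < √(-K) := Real.sqrt_pos.2 (by linarith)
    rw [sn_of_neg h]
    exact div_pos (Real.sin_pos_of_pos_of_lt_pi (by positivity) (hK h)) h2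
  · subst h; simpa [sn_of_eq_zero]
  · have h2 : 0 < √K := Real.sqrt_pos.2 h
    rw [sn_of_pos h]
    exact div_pos (Real.sinh_pos_iff.2 (by positivity)) h2

theorem sn_le_sn {K s t : ℝ} (hs : 0 ≤ s) (hst : s ≤ t)
    (hK : K < 0 → √(-K) * t ≤ Real.pi / 2) : sn K s ≤ sn K t := by
  rcases lt_trichotomy K 0 with h | h | h
  · have h2 : 0 < √(-K) := Real.sqrt_pos.2 (by linarith)
    rw [sn_of_neg h, sn_of_neg h]
    have h3 : √(-K) * s ≤ √(-K) * t := by gcongr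
    have h4 : 0 ≤ √(-K) * s := by positivity
    have := Real.sin_le_sin_of_le_of_le_pi_div_two (by linarith [Real.pi_pos]) (hK h) h3
    gcongr
  · subst h; simpa [sn_of_eq_zero]
  · have h2 : 0 < √K := Real.sqrt_pos.2 h
    rw [sn_of_pos h, sn_of_pos h]
    have : Real.sinh (√K * s) ≤ Real.sinh (√K * t) := Real.sinh_le_sinh.2 (by gcongr)
    gcongr

theorem md_lt_md {K s t : ℝ} (hs : 0 ≤ s) (hst : s < t)
    (hK : K < 0 → √(-K) * t ≤ Real.pi) : md K s < md K t := by
  rcases lt_trichotomy K 0 with h | h | h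
  · have h2 : 0 < √(-K) := Real.sqrt_pos.2 (by linarith)
    rw [md_of_neg h, md_of_neg h]
    have h3 : √(-K) * s < √(-K) * t := by gcongr
    have := Real.cos_lt_cos_of_nonneg_of_le_pi (by positivity) (hK h) h3
    exact (div_lt_div_right_of_neg h).2 (by linarith)
  · subst h; simp only [md_of_eq_zero]; gcongr
  · have h2 : 0 < √K := Real.sqrt_pos.2 h
    rw [md_of_pos h, md_of_pos h]
    have : Real.cosh (√K * s) < Real.cosh (√K * t) := by
      rw [Real.cosh_lt_cosh, abs_of_nonneg (by positivity), abs_of_nonneg]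
      · gcongr
      · have := hs.trans hst.le; positivity
    gcongr

theorem md_le_md {K s t : ℝ} (hs : 0 ≤ s) (hst : s ≤ t)
    (hK : K < 0 → √(-K) * t ≤ Real.pi) : md K s ≤ md K t := by
  rcases hst.eq_or_lt with h | h
  · rw [h]
  · exact (md_lt_md hs h hK).le

theorem le_of_md_le_md {K s t : ℝ} (ht : 0 ≤ t) (hK : K < 0 → √(-K) * s ≤ Real.pi)
    (h : md K s ≤ md K t) : s ≤ t := by
  by_contra! hc
  exact absurd (md_lt_md ht hc hK) (not_lt.2 h)

theorem md_pos {K s : ℝ} (hs : 0 < s) (hK : K < 0 → √(-K) * s ≤ Real.pi) : 0 < md K s := by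
  simpa [md_zero] using md_lt_md le_rfl hs hK

theorem md_nonneg {K s : ℝ} (hs : 0 ≤ s) (hK : K < 0 → √(-K) * s ≤ Real.pi) : 0 ≤ md K s := by
  simpa [md_zero] using md_le_md le_rfl hs hK

theorem hasDerivAt_sn_zero (K : ℝ) : HasDerivAt (sn K) 1 0 := by
  rcases lt_trichotomy K 0 with h | h | h
  · have h2 : √(-K) ≠ 0 := (Real.sqrt_pos.2 (by linarith)).ne'
    have h1 : HasDerivAt (fun s : ℝ => √(-K) * s) (√(-K)) 0 := by
      simpa using (hasDerivAt_id (0 : ℝ)).const_mul (√(-K))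
    have := (h1.sin).div_const (√(-K))
    simp only [mul_zero, Real.cos_zero, one_mul, div_self h2] at this
    exact this.congr_of_eventuallyEq (Eventually.of_forall fun s => sn_of_neg h s)
  · subst h
    exact (hasDerivAt_id (0 : ℝ)).congr_of_eventuallyEq
      (Eventually.of_forall fun s => sn_of_eq_zero s)
  · have h2 : √K ≠ 0 := (Real.sqrt_pos.2 h).ne'
    have h1 : HasDerivAt (fun s : ℝ => √K * s) (√K) 0 := by
      simpa using (hasDerivAt_id (0 : ℝ)).const_mul (√K)
    have := (h1.sinh).div_const (√K)
    simp only [mul_zero, Real.cosh_zero, one_mul, div_self h2] at this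
    exact this.congr_of_eventuallyEq (Eventually.of_forall fun s => sn_of_pos h s)

theorem tendsto_sn_div (K x : ℝ) :
    Tendsto (fun δ : ℝ => sn K (δ * x) / δ) (𝓝[>] 0) (𝓝 x) := by
  have h0 : HasDerivAt (fun δ : ℝ => δ * x) x 0 := by
    simpa using (hasDerivAt_id (0 : ℝ)).mul_const x
  have h1 : HasDerivAt (fun δ : ℝ => sn K (δ * x)) x 0 := by
    have h2 : HasDerivAt (sn K) 1 ((fun δ : ℝ => δ * x) 0) := by
      simpa using hasDerivAt_sn_zero K
    simpa [Function.comp_def] using h2.comp 0 h0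
  have := hasDerivAt_iff_tendsto_slope_zero.1 h1
  have h3 := this.mono_left (nhdsWithin_mono 0 (fun y (hy : 0 < y) => hy.ne'))
  refine h3.congr fun δ => ?_
  simp [sn_zero, div_eq_inv_mul]

/-- At small scales the geometry becomes Minkowskian. The factorisation sn² = (2 + K md) md from
`sn_sq` reduces the quadratic limit to the linear one for `sn`. -/
theorem tendsto_md_div (K x : ℝ) :
    Tendsto (fun δ : ℝ => md K (δ * x) / δ ^ 2) (𝓝[>] 0) (𝓝 (x ^ 2 / 2)) := by
  have h1 : Tendsto (fun δ : ℝ => 2 + K * md K (δ * x)) (𝓝[>] 0) (𝓝 2) := by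
    have : Continuous fun δ : ℝ => 2 + K * md K (δ * x) := by
      have := continuous_md K
      fun_prop
    have h := (this.tendsto 0).mono_left (nhdsWithin_le_nhds (s := Ioi 0))
    simpa [md_zero] using h
  have h2 := ((tendsto_sn_div K x).pow 2).div h1 two_ne_zero
  refine h2.congr' ?_
  filter_upwards [h1.eventually (lt_mem_nhds one_lt_two)] with δ hδ
  have h3 := sn_sq K (δ * x)
  have h4 : sn K (δ * x) ^ 2 = (2 + K * md K (δ * x)) * md K (δ * x) := by rw [h3]; ring
  rw [Pi.div_apply, div_pow, h4]
  have : (2 + K * md K (δ * x)) ≠ 0 := by linarith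
  field_simp

/-! ### Hinges and the law of cosines -/

/-- For a hinge with side lengths `x`, `y` and opposite side length `z`, all measured with `md`,
the product of the two sides at the vertex of the hinge. -/
def hingeProd (K x y z : ℝ) : ℝ := md K x + md K y + K * md K x * md K y - md K z

/-- The reference hinge is the degenerate one with both sides in the same direction, whose third
side is y - x. `hingeProd_eq_add` uses the hinge with opposite directions and third side x + y. -/
theorem hingeProd_eq_sub (K x y z : ℝ) :
    hingeProd K x y z = md K (y - x) + sn K x * sn K y - md K z := by
  rw [md_sub, hingeProd]; ring

theorem hingeProd_eq_add (K x y z : ℝ) :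
    hingeProd K x y z = md K (x + y) - sn K x * sn K y - md K z := by
  rw [md_add, hingeProd]; ring

theorem hingeProd_comm (K x y z : ℝ) : hingeProd K x y z = hingeProd K y x z := by
  rw [hingeProd, hingeProd]; ring

/-- The comparison of a triangle at an interior point of a side is equivalent to the comparison of
the hinges at an endpoint of that side. -/
theorem hinge_at_endpoint (K u v X Y Z : ℝ) :
    sn K (u + v) * hingeProd K Y u X - sn K u * hingeProd K Y (u + v) Z =
      -(sn K v * hingeProd K u X Y + sn K u * hingeProd K v X Z) := by
  simp only [hingeProd, md_add, sn_add]
  linear_combination (-(md K Y * K * sn K v) - sn K v) * sn_sq K u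

/-- The left side depends on X only through `md K X`, with coefficient `sn K (u + v)`. In the model
it vanishes at the true distance X from the opposite vertex to the point dividing the side into u
and v, so its sign compares X with the model distance. -/
theorem chord_identity (K u v X Y Z : ℝ) :
    sn K v * hingeProd K u X Y + sn K u * hingeProd K v X Z =
      sn K (u + v) * md K X + (sn K v * md K u + sn K u * md K v)
        - sn K v * md K Y - sn K u * md K Z := by
  simp only [hingeProd, sn_add]; ring

end Comparison

namespace Comparison

/-! ### The four-point inequality in spaces with triangle comparison -/

/-- Points `q`, `z`, `r` on a segment of the Minkowski plane, given by their distances `Q`, `Z`, `R`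
from the origin, such that the angles subtended by `q z` and `z r` are `arcosh α`, `arcosh β`. -/
theorem exists_subdivided_hinge {α β : ℝ} (hα : 1 < α) (hβ : 1 < β) :
    ∃ Q Z R D₁ D₂ : ℝ, 0 < Q ∧ Q ≤ Z ∧ Z ≤ R ∧ 0 < D₁ ∧ 0 < D₂ ∧
      D₁ ^ 2 = (Z - Q) ^ 2 - 2 * ((α - 1) * (Q * Z)) ∧
      D₂ ^ 2 = (R - Z) ^ 2 - 2 * ((β - 1) * (Z * R)) ∧
      (R - Q) ^ 2 / 2 + Q * R - (D₁ + D₂) ^ 2 / 2 =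
        (α * β + √(α ^ 2 - 1) * √(β ^ 2 - 1)) * (Q * R) := by
  obtain ⟨s, hs⟩ : ∃ s, s = √(α ^ 2 - 1) := ⟨_, rfl⟩
  obtain ⟨t, ht⟩ : ∃ t, t = √(β ^ 2 - 1) := ⟨_, rfl⟩
  rw [← hs, ← ht]
  have hs0 : 0 < s := hs ▸ Real.sqrt_pos.2 (by nlinarith)
  have ht0 : 0 < t := ht ▸ Real.sqrt_pos.2 (by nlinarith)
  have hs2 : s ^ 2 = α ^ 2 - 1 := hs ▸ Real.sq_sqrt (by nlinarith)
  have ht2 : t ^ 2 = β ^ 2 - 1 := ht ▸ Real.sq_sqrt (by nlinarith)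
  obtain ⟨a, ha⟩ : ∃ a, a = α / s := ⟨_, rfl⟩
  obtain ⟨b, hb⟩ : ∃ b, b = β / t := ⟨_, rfl⟩
  have ha' : α = a * s := by rw [ha]; field_simp
  have hb' : β = b * t := by rw [hb]; field_simp
  have ha1 : 1 < a := by
    rw [ha, lt_div_iff₀ hs0, one_mul]
    exact lt_of_pow_lt_pow_left₀ 2 (by linarith) (by linarith)
  have hb1 : 1 < b := by
    rw [hb, lt_div_iff₀ ht0, one_mul]
    exact lt_of_pow_lt_pow_left₀ 2 (by linarith) (by linarith)
  -- In Minkowski coordinates (time, space) with the middle point at (Z, 0), take q = (a, -1) and r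
  -- = (N b, N). N is chosen so that the segment from q to r has slope (N + 2)/(N + 1) > 1 and is
  -- timelike. It crosses the time axis at height Z and is divided there in the ratio 1 : N.
  obtain ⟨N, hN⟩ : ∃ N, N = (a + 2) / (b - 1) := ⟨_, rfl⟩
  have hb1' : 0 < b - 1 := by linarith
  have hN0 : 0 < N := by rw [hN]; positivity
  have hNb : N * b - a = N + 2 := by
    have : N * (b - 1) = a + 2 := by rw [hN]; field_simp
    linarith
  obtain ⟨Q, hQ⟩ : ∃ Q, Q = 1 / s := ⟨_, rfl⟩
  obtain ⟨R, hR⟩ : ∃ R, R = N / t := ⟨_, rfl⟩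
  obtain ⟨Z, hZ⟩ : ∃ Z, Z = N * (a + b) / (N + 1) := ⟨_, rfl⟩
  have hQ0 : 0 < Q := by rw [hQ]; positivity
  have hR0 : 0 < R := by rw [hR]; positivity
  have hZ0 : 0 < Z := by rw [hZ]; positivity
  have hαQ : α * Q = a := by rw [hQ, ha]; ring
  have hβR : β * R = N * b := by rw [hR, hb]; ring
  have hQ2 : Q ^ 2 = a ^ 2 - 1 := by
    rw [hQ, ha]; field_simp; linarith
  have hR2 : R ^ 2 = N ^ 2 * (b ^ 2 - 1) := by
    rw [hR, hb]; field_simp; linarith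
  have hZa : (Z - a) * (N + 1) = N + 2 := by
    rw [hZ, sub_mul, div_mul_cancel₀ _ (by linarith)]; linarith
  have hZb : (N * b - Z) * (N + 1) = N * (N + 2) := by
    rw [hZ, sub_mul, div_mul_cancel₀ _ (by linarith)]; linear_combination N * hNb
  have hZa1 : 1 < Z - a := by
    by_contra! hc
    have := mul_le_mul_of_nonneg_right hc (by linarith : 0 ≤ N + 1)
    linarith
  have hZb1 : N < N * b - Z := by
    by_contra! hc
    have := mul_le_mul_of_nonneg_right hc (by linarith : 0 ≤ N + 1)
    linarith
  have hDpos : 0 < (N + 2) ^ 2 - (N + 1) ^ 2 := by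
    linarith [show (N + 2) ^ 2 - (N + 1) ^ 2 = 2 * N + 3 by ring]
  obtain ⟨D, hD⟩ : ∃ D, D = √((N + 2) ^ 2 - (N + 1) ^ 2) := ⟨_, rfl⟩
  have hD0 : 0 < D := by rw [hD]; exact Real.sqrt_pos.2 hDpos
  have hD2 : D ^ 2 = (N + 2) ^ 2 - (N + 1) ^ 2 := by
    rw [hD]; exact Real.sq_sqrt hDpos.le
  obtain ⟨D₁, hD₁⟩ : ∃ D₁, D₁ = D / (N + 1) := ⟨_, rfl⟩
  obtain ⟨D₂, hD₂⟩ : ∃ D₂, D₂ = N * D / (N + 1) := ⟨_, rfl⟩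
  have hD₁0 : 0 < D₁ := by rw [hD₁]; positivity
  have hD₂0 : 0 < D₂ := by rw [hD₂]; positivity
  have hDD : D₁ + D₂ = D := by rw [hD₁, hD₂]; field_simp; ring
  have hD₁2 : D₁ ^ 2 = (Z - a) ^ 2 - 1 := by
    have : Z - a = (N + 2) / (N + 1) := by rw [eq_div_iff (by linarith)]; exact hZa
    rw [this, hD₁, div_pow, hD2]; field_simp
  have hD₂2 : D₂ ^ 2 = (N * b - Z) ^ 2 - N ^ 2 := by
    have : N * b - Z = N * (N + 2) / (N + 1) := by rw [eq_div_iff (by linarith)]; exact hZb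
    rw [this, hD₂, div_pow, mul_pow, hD2]; field_simp
  have hQZ : Q ≤ Z := by
    have : 1 * Q ≤ α * Q := by gcongr
    linarith
  have hZR : Z ≤ R := by
    refine le_of_sq_le_sq ?_ hR0.le
    have h1 := mul_pos hZ0 (hN0.trans hZb1)
    have h2 : N ^ 2 < (N * b - Z) ^ 2 := by gcongr
    linarith [show R ^ 2 = (N * b - Z) ^ 2 - N ^ 2 + 2 * (Z * (N * b - Z)) + Z ^ 2 by rw [hR2]; ring]
  refine ⟨Q, Z, R, D₁, D₂, hQ0, hQZ, hZR, hD₁0, hD₂0, ?_, ?_, ?_⟩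
  · linear_combination hD₁2 - hQ2 + 2 * Z * hαQ
  · linear_combination hD₂2 - hR2 + 2 * Z * hβR
  · have e5 : (R - Q) ^ 2 / 2 + Q * R - D ^ 2 / 2 = N * (a * b + 1) := by
      have : N + 2 = N * b - a := hNb.symm
      rw [this] at hD2
      linear_combination hR2 / 2 + hQ2 / 2 - hD2 / 2
    rw [hDD, e5, hQ, hR, ha', hb']
    field_simp

/-- The factor l < 1 leaves room: divided by δ², the difference of the two sides tends to (1 - l²)
D²/2 > 0. -/
theorem eventually_md_lt {K α Q Z D l : ℝ} (hD : 0 < D) (hl : l ∈ Ioo (0 : ℝ) 1)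
    (h : D ^ 2 = (Z - Q) ^ 2 - 2 * ((α - 1) * (Q * Z))) :
    ∀ᶠ δ in 𝓝[>] (0 : ℝ), md K (δ * (l * D)) <
        md K (δ * (Z - Q)) - (α - 1) * (sn K (δ * Q) * sn K (δ * Z)) := by
  have hl2 : l ^ 2 < 1 := pow_lt_one₀ hl.1.le hl.2 two_ne_zero
  have lim := ((tendsto_md_div K (Z - Q)).sub (((tendsto_sn_div K Q).mul
    (tendsto_sn_div K Z)).const_mul (α - 1))).sub (tendsto_md_div K (l * D))
  have pos : 0 < (Z - Q) ^ 2 / 2 - (α - 1) * (Q * Z) - (l * D) ^ 2 / 2 := by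
    have : (Z - Q) ^ 2 / 2 - (α - 1) * (Q * Z) - (l * D) ^ 2 / 2 = (1 - l ^ 2) * D ^ 2 / 2 := by
      linear_combination (-1 / 2) * h
    rw [this]
    have := mul_pos (sub_pos.2 hl2) (pow_pos hD 2)
    linarith
  filter_upwards [lim.eventually (lt_mem_nhds pos), self_mem_nhdsWithin] with δ h1 hδ
  have hδ0 : (0 : ℝ) < δ := hδ
  have hδ2 : 0 < δ ^ 2 := by positivity
  have : md K (δ * (Z - Q)) - (α - 1) * (sn K (δ * Q) * sn K (δ * Z)) - md K (δ * (l * D))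
      = δ ^ 2 * (md K (δ * (Z - Q)) / δ ^ 2
    - (α - 1) * (sn K (δ * Q) / δ * (sn K (δ * Z) / δ)) - md K (δ * (l * D)) / δ ^ 2) := by
    field_simp
  have := this ▸ mul_pos hδ2 h1
  linarith

/-- If every infinitesimal triangulation of a hinge by hinges of angles `arcosh α` and `arcosh β`
bounds its cosine `Γ`, then `Γ` is at most the hyperbolic cosine of the sum of the angles. -/
theorem le_cosh_add_of_infinitesimal {K Γ α β : ℝ} (hα : 1 < α) (hβ : 1 < β)
    (H : ∀ Q Z R d₁ d₂ : ℝ, 0 < Q → Q ≤ Z → Z ≤ R → 0 < d₁ → 0 < d₂ → ∀ᶠ δ in 𝓝[>] (0 : ℝ),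
      md K (δ * d₁) < md K (δ * (Z - Q)) - (α - 1) * (sn K (δ * Q) * sn K (δ * Z)) →
      md K (δ * d₂) < md K (δ * (R - Z)) - (β - 1) * (sn K (δ * Z) * sn K (δ * R)) →
      Γ * (sn K (δ * Q) * sn K (δ * R)) ≤
        md K (δ * (R - Q)) + sn K (δ * Q) * sn K (δ * R) - md K (δ * (d₁ + d₂))) :
    Γ ≤ α * β + √(α ^ 2 - 1) * √(β ^ 2 - 1) := by
  obtain ⟨Q, Z, R, D₁, D₂, hQ0, hQZ, hZR, hD₁0, hD₂0, hD₁, hD₂, hD⟩ :=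
    exists_subdivided_hinge hα hβ
  -- For each fixed l < 1 divide by δ² and let δ → 0; only afterwards let l → 1.
  have key : ∀ l ∈ Ioo (0 : ℝ) 1,
      Γ * (Q * R) ≤ (R - Q) ^ 2 / 2 + Q * R - (l * (D₁ + D₂)) ^ 2 / 2 := by
    intro l hl
    have hev := H Q Z R (l * D₁) (l * D₂) hQ0 hQZ hZR (mul_pos hl.1 hD₁0) (mul_pos hl.1 hD₂0)
    have lim1 := ((tendsto_sn_div K Q).mul (tendsto_sn_div K R)).const_mul Γ
    have lim2 := ((tendsto_md_div K (R - Q)).add ((tendsto_sn_div K Q).mul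
      (tendsto_sn_div K R))).sub (tendsto_md_div K (l * (D₁ + D₂)))
    refine le_of_tendsto_of_tendsto lim1 lim2 ?_
    filter_upwards [hev, eventually_md_lt hD₁0 hl hD₁, eventually_md_lt hD₂0 hl hD₂,
      self_mem_nhdsWithin] with δ h0 h1 h2 hδ
    have hδ0 : (0 : ℝ) < δ := hδ
    have h3 := h0 h1 h2
    rw [← mul_add] at h3
    have e3 : Γ * (sn K (δ * Q) / δ * (sn K (δ * R) / δ))
        = Γ * (sn K (δ * Q) * sn K (δ * R)) / δ ^ 2 := by field_simp
    have e4 : md K (δ * (R - Q)) / δ ^ 2 + sn K (δ * Q) / δ * (sn K (δ * R) / δ)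
        - md K (δ * (l * (D₁ + D₂))) / δ ^ 2
        = (md K (δ * (R - Q)) + sn K (δ * Q) * sn K (δ * R)
          - md K (δ * (l * (D₁ + D₂)))) / δ ^ 2 := by
      field_simp
    rw [e3, e4]
    gcongr
  have lim : Tendsto (fun l : ℝ => (R - Q) ^ 2 / 2 + Q * R - (l * (D₁ + D₂)) ^ 2 / 2) (𝓝[<] 1)
      (𝓝 ((R - Q) ^ 2 / 2 + Q * R - (1 * (D₁ + D₂)) ^ 2 / 2)) := by
    have : Continuous fun l : ℝ => (R - Q) ^ 2 / 2 + Q * R - (l * (D₁ + D₂)) ^ 2 / 2 := by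
      fun_prop
    exact (this.tendsto 1).mono_left nhdsWithin_le_nhds
  have fin := ge_of_tendsto lim (by
    filter_upwards [Ioo_mem_nhdsLT (zero_lt_one' ℝ)] with l hl using key l hl)
  rw [one_mul, hD] at fin
  exact le_of_mul_le_mul_right fin (mul_pos hQ0 (hQ0.trans_le (hQZ.trans hZR)))

end Comparison

/-! ### The four-point inequality as an analytic statement, and abstract comparison spaces -/

namespace Comparison

/-- The four-point inequality in terms of the distances `e = d(p, o)`, `x = d(o, q)`, `y = d(o, r)`,
`X = d(p, q)`, `Y = d(p, r)`, `z = d(q, r)` of four points. -/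
def FourPointIneq (K e x y X Y z : ℝ) : Prop :=
  sn K e ^ 2 * hingeProd K x y z ≤ hingeProd K e x X * hingeProd K e y Y +
    √(hingeProd K e x X ^ 2 - sn K e ^ 2 * sn K x ^ 2) *
      √(hingeProd K e y Y ^ 2 - sn K e ^ 2 * sn K y ^ 2)

theorem FourPointIneq.of_tendsto {ι : Type*} {l : Filter ι} [l.NeBot] {K : ℝ}
    {e x y X Y z : ι → ℝ} {e' x' y' X' Y' z' : ℝ}
    (he : Tendsto e l (𝓝 e')) (hx : Tendsto x l (𝓝 x')) (hy : Tendsto y l (𝓝 y'))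
    (hX : Tendsto X l (𝓝 X')) (hY : Tendsto Y l (𝓝 Y')) (hz : Tendsto z l (𝓝 z'))
    (h : ∀ᶠ i in l, FourPointIneq K (e i) (x i) (y i) (X i) (Y i) (z i)) :
    FourPointIneq K e' x' y' X' Y' z' := by
  have hm : ∀ {f : ι → ℝ} {a : ℝ}, Tendsto f l (𝓝 a) → Tendsto (fun i => md K (f i)) l (𝓝 (md K a)) :=
    fun h => ((continuous_md K).tendsto _).comp h
  have hs : ∀ {f : ι → ℝ} {a : ℝ}, Tendsto f l (𝓝 a) → Tendsto (fun i => sn K (f i)) l (𝓝 (sn K a)) :=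
    fun h => ((continuous_sn K).tendsto _).comp h
  have hp : ∀ {f g k : ι → ℝ} {a b c : ℝ}, Tendsto f l (𝓝 a) → Tendsto g l (𝓝 b) →
      Tendsto k l (𝓝 c) →
      Tendsto (fun i => hingeProd K (f i) (g i) (k i)) l (𝓝 (hingeProd K a b c)) :=
    fun h1 h2 h3 => (((hm h1).add (hm h2)).add (((hm h1).const_mul K).mul (hm h2))).sub (hm h3)
  have hr : ∀ {f g : ι → ℝ} {a b : ℝ}, Tendsto f l (𝓝 a) → Tendsto g l (𝓝 b) →
      Tendsto (fun i => √(hingeProd K (e i) (f i) (g i) ^ 2 - sn K (e i) ^ 2 * sn K (f i) ^ 2)) l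
        (𝓝 √(hingeProd K e' a b ^ 2 - sn K e' ^ 2 * sn K a ^ 2)) :=
    fun h1 h2 => (((hp he h1 h2).pow 2).sub (((hs he).pow 2).mul ((hs h1).pow 2))).sqrt
  exact le_of_tendsto_of_tendsto (((hs he).pow 2).mul (hp hx hy hz))
    (((hp he hx hX).mul (hp he hy hY)).add ((hr hx hX).mul (hr hy hY))) h

/-- The part of the structure of a small neighbourhood with triangle comparison from which the
four-point inequality follows. The curves in `seg` are distance realizers. -/
structure ComparisonSpace (K : ℝ) (Y : Type*) where
  τ : Y → Y → ℝ
  nonneg : ∀ x y, 0 ≤ τ x y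
  small : ∀ x y, K < 0 → √(-K) * τ x y < Real.pi / 4
  tri : ∀ x y z, 0 < τ x y → 0 < τ y z → τ x y + τ y z ≤ τ x z
  seg : (ℝ → Y) → Prop
  seg_exists : ∀ x y, 0 < τ x y → ∃ γ, seg γ ∧ γ 0 = x ∧ γ 1 = y
  seg_pos : ∀ γ, seg γ → ∀ s t, 0 ≤ s → s < t → t ≤ 1 → 0 < τ (γ s) (γ t)
  seg_add : ∀ γ, seg γ → ∀ r s t, 0 ≤ r → r < s → s < t → t ≤ 1 →
    τ (γ r) (γ t) = τ (γ r) (γ s) + τ (γ s) (γ t)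
  seg_cont_left : ∀ γ, seg γ → ∀ w, ContinuousOn (fun s => τ (γ s) w) (Icc 0 1)
  seg_cont_right : ∀ γ, seg γ → ∀ w, ContinuousOn (fun s => τ w (γ s)) (Icc 0 1)
  compare : ∀ γ, seg γ → ∀ r s t, 0 ≤ r → r < s → s < t → t ≤ 1 → ∀ c,
    (0 < τ (γ t) c ∨ 0 < τ c (γ r) ∨
      (0 < τ (γ r) c ∧ 0 < τ c (γ t) ∧ (0 < τ (γ s) c ∨ 0 < τ c (γ s)))) →
    sn K (τ (γ s) (γ t)) * hingeProd K (τ (γ r) (γ s)) (τ (γ s) c + τ c (γ s))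
        (τ (γ r) c + τ c (γ r)) +
      sn K (τ (γ r) (γ s)) * hingeProd K (τ (γ s) (γ t)) (τ (γ s) c + τ c (γ s))
        (τ (γ t) c + τ c (γ t)) ≤ 0

namespace ComparisonSpace

variable {K : ℝ} {Y : Type*} (S : ComparisonSpace K Y)

/-- The time reversal of a comparison space. -/
def reverse : ComparisonSpace K Y where
  τ x y := S.τ y x
  nonneg x y := S.nonneg y x
  small x y := S.small y x
  tri x y z h1 h2 := by linarith [S.tri z y x h2 h1]
  seg γ := S.seg fun s => γ (1 - s)
  seg_exists x y h := by
    obtain ⟨γ, h1, h2, h3⟩ := S.seg_exists y x h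
    exact ⟨fun s => γ (1 - s), by simpa using h1, by simpa using h3, by simpa using h2⟩
  seg_pos γ h s t hs hst ht := by
    have := S.seg_pos _ h (1 - t) (1 - s) (by linarith) (by linarith) (by linarith)
    simpa using this
  seg_add γ h r s t hr hrs hst ht := by
    have := S.seg_add _ h (1 - t) (1 - s) (1 - r) (by linarith) (by linarith) (by linarith)
      (by linarith)
    simp only [sub_sub_cancel] at this
    linarith
  seg_cont_left γ h w := by
    have := (S.seg_cont_right _ h w).comp (t := Icc (0 : ℝ) 1) (s := Icc (0 : ℝ) 1)
      (f := fun s => 1 - s) (by fun_prop)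
      (fun s hs => ⟨by linarith [hs.2], by linarith [hs.1]⟩)
    simpa [Function.comp_def] using this
  seg_cont_right γ h w := by
    have := (S.seg_cont_left _ h w).comp (t := Icc (0 : ℝ) 1) (s := Icc (0 : ℝ) 1)
      (f := fun s => 1 - s) (by fun_prop)
      (fun s hs => ⟨by linarith [hs.2], by linarith [hs.1]⟩)
    simpa [Function.comp_def] using this
  compare γ h r s t hr hrs hst ht c hc := by
    have := S.compare _ h (1 - t) (1 - s) (1 - r) (by linarith) (by linarith) (by linarith)
      (by linarith) c (by simp only [sub_sub_cancel]; tauto)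
    simp only [sub_sub_cancel] at this
    simp only [add_comm (S.τ c _) (S.τ _ c)]
    linarith

theorem small_pi (x y : Y) (hK : K < 0) : √(-K) * S.τ x y < Real.pi :=
  (S.small x y hK).trans (by linarith [Real.pi_pos])

theorem small_pi_div_two (x y : Y) (hK : K < 0) : √(-K) * S.τ x y < Real.pi / 2 :=
  (S.small x y hK).trans (by linarith [Real.pi_pos])

theorem sn_pos {x y : Y} (h : 0 < S.τ x y) : 0 < sn K (S.τ x y) :=
  Comparison.sn_pos h (S.small_pi x y)

theorem self_eq_zero (x : Y) : S.τ x x = 0 := by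
  by_contra h
  have h1 : 0 < S.τ x x := lt_of_le_of_ne (S.nonneg x x) (Ne.symm h)
  linarith [S.tri x x x h1 h1]

theorem eq_zero_of_pos {x y : Y} (h : 0 < S.τ x y) : S.τ y x = 0 := by
  by_contra h1
  have h2 : 0 < S.τ y x := lt_of_le_of_ne (S.nonneg y x) (Ne.symm h1)
  linarith [S.tri x y x h h2, S.self_eq_zero x]

theorem pos_trans {x y z : Y} (h1 : 0 < S.τ x y) (h2 : 0 < S.τ y z) : 0 < S.τ x z := by
  linarith [S.tri x y z h1 h2]

theorem exists_point {σ : ℝ → Y} (hσ : S.seg σ) {s₀ s₁ x : ℝ} (hs₀ : 0 ≤ s₀) (hs : s₀ < s₁)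
    (hs₁ : s₁ ≤ 1) (hx : 0 < x) (hx1 : x ≤ S.τ (σ s₀) (σ s₁)) :
    ∃ s, s₀ < s ∧ s ≤ s₁ ∧ S.τ (σ s₀) (σ s) = x := by
  have hc : ContinuousOn (fun s => S.τ (σ s₀) (σ s)) (Icc s₀ s₁) :=
    (S.seg_cont_right σ hσ _).mono (Icc_subset_Icc hs₀ hs₁)
  obtain ⟨s, hs, hsx⟩ := intermediate_value_Icc hs.le hc
    ⟨by rw [S.self_eq_zero]; exact hx.le, hx1⟩
  refine ⟨s, lt_of_le_of_ne hs.1 ?_, hs.2, hsx⟩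
  rintro rfl
  simp only [S.self_eq_zero] at hsx
  exact hx.ne hsx

/-- Monotonicity of the comparison hinges at the starting point of a segment. -/
theorem hinge_mono {σ : ℝ → Y} (hσ : S.seg σ) {s : ℝ} (hs : 0 < s) (hs1 : s ≤ 1) {c : Y}
    (hc : 0 < S.τ (σ 1) c ∨ 0 < S.τ c (σ 0) ∨
      (0 < S.τ (σ 0) c ∧ 0 < S.τ c (σ 1) ∧ (0 < S.τ (σ s) c ∨ 0 < S.τ c (σ s)))) :
    sn K (S.τ (σ 0) (σ s)) * hingeProd K (S.τ (σ 0) c + S.τ c (σ 0)) (S.τ (σ 0) (σ 1))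
        (S.τ (σ 1) c + S.τ c (σ 1)) ≤
      sn K (S.τ (σ 0) (σ 1)) * hingeProd K (S.τ (σ 0) c + S.τ c (σ 0)) (S.τ (σ 0) (σ s))
        (S.τ (σ s) c + S.τ c (σ s)) := by
  rcases hs1.eq_or_lt with rfl | hs1
  · exact le_rfl
  have h1 := S.compare σ hσ 0 s 1 le_rfl hs hs1 le_rfl c hc
  have h2 := S.seg_add σ hσ 0 s 1 le_rfl hs hs1 le_rfl
  have h3 := hinge_at_endpoint K (S.τ (σ 0) (σ s)) (S.τ (σ s) (σ 1)) (S.τ (σ s) c + S.τ c (σ s))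
    (S.τ (σ 0) c + S.τ c (σ 0)) (S.τ (σ 1) c + S.τ c (σ 1))
  rw [← h2] at h3
  linarith

/-- By the reverse triangle inequality, a hinge with one past-directed and one future-directed side
has signed cosine at most -1. -/
theorem hingeProd_le_neg {e x X : ℝ} (he : 0 ≤ e) (hx : 0 ≤ x) (hX : e + x ≤ X)
    (hK : K < 0 → √(-K) * X ≤ Real.pi) : hingeProd K e x X ≤ -(sn K e * sn K x) := by
  rw [hingeProd_eq_add]
  linarith [md_le_md (K := K) (add_nonneg he hx) hX hK]

/-- If the hinges at the starting point of a segment have angle at most `arcosh α`, then the points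
of the segment are timelike related to `w` as long as their comparison points are. -/
theorem pos_of_hinge {σ : ℝ → Y} (hσ : S.seg σ) {s₀ s₁ α : ℝ} (hs₀ : 0 ≤ s₀) (hs : s₀ < s₁)
    (hs₁ : s₁ ≤ 1) (hα : 1 ≤ α) {w : Y} (hw : 0 < S.τ (σ s₀) w)
    (h : ∀ s, s₀ < s → s ≤ s₁ → 0 < S.τ (σ s) w →
      hingeProd K (S.τ (σ s₀) (σ s)) (S.τ (σ s₀) w) (S.τ (σ s) w) ≤
        α * (sn K (S.τ (σ s₀) (σ s)) * sn K (S.τ (σ s₀) w)))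
    (hle : S.τ (σ s₀) (σ s₁) ≤ S.τ (σ s₀) w)
    (hpos : 0 < md K (S.τ (σ s₀) w - S.τ (σ s₀) (σ s₁)) -
      (α - 1) * (sn K (S.τ (σ s₀) (σ s₁)) * sn K (S.τ (σ s₀) w))) :
    0 < S.τ (σ s₁) w := by
  by_contra hcon
  have h0 : S.τ (σ s₁) w = 0 := le_antisymm (not_lt.1 hcon) (S.nonneg _ _)
  set κ := md K (S.τ (σ s₀) w - S.τ (σ s₀) (σ s₁)) -
      (α - 1) * (sn K (S.τ (σ s₀) (σ s₁)) * sn K (S.τ (σ s₀) w)) with hκ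
  -- If τ (σ s₁) w were 0, continuity would give an earlier s with τ (σ s) w = η > 0 and md η < κ.
  -- The hinge bound at s forces md η ≥ κ.
  have hsmall : ∀ᶠ η in 𝓝[>] (0 : ℝ), md K η < κ := by
    have := ((continuous_md K).tendsto 0).mono_left (nhdsWithin_le_nhds (s := Ioi 0))
    rw [md_zero] at this
    exact this.eventually (gt_mem_nhds hpos)
  obtain ⟨η, ⟨hη, hη0, hηw⟩⟩ := (hsmall.and (Ioo_mem_nhdsGT hw)).exists
  have hc : ContinuousOn (fun s => S.τ (σ s) w) (Icc s₀ s₁) :=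
    (S.seg_cont_left σ hσ w).mono (Icc_subset_Icc hs₀ hs₁)
  obtain ⟨s, hs', hsη⟩ := intermediate_value_Icc' hs.le hc
    ⟨by rw [h0]; exact hη0.le, hηw.le⟩
  simp only at hsη
  have hss : s₀ < s := by
    refine lt_of_le_of_ne hs'.1 ?_
    rintro rfl
    exact hηw.ne' hsη
  have h2 := h s hss hs'.2 (by rw [hsη]; exact hη0)
  rw [hingeProd_eq_sub, hsη] at h2
  have hmono : S.τ (σ s₀) (σ s) ≤ S.τ (σ s₀) (σ s₁) := by
    rcases hs'.2.eq_or_lt with h | h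
    · rw [h]
    · rw [S.seg_add σ hσ s₀ s s₁ hs₀ hss h hs₁]
      linarith [S.nonneg (σ s) (σ s₁)]
  have h3 : md K (S.τ (σ s₀) w - S.τ (σ s₀) (σ s₁)) ≤ md K (S.τ (σ s₀) w - S.τ (σ s₀) (σ s)) := by
    refine md_le_md (by linarith) (by linarith) fun hK => ?_
    have := S.small_pi (σ s₀) w hK
    have h4 : √(-K) * (S.τ (σ s₀) w - S.τ (σ s₀) (σ s)) ≤ √(-K) * S.τ (σ s₀) w := by
      gcongr; linarith [S.nonneg (σ s₀) (σ s)]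
    linarith
  have h5 : sn K (S.τ (σ s₀) (σ s)) ≤ sn K (S.τ (σ s₀) (σ s₁)) :=
    sn_le_sn (S.nonneg _ _) hmono fun hK => (S.small_pi_div_two _ _ hK).le
  have h6 : (α - 1) * (sn K (S.τ (σ s₀) (σ s)) * sn K (S.τ (σ s₀) w)) ≤
      (α - 1) * (sn K (S.τ (σ s₀) (σ s₁)) * sn K (S.τ (σ s₀) w)) := by
    have := (S.sn_pos hw).le
    have : 0 ≤ α - 1 := by linarith
    gcongr
  linarith

end ComparisonSpace

end Comparison

/-! ### Angles at a point of a segment, and the four-point inequality -/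

namespace Comparison

namespace ComparisonSpace

variable {K : ℝ} {Y : Type*} (S : ComparisonSpace K Y)

/-- At a point `p` in the interior of a segment `γ`, the angle between `γ` and another segment `ρ` is
at most the comparison angle between `ρ` and the opposite direction of `γ`. -/
theorem adjacent_hinge_bound {γ ρ : ℝ → Y} (hγ : S.seg γ) (hρ : S.seg ρ) {t₀ t s : ℝ} (ht₀ : 0 < t₀)
    (ht : t₀ < t) (ht1 : t ≤ 1) (hs : 0 < s) (hs1 : s ≤ 1) (h0 : ρ 0 = γ t₀)
    (hrel : 0 < S.τ (ρ s) (γ t) ∨ 0 < S.τ (γ t) (ρ s)) :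
    hingeProd K (S.τ (γ t₀) (γ t)) (S.τ (γ t₀) (ρ s)) (S.τ (γ t) (ρ s) + S.τ (ρ s) (γ t)) ≤
      -hingeProd K (S.τ (γ 0) (γ t₀)) (S.τ (γ t₀) (ρ 1)) (S.τ (γ 0) (ρ 1)) /
        (sn K (S.τ (γ 0) (γ t₀)) * sn K (S.τ (γ t₀) (ρ 1))) *
        (sn K (S.τ (γ t₀) (γ t)) * sn K (S.τ (γ t₀) (ρ s))) := by
  have p0 : 0 < S.τ (γ 0) (γ t₀) := S.seg_pos γ hγ _ _ le_rfl ht₀ (by linarith)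
  have pt : 0 < S.τ (γ t₀) (γ t) := S.seg_pos γ hγ _ _ ht₀.le ht ht1
  have ps : 0 < S.τ (γ t₀) (ρ s) := h0 ▸ S.seg_pos ρ hρ _ _ le_rfl hs hs1
  have p1 : 0 < S.τ (γ t₀) (ρ 1) := h0 ▸ S.seg_pos ρ hρ _ _ le_rfl zero_lt_one le_rfl
  have q0 := S.pos_trans p0 ps
  have q1 := S.pos_trans p0 p1
  -- Monotonicity along ρ, seen from γ 0, passes from ρ 1 to ρ s. Then comparison at the interior
  -- point γ t₀ of γ, with opposite vertex ρ s, turns the hinge with the past part of γ into the one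
  -- with its future part.
  have h1 := S.hinge_mono hρ hs hs1 (c := γ 0) (Or.inr (Or.inl (h0 ▸ p0)))
  rw [h0, S.eq_zero_of_pos p0, S.eq_zero_of_pos q1, S.eq_zero_of_pos q0, zero_add, zero_add,
    zero_add] at h1
  have h2 := S.compare γ hγ 0 t₀ t le_rfl ht₀ ht ht1 (ρ s) (by
    rcases hrel with h | h
    · exact Or.inr (Or.inr ⟨q0, h, Or.inl ps⟩)
    · exact Or.inl h)
  rw [S.eq_zero_of_pos ps, S.eq_zero_of_pos q0, add_zero, add_zero] at h2
  have e0 := S.sn_pos p0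
  have et := S.sn_pos pt
  have es := S.sn_pos ps
  have e1 := S.sn_pos p1
  rw [div_mul_eq_mul_div, le_div_iff₀ (by positivity)]
  have h3 := mul_le_mul_of_nonneg_left h1 et.le
  have h4 := mul_le_mul_of_nonneg_left h2 e1.le
  linarith

theorem pos_of_pos_right {γ : ℝ → Y} (hγ : S.seg γ) {s : ℝ} (hs1 : s ≤ 1) (hs : 0 ≤ s) {w : Y}
    (h : 0 < S.τ (γ 1) w) : 0 < S.τ (γ s) w := by
  rcases hs1.eq_or_lt with rfl | h1
  · exact h
  · exact S.pos_trans (S.seg_pos γ hγ s 1 hs h1 le_rfl) h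

theorem pos_of_pos_left {γ : ℝ → Y} (hγ : S.seg γ) {s : ℝ} (hs1 : s ≤ 1) (hs : 0 ≤ s) {w : Y}
    (h : 0 < S.τ w (γ s)) : 0 < S.τ w (γ 1) := by
  rcases hs1.eq_or_lt with rfl | h1
  · exact h
  · exact S.pos_trans h (S.seg_pos γ hγ s 1 hs h1 le_rfl)

/-- At o = γ t₀ the segments σ to x₃ and ρ to x₄ make with the continuation of γ angles of
hyperbolic cosine at most α and β. Points q on σ, z on γ, r on ρ are placed at distances δQ, δZ, δR
from o, as on a subdivided Minkowski hinge. The angle bounds give lower bounds for τ(q, z) and τ(z,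
r), hence for τ(q, r), hence an upper bound for the hinge at o over q, r. Monotonicity carries it
over to the hinge over x₃, x₄. -/
theorem hinge_cos_le {γ : ℝ → Y} (hγ : S.seg γ) {t₀ : ℝ} (ht₀ : 0 < t₀) (ht1 : t₀ < 1)
    {x₃ x₄ : Y} (h3 : 0 < S.τ (γ t₀) x₃) (h34 : 0 < S.τ x₃ x₄) {α β : ℝ} (hα : 1 < α) (hβ : 1 < β)
    (hα' : -hingeProd K (S.τ (γ 0) (γ t₀)) (S.τ (γ t₀) x₃) (S.τ (γ 0) x₃) /
        (sn K (S.τ (γ 0) (γ t₀)) * sn K (S.τ (γ t₀) x₃)) ≤ α)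
    (hβ' : -hingeProd K (S.τ (γ 0) (γ t₀)) (S.τ (γ t₀) x₄) (S.τ (γ 0) x₄) /
        (sn K (S.τ (γ 0) (γ t₀)) * sn K (S.τ (γ t₀) x₄)) ≤ β) :
    hingeProd K (S.τ (γ t₀) x₃) (S.τ (γ t₀) x₄) (S.τ x₃ x₄) /
      (sn K (S.τ (γ t₀) x₃) * sn K (S.τ (γ t₀) x₄)) ≤ α * β + √(α ^ 2 - 1) * √(β ^ 2 - 1) := by
  have h4 := S.pos_trans h3 h34
  obtain ⟨σ, hσ, hσ0, rfl⟩ := S.seg_exists _ _ h3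
  obtain ⟨ρ, hρ, hρ0, rfl⟩ := S.seg_exists _ _ h4
  have p1 : 0 < S.τ (γ t₀) (γ 1) := S.seg_pos γ hγ _ _ ht₀.le ht1 le_rfl
  refine le_cosh_add_of_infinitesimal (K := K) hα hβ fun Q Z R d₁ d₂ hQ hQZ hZR hd₁ hd₂ => ?_
  have hlim : ∀ c : ℝ, Tendsto (fun δ : ℝ => δ * c) (𝓝[>] 0) (𝓝 0) := fun c => by
    have : Continuous fun δ : ℝ => δ * c := by fun_prop
    simpa using (this.tendsto 0).mono_left (nhdsWithin_le_nhds (s := Ioi 0))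
  have hlim' : ∀ c : ℝ, Tendsto (fun δ : ℝ => √(-K) * (δ * c)) (𝓝[>] 0) (𝓝 0) := fun c => by
    simpa using (hlim c).const_mul (√(-K))
  filter_upwards [self_mem_nhdsWithin, (hlim Q).eventually (gt_mem_nhds h3),
    (hlim Z).eventually (gt_mem_nhds p1), (hlim R).eventually (gt_mem_nhds h4),
    (hlim' d₁).eventually (gt_mem_nhds Real.pi_pos),
    (hlim' d₂).eventually (gt_mem_nhds Real.pi_pos)] with δ hδ hδQ hδZ hδR hδ₁ hδ₂ hyp₁ hyp₂
  have hδ0 : (0 : ℝ) < δ := hδ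
  have hZ : 0 < Z := hQ.trans_le hQZ
  have hR : 0 < R := hZ.trans_le hZR
  obtain ⟨s, hs0, hs1, hsQ⟩ := S.exists_point hσ le_rfl zero_lt_one le_rfl (mul_pos hδ0 hQ)
    (by rw [hσ0]; exact hδQ.le)
  obtain ⟨t, htt, ht1', htZ⟩ := S.exists_point hγ ht₀.le ht1 le_rfl (mul_pos hδ0 hZ) hδZ.le
  obtain ⟨r, hr0, hr1, hrR⟩ := S.exists_point hρ le_rfl zero_lt_one le_rfl (mul_pos hδ0 hR)
    (by rw [hρ0]; exact hδR.le)
  rw [hσ0] at hsQ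
  rw [hρ0] at hrR
  have pq : 0 < S.τ (γ t₀) (σ s) := by rw [hsQ]; positivity
  have pz : 0 < S.τ (γ t₀) (γ t) := by rw [htZ]; positivity
  have pr : 0 < S.τ (γ t₀) (ρ r) := by rw [hrR]; positivity
  have m₁ : 0 ≤ md K (δ * d₁) := md_nonneg (by positivity) fun _ => hδ₁.le
  have m₂ : 0 ≤ md K (δ * d₂) := md_nonneg (by positivity) fun _ => hδ₂.le
  -- The bound is needed for all points of σ up to q, since `pos_of_hinge` is a continuity argument
  -- along σ.
  have b₁ : ∀ s', 0 < s' → s' ≤ s → 0 < S.τ (σ s') (γ t) →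
      hingeProd K (S.τ (γ t₀) (σ s')) (S.τ (γ t₀) (γ t)) (S.τ (σ s') (γ t)) ≤
        α * (sn K (S.τ (γ t₀) (σ s')) * sn K (S.τ (γ t₀) (γ t))) := by
    intro s' hs' hss' hp
    have := S.adjacent_hinge_bound hγ hσ ht₀ htt ht1' hs' (hss'.trans hs1) hσ0 (Or.inl hp)
    rw [S.eq_zero_of_pos hp, zero_add] at this
    rw [hingeProd_comm, mul_comm (sn K (S.τ (γ t₀) (σ s')))]
    refine this.trans (mul_le_mul_of_nonneg_right hα' ?_)
    have := S.seg_pos σ hσ 0 s' le_rfl hs' (hss'.trans hs1)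
    rw [hσ0] at this
    exact mul_nonneg (S.sn_pos pz).le (S.sn_pos this).le
  -- q ≪ z holds because the comparison points are timelike related: `hyp₁` makes the relevant `md`
  -- expression positive.
  have qz : 0 < S.τ (σ s) (γ t) := by
    refine S.pos_of_hinge hσ le_rfl hs0 hs1 hα.le (w := γ t) (by rw [hσ0]; exact pz) ?_ ?_ ?_
    · rw [hσ0]; exact b₁
    · rw [hσ0, hsQ, htZ]; gcongr
    · rw [hσ0, hsQ, htZ, ← mul_sub]; linarith
  have b₂ : ∀ t', t₀ < t' → t' ≤ t → 0 < S.τ (γ t') (ρ r) →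
      hingeProd K (S.τ (γ t₀) (γ t')) (S.τ (γ t₀) (ρ r)) (S.τ (γ t') (ρ r)) ≤
        β * (sn K (S.τ (γ t₀) (γ t')) * sn K (S.τ (γ t₀) (ρ r))) := by
    intro t' ht' htt' hp
    have := S.adjacent_hinge_bound hγ hρ ht₀ ht' (htt'.trans ht1') hr0 hr1 hρ0 (Or.inr hp)
    rw [S.eq_zero_of_pos hp, add_zero] at this
    refine this.trans (mul_le_mul_of_nonneg_right hβ' ?_)
    have := S.seg_pos γ hγ t₀ t' ht₀.le ht' (htt'.trans ht1')
    exact mul_nonneg (S.sn_pos this).le (S.sn_pos pr).le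
  have zr : 0 < S.τ (γ t) (ρ r) := by
    refine S.pos_of_hinge hγ ht₀.le htt ht1' hβ.le (w := ρ r) pr b₂ ?_ ?_
    · rw [hrR, htZ]; gcongr
    · rw [hrR, htZ, ← mul_sub]; linarith
  have l₁ : δ * d₁ ≤ S.τ (σ s) (γ t) := by
    refine le_of_md_le_md (K := K) (S.nonneg _ _) (fun _ => hδ₁.le) ?_
    have := b₁ s hs0 le_rfl qz
    rw [hingeProd_eq_sub, hsQ, htZ, ← mul_sub] at this
    linarith
  have l₂ : δ * d₂ ≤ S.τ (γ t) (ρ r) := by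
    refine le_of_md_le_md (K := K) (S.nonneg _ _) (fun _ => hδ₂.le) ?_
    have := b₂ t htt le_rfl zr
    rw [hingeProd_eq_sub, hrR, htZ, ← mul_sub] at this
    linarith
  have qr := S.pos_trans qz zr
  have l : δ * (d₁ + d₂) ≤ S.τ (σ s) (ρ r) := by linarith [S.tri _ _ _ qz zr]
  have ml : md K (δ * (d₁ + d₂)) ≤ md K (S.τ (σ s) (ρ r)) :=
    md_le_md (by positivity) l fun hK => (S.small_pi _ _ hK).le
  have q4 : 0 < S.τ (σ s) (ρ 1) := S.pos_of_pos_left hρ hr1 hr0.le qr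
  -- Two monotonicity steps at o: first x₃ is replaced by q with x₄ fixed, then x₄ by r with q
  -- fixed. In the second step q lies chronologically between the endpoints of ρ, so its relation to
  -- r has to be supplied.
  have g₁ := S.hinge_mono hσ hs0 hs1 (c := ρ 1) (Or.inl h34)
  have g₂ := S.hinge_mono hρ hr0 hr1 (c := σ s)
    (Or.inr (Or.inr ⟨by rw [hρ0]; exact pq, q4, Or.inr qr⟩))
  rw [hσ0, S.eq_zero_of_pos h4, S.eq_zero_of_pos h34, S.eq_zero_of_pos q4] at g₁
  rw [hρ0, S.eq_zero_of_pos pq, S.eq_zero_of_pos q4, S.eq_zero_of_pos qr] at g₂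
  simp only [add_zero, zero_add] at g₁ g₂
  have e3 := S.sn_pos h3
  have e4 := S.sn_pos h4
  have er := S.sn_pos pr
  have g₃ : hingeProd K (S.τ (γ t₀) (σ 1)) (S.τ (γ t₀) (ρ 1)) (S.τ (σ 1) (ρ 1)) *
      (sn K (δ * Q) * sn K (δ * R)) ≤ hingeProd K (δ * Q) (δ * R) (S.τ (σ s) (ρ r)) *
        (sn K (S.τ (γ t₀) (σ 1)) * sn K (S.τ (γ t₀) (ρ 1))) := by
    have i₁ := mul_le_mul_of_nonneg_left g₁ er.le
    have i₂ := mul_le_mul_of_nonneg_left g₂ e3.le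
    rw [hingeProd_comm K (S.τ (γ t₀) (ρ 1)), hingeProd_comm K (S.τ (γ t₀) (ρ 1))] at i₁
    rw [hsQ, hrR] at i₁ i₂
    linarith
  rw [div_mul_eq_mul_div, div_le_iff₀ (mul_pos e3 e4)]
  refine g₃.trans (mul_le_mul_of_nonneg_right ?_ (mul_pos e3 e4).le)
  rw [hingeProd_eq_sub, ← mul_sub]
  linarith

theorem fourPoint_interior {γ : ℝ → Y} (hγ : S.seg γ) {t₀ : ℝ} (ht₀ : 0 < t₀) (ht1 : t₀ < 1)
    {x₃ x₄ : Y} (h3 : 0 < S.τ (γ t₀) x₃) (h34 : 0 < S.τ x₃ x₄) :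
    FourPointIneq K (S.τ (γ 0) (γ t₀)) (S.τ (γ t₀) x₃) (S.τ (γ t₀) x₄) (S.τ (γ 0) x₃)
      (S.τ (γ 0) x₄) (S.τ x₃ x₄) := by
  have h4 := S.pos_trans h3 h34
  have h0 : 0 < S.τ (γ 0) (γ t₀) := S.seg_pos γ hγ _ _ le_rfl ht₀ ht1.le
  have e0 := S.sn_pos h0
  have e3 := S.sn_pos h3
  have e4 := S.sn_pos h4
  have main := fun {α β : ℝ} => S.hinge_cos_le hγ ht₀ ht1 h3 h34 (α := α) (β := β)
  have hA := hingeProd_le_neg (K := K) (S.nonneg (γ 0) (γ t₀)) (S.nonneg (γ t₀) x₃)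
    (S.tri _ _ _ h0 h3) fun hK => (S.small_pi _ _ hK).le
  have hB := hingeProd_le_neg (K := K) (S.nonneg (γ 0) (γ t₀)) (S.nonneg (γ t₀) x₄)
    (S.tri _ _ _ h0 h4) fun hK => (S.small_pi _ _ hK).le
  unfold FourPointIneq
  generalize hingeProd K (S.τ (γ 0) (γ t₀)) (S.τ (γ t₀) x₃) (S.τ (γ 0) x₃) = A at *
  generalize hingeProd K (S.τ (γ 0) (γ t₀)) (S.τ (γ t₀) x₄) (S.τ (γ 0) x₄) = B at *
  generalize hingeProd K (S.τ (γ t₀) x₃) (S.τ (γ t₀) x₄) (S.τ x₃ x₄) = C at *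
  generalize sn K (S.τ (γ 0) (γ t₀)) = u at *
  generalize sn K (S.τ (γ t₀) x₃) = v at *
  generalize sn K (S.τ (γ t₀) x₄) = w at *
  obtain ⟨α, hα⟩ : ∃ α, α = -A / (u * v) := ⟨_, rfl⟩
  obtain ⟨β, hβ⟩ : ∃ β, β = -B / (u * w) := ⟨_, rfl⟩
  have hα1 : 1 ≤ α := by rw [hα, le_div_iff₀ (by positivity)]; linarith
  have hβ1 : 1 ≤ β := by rw [hβ, le_div_iff₀ (by positivity)]; linarith
  -- α and β may equal 1, where `hinge_cos_le` does not apply. They are enlarged by η, and η → 0.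
  have lim : Tendsto (fun η : ℝ => (α + η) * (β + η) + √((α + η) ^ 2 - 1) * √((β + η) ^ 2 - 1))
      (𝓝[>] 0) (𝓝 ((α + 0) * (β + 0) + √((α + 0) ^ 2 - 1) * √((β + 0) ^ 2 - 1))) := by
    have : Continuous fun η : ℝ =>
        (α + η) * (β + η) + √((α + η) ^ 2 - 1) * √((β + η) ^ 2 - 1) := by fun_prop
    exact (this.tendsto 0).mono_left nhdsWithin_le_nhds
  have hΓ := ge_of_tendsto lim (by
    filter_upwards [self_mem_nhdsWithin] with η hη
    have : (0 : ℝ) < η := hη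
    exact main (by linarith) (by linarith) (by rw [← hα]; linarith) (by rw [← hβ]; linarith))
  rw [add_zero, add_zero, div_le_iff₀ (by positivity)] at hΓ
  have hA' : A = -(α * (u * v)) := by rw [hα]; field_simp
  have hB' : B = -(β * (u * w)) := by rw [hβ]; field_simp
  have r₁ : √(A ^ 2 - u ^ 2 * v ^ 2) = u * v * √(α ^ 2 - 1) := by
    rw [hA', show (-(α * (u * v))) ^ 2 - u ^ 2 * v ^ 2 = (u * v) ^ 2 * (α ^ 2 - 1) by ring,
      Real.sqrt_mul (by positivity), Real.sqrt_sq (by positivity)]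
  have r₂ : √(B ^ 2 - u ^ 2 * w ^ 2) = u * w * √(β ^ 2 - 1) := by
    rw [hB', show (-(β * (u * w))) ^ 2 - u ^ 2 * w ^ 2 = (u * w) ^ 2 * (β ^ 2 - 1) by ring,
      Real.sqrt_mul (by positivity), Real.sqrt_sq (by positivity)]
  rw [r₁, r₂, hA', hB']
  have := mul_le_mul_of_nonneg_left hΓ (sq_nonneg u)
  linarith

theorem tendsto_left {γ : ℝ → Y} (hγ : S.seg γ) (w : Y) :
    Tendsto (fun s => S.τ (γ s) w) (𝓝[<] 1) (𝓝 (S.τ (γ 1) w)) := by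
  have := S.seg_cont_left γ hγ w 1 ⟨zero_le_one, le_rfl⟩
  exact this.mono_left (nhdsWithin_le_of_mem
    (mem_of_superset (Ioo_mem_nhdsLT zero_lt_one) Ioo_subset_Icc_self))

theorem tendsto_right {γ : ℝ → Y} (hγ : S.seg γ) (w : Y) :
    Tendsto (fun s => S.τ w (γ s)) (𝓝[<] 1) (𝓝 (S.τ w (γ 1))) := by
  have := S.seg_cont_right γ hγ w 1 ⟨zero_le_one, le_rfl⟩
  exact this.mono_left (nhdsWithin_le_of_mem
    (mem_of_superset (Ioo_mem_nhdsLT zero_lt_one) Ioo_subset_Icc_self))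

/-- The four-point inequality follows from triangle comparison. The last hypothesis holds for
`x₃ ≤ x₄`. -/
theorem fourPoint {x₁ x₂ x₃ x₄ : Y} (h12 : 0 < S.τ x₁ x₂) (h23 : 0 < S.τ x₂ x₃)
    (h34 : ∀ y, 0 < S.τ y x₃ → 0 < S.τ y x₄) :
    FourPointIneq K (S.τ x₁ x₂) (S.τ x₂ x₃) (S.τ x₂ x₄) (S.τ x₁ x₃) (S.τ x₁ x₄) (S.τ x₃ x₄) := by
  -- Here x₂ is pulled back along a segment from x₁, so that the segment continues beyond the
  -- vertex, and the inequality passes to the limit.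
  have strict : ∀ z, 0 < S.τ x₂ z → 0 < S.τ z x₄ → FourPointIneq K (S.τ x₁ x₂) (S.τ x₂ z)
      (S.τ x₂ x₄) (S.τ x₁ z) (S.τ x₁ x₄) (S.τ z x₄) := by
    intro z h2z hz4
    obtain ⟨γ, hγ, rfl, rfl⟩ := S.seg_exists _ _ h12
    refine FourPointIneq.of_tendsto (l := 𝓝[<] (1 : ℝ)) (S.tendsto_right hγ _)
      (S.tendsto_left hγ z) (S.tendsto_left hγ x₄) tendsto_const_nhds tendsto_const_nhds
      tendsto_const_nhds ?_
    filter_upwards [Ioo_mem_nhdsLT (zero_lt_one' ℝ)] with t ht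
    exact S.fourPoint_interior hγ ht.1 ht.2 (S.pos_of_pos_right hγ ht.2.le ht.1.le h2z) hz4
  -- x₃ is approached from the past along a segment from x₂; the approximating points are ≪ x₄ even
  -- when x₃ ≤ x₄ is not chronological.
  obtain ⟨γ, hγ, rfl, rfl⟩ := S.seg_exists _ _ h23
  refine FourPointIneq.of_tendsto (l := 𝓝[<] (1 : ℝ)) tendsto_const_nhds
    (S.tendsto_right hγ _) tendsto_const_nhds (S.tendsto_right hγ _) tendsto_const_nhds
    (S.tendsto_left hγ _) ?_
  filter_upwards [Ioo_mem_nhdsLT (zero_lt_one' ℝ)] with t ht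
  exact strict (γ t) (S.seg_pos γ hγ 0 t le_rfl ht.1 ht.2.le)
    (h34 _ (S.seg_pos γ hγ t 1 ht.1.le ht.2 le_rfl))

end ComparisonSpace

end Comparison

namespace ModelPlane

open Comparison

/-! ### The geometry of the comparison spaces -/

/-- The modified distance of two points of `𝕃²_K`, an algebraic expression in the coordinates. -/
def modDist (K : ℝ) (p q : ModelPlane) : ℝ :=
  if 0 < K then (Real.cosh p.1 * Real.cosh q.1 * Real.cos (q.2 - p.2)
      - Real.sinh p.1 * Real.sinh q.1 - 1) / K
  else if K = 0 then ((q.1 - p.1) ^ 2 - (q.2 - p.2) ^ 2) / 2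
  else (Real.cosh p.2 * Real.cosh q.2 * Real.cos (q.1 - p.1)
      - Real.sinh p.2 * Real.sinh q.2 - 1) / K

theorem modDist_of_pos {K : ℝ} (hK : 0 < K) (p q : ModelPlane) :
    modDist K p q = (Real.cosh p.1 * Real.cosh q.1 * Real.cos (q.2 - p.2)
      - Real.sinh p.1 * Real.sinh q.1 - 1) / K := by
  simp [modDist, hK]

theorem modDist_of_eq_zero (p q : ModelPlane) :
    modDist 0 p q = ((q.1 - p.1) ^ 2 - (q.2 - p.2) ^ 2) / 2 := by
  simp [modDist]

theorem modDist_of_neg {K : ℝ} (hK : K < 0) (p q : ModelPlane) :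
    modDist K p q = (Real.cosh p.2 * Real.cosh q.2 * Real.cos (q.1 - p.1)
      - Real.sinh p.2 * Real.sinh q.2 - 1) / K := by
  simp [modDist, hK.not_gt, hK.ne]

theorem modDist_comm (K : ℝ) (p q : ModelPlane) : modDist K p q = modDist K q p := by
  rcases lt_trichotomy K 0 with h | h | h
  · rw [modDist_of_neg h, modDist_of_neg h, ← Real.cos_neg, neg_sub]; ring
  · subst h; rw [modDist_of_eq_zero, modDist_of_eq_zero]; ring
  · rw [modDist_of_pos h, modDist_of_pos h, ← Real.cos_neg, neg_sub]; ring

theorem conf_of_pos {K : ℝ} (hK : 0 < K) (p : ModelPlane) :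
    conf K p = (Real.arctan (Real.sinh p.1), p.2) := by
  simp [conf, hK]

theorem conf_of_eq_zero (p : ModelPlane) : conf 0 p = p := by simp [conf]

theorem conf_of_neg {K : ℝ} (hK : K < 0) (p : ModelPlane) :
    conf K p = (p.1, Real.arctan (Real.sinh p.2)) := by
  simp [conf, hK.not_gt, hK.ne]

theorem conf_injective (K : ℝ) : Function.Injective (conf K) := by
  intro p q h
  rcases lt_trichotomy K 0 with hK | hK | hK
  · rw [conf_of_neg hK, conf_of_neg hK, Prod.mk.injEq] at h
    exact Prod.ext h.1 (Real.sinh_injective (Real.arctan_injective h.2))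
  · subst hK; rwa [conf_of_eq_zero, conf_of_eq_zero] at h
  · rw [conf_of_pos hK, conf_of_pos hK, Prod.mk.injEq] at h
    exact Prod.ext (Real.sinh_injective (Real.arctan_injective h.1)) h.2

/-! ### Null coordinates, causality and the sign of the modified distance -/

/-- The null coordinate `u + v`. -/
def nullP (K : ℝ) (p : ModelPlane) : ℝ := (conf K p).1 + (conf K p).2

/-- The null coordinate `u - v`. -/
def nullM (K : ℝ) (p : ModelPlane) : ℝ := (conf K p).1 - (conf K p).2

theorem ext_null {K : ℝ} {p q : ModelPlane} (h1 : nullP K p = nullP K q)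
    (h2 : nullM K p = nullM K q) : p = q := by
  unfold nullP nullM at *
  exact conf_injective K (Prod.ext (by linarith) (by linarith))

theorem chron_iff {K : ℝ} {p q : ModelPlane} :
    chron K p q ↔ nullP K p < nullP K q ∧ nullM K p < nullM K q := by
  unfold chron nullP nullM
  rw [abs_lt]
  constructor <;> rintro ⟨h1, h2⟩ <;> constructor <;> linarith

theorem causal_iff {K : ℝ} {p q : ModelPlane} :
    causal K p q ↔ nullP K p ≤ nullP K q ∧ nullM K p ≤ nullM K q := by
  unfold causal nullP nullM
  rw [abs_le]
  constructor <;> rintro ⟨h1, h2⟩ <;> constructor <;> linarith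

theorem chron_trans {K : ℝ} {p q r : ModelPlane} (h1 : chron K p q) (h2 : chron K q r) :
    chron K p r := by
  rw [chron_iff] at *; exact ⟨h1.1.trans h2.1, h1.2.trans h2.2⟩

theorem chron.causal {K : ℝ} {p q : ModelPlane} (h : chron K p q) : causal K p q := by
  rw [chron_iff] at h; rw [causal_iff]; exact ⟨h.1.le, h.2.le⟩

/-- For `K < 0`, the point `q` is strictly in the past of the future antipode of `p`. -/
def BeforeAntipode (K : ℝ) (p q : ModelPlane) : Prop :=
  K < 0 → nullP K q - nullM K p < Real.pi ∧ nullM K q - nullP K p < Real.pi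

theorem BeforeAntipode.mono {K : ℝ} {p q p' q' : ModelPlane} (h : BeforeAntipode K p q)
    (hp : causal K p p') (hq : causal K q' q) : BeforeAntipode K p' q' := by
  intro hK
  rw [causal_iff] at hp hq
  obtain ⟨h1, h2⟩ := h hK
  constructor <;> linarith [hp.1, hp.2, hq.1, hq.2]

theorem abs_nullP_add_nullM_lt {K : ℝ} (hK : 0 < K) (p : ModelPlane) :
    |nullP K p + nullM K p| < Real.pi := by
  have h1 := Real.neg_pi_div_two_lt_arctan (Real.sinh p.1)
  have h2 := Real.arctan_lt_pi_div_two (Real.sinh p.1)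
  simp only [nullP, nullM, conf_of_pos hK]
  rw [abs_lt]; constructor <;> linarith

theorem abs_nullP_sub_nullM_lt {K : ℝ} (hK : K < 0) (p : ModelPlane) :
    |nullP K p - nullM K p| < Real.pi := by
  have h1 := Real.neg_pi_div_two_lt_arctan (Real.sinh p.2)
  have h2 := Real.arctan_lt_pi_div_two (Real.sinh p.2)
  simp only [nullP, nullM, conf_of_neg hK]
  rw [abs_lt]; constructor <;> linarith

/-- For the Gudermannian angle θ = arctan (sinh x) one has cosh x = sec θ, and sinh x = tan θ by the
next lemma. This is the passage between metric and conformal coordinates. -/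
theorem cosh_mul_cos_arctan_sinh (x : ℝ) : Real.cosh x * Real.cos (Real.arctan (Real.sinh x)) = 1 := by
  rw [Real.cos_arctan, ← Real.cosh_sq', Real.sqrt_sq (Real.cosh_pos x).le]
  field_simp [(Real.cosh_pos x).ne']

theorem sinh_eq_cosh_mul_sin_arctan_sinh (x : ℝ) :
    Real.sinh x = Real.cosh x * Real.sin (Real.arctan (Real.sinh x)) := by
  rw [Real.sin_arctan, ← Real.cosh_sq', Real.sqrt_sq (Real.cosh_pos x).le]
  field_simp [(Real.cosh_pos x).ne']

/-- Dividing by the conformal factor leaves a difference of cosines. Sum-to-product then yields a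
product of one sine for each null coordinate difference. -/
theorem cosh_mul_cosh_mul_sub (x y c : ℝ) :
    Real.cosh x * Real.cosh y * c - Real.sinh x * Real.sinh y - 1 =
      Real.cosh x * Real.cosh y *
        (c - Real.cos (Real.arctan (Real.sinh y) - Real.arctan (Real.sinh x))) := by
  have h1 := cosh_mul_cos_arctan_sinh x
  have h2 := cosh_mul_cos_arctan_sinh y
  have h3 := sinh_eq_cosh_mul_sin_arctan_sinh x
  have h4 := sinh_eq_cosh_mul_sin_arctan_sinh y
  rw [Real.cos_sub]
  generalize Real.cos (Real.arctan (Real.sinh x)) = a at *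
  generalize Real.cos (Real.arctan (Real.sinh y)) = b at *
  generalize Real.sin (Real.arctan (Real.sinh x)) = a' at *
  generalize Real.sin (Real.arctan (Real.sinh y)) = b' at *
  rw [h3, h4]
  linear_combination (Real.cosh y * b) * h1 + h2

theorem cosh_mul_cosh_mul_add (x y c : ℝ) :
    Real.cosh x * Real.cosh y * c - Real.sinh x * Real.sinh y + 1 =
      Real.cosh x * Real.cosh y *
        (c + Real.cos (Real.arctan (Real.sinh y) + Real.arctan (Real.sinh x))) := by
  have h1 := cosh_mul_cos_arctan_sinh x
  have h2 := cosh_mul_cos_arctan_sinh y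
  have h3 := sinh_eq_cosh_mul_sin_arctan_sinh x
  have h4 := sinh_eq_cosh_mul_sin_arctan_sinh y
  rw [Real.cos_add]
  generalize Real.cos (Real.arctan (Real.sinh x)) = a at *
  generalize Real.cos (Real.arctan (Real.sinh y)) = b at *
  generalize Real.sin (Real.arctan (Real.sinh x)) = a' at *
  generalize Real.sin (Real.arctan (Real.sinh y)) = b' at *
  rw [h3, h4]
  linear_combination -(Real.cosh y * b) * h1 - h2

theorem modDist_null_of_pos {K : ℝ} (hK : 0 < K) (p q : ModelPlane) :
    modDist K p q = 2 * (Real.sin ((nullP K q - nullP K p) / 2) *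
      Real.sin ((nullM K q - nullM K p) / 2)) * (Real.cosh p.1 * Real.cosh q.1) / K := by
  rw [modDist_of_pos hK, cosh_mul_cosh_mul_sub, Real.cos_sub_cos]
  simp only [nullP, nullM, conf_of_pos hK]
  congr 1
  rw [show (q.2 - p.2 - (Real.arctan (Real.sinh q.1) - Real.arctan (Real.sinh p.1))) / 2 =
    -((Real.arctan (Real.sinh q.1) - q.2 - (Real.arctan (Real.sinh p.1) - p.2)) / 2) by ring,
    Real.sin_neg, show (q.2 - p.2 + (Real.arctan (Real.sinh q.1) - Real.arctan (Real.sinh p.1))) / 2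
      = (Real.arctan (Real.sinh q.1) + q.2 - (Real.arctan (Real.sinh p.1) + p.2)) / 2 by ring]
  ring

theorem modDist_null_of_neg {K : ℝ} (hK : K < 0) (p q : ModelPlane) :
    modDist K p q = 2 * (Real.sin ((nullP K q - nullP K p) / 2) *
      Real.sin ((nullM K q - nullM K p) / 2)) * (Real.cosh p.2 * Real.cosh q.2) / (-K) := by
  rw [modDist_of_neg hK, cosh_mul_cosh_mul_sub, Real.cos_sub_cos]
  simp only [nullP, nullM, conf_of_neg hK]
  rw [div_neg, ← neg_div]
  congr 1
  rw [show (q.1 - p.1 - (Real.arctan (Real.sinh q.2) - Real.arctan (Real.sinh p.2))) / 2 =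
    (q.1 - Real.arctan (Real.sinh q.2) - (p.1 - Real.arctan (Real.sinh p.2))) / 2 by ring,
    show (q.1 - p.1 + (Real.arctan (Real.sinh q.2) - Real.arctan (Real.sinh p.2))) / 2
      = (q.1 + Real.arctan (Real.sinh q.2) - (p.1 + Real.arctan (Real.sinh p.2))) / 2 by ring]
  ring

theorem modDist_null_of_eq_zero (p q : ModelPlane) :
    modDist 0 p q = (nullP 0 q - nullP 0 p) * (nullM 0 q - nullM 0 p) / 2 := by
  simp only [modDist_of_eq_zero, nullP, nullM, conf_of_eq_zero]; ring

/-- For timelike related points before the antipode the left side is 1 + cos (√(-K) τ). The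
factorisation shows that it vanishes exactly when q is null related to an antipode of p. -/
theorem mul_modDist_add_two {K : ℝ} (hK : K < 0) (p q : ModelPlane) :
    K * modDist K p q + 2 = 2 * (Real.cos ((nullP K q - nullM K p) / 2) *
      Real.cos ((nullM K q - nullP K p) / 2)) * (Real.cosh p.2 * Real.cosh q.2) := by
  have h1 : K * modDist K p q + 2 = Real.cosh p.2 * Real.cosh q.2 * Real.cos (q.1 - p.1)
      - Real.sinh p.2 * Real.sinh q.2 + 1 := by
    rw [modDist_of_neg hK, mul_div_cancel₀ _ hK.ne]; ring
  rw [h1, cosh_mul_cosh_mul_add, Real.cos_add_cos]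
  simp only [nullP, nullM, conf_of_neg hK]
  rw [show (q.1 - p.1 - (Real.arctan (Real.sinh q.2) + Real.arctan (Real.sinh p.2))) / 2 =
    (q.1 - Real.arctan (Real.sinh q.2) - (p.1 + Real.arctan (Real.sinh p.2))) / 2 by ring,
    show (q.1 - p.1 + (Real.arctan (Real.sinh q.2) + Real.arctan (Real.sinh p.2))) / 2
      = (q.1 + Real.arctan (Real.sinh q.2) - (p.1 - Real.arctan (Real.sinh p.2))) / 2 by ring]
  ring

theorem null_sub_lt_two_pi {K : ℝ} (hK : K ≠ 0) {p q : ModelPlane} (h : chron K p q)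
    (ha : BeforeAntipode K p q) :
    nullP K q - nullP K p < 2 * Real.pi ∧ nullM K q - nullM K p < 2 * Real.pi := by
  rw [chron_iff] at h
  rcases hK.lt_or_gt with hK | hK
  · obtain ⟨h1, h2⟩ := ha hK
    constructor <;> linarith [h.1, h.2]
  · have h1 := abs_lt.1 (abs_nullP_add_nullM_lt hK p)
    have h2 := abs_lt.1 (abs_nullP_add_nullM_lt hK q)
    constructor <;> linarith [h.1, h.2, h1.1, h2.2]

theorem modDist_pos {K : ℝ} {p q : ModelPlane} (h : chron K p q) (ha : BeforeAntipode K p q) :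
    0 < modDist K p q := by
  have hc := chron_iff.1 h
  rcases lt_trichotomy K 0 with hK | hK | hK
  · obtain ⟨h1, h2⟩ := null_sub_lt_two_pi hK.ne h ha
    have s1 := Real.sin_pos_of_pos_of_lt_pi (x := (nullP K q - nullP K p) / 2)
      (by linarith [hc.1]) (by linarith)
    have s2 := Real.sin_pos_of_pos_of_lt_pi (x := (nullM K q - nullM K p) / 2)
      (by linarith [hc.2]) (by linarith)
    have := Real.cosh_pos p.2
    have := Real.cosh_pos q.2
    rw [modDist_null_of_neg hK]
    exact div_pos (by positivity) (by linarith)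
  · subst hK
    rw [modDist_null_of_eq_zero]
    exact div_pos (mul_pos (sub_pos.2 hc.1) (sub_pos.2 hc.2)) two_pos
  · obtain ⟨h1, h2⟩ := null_sub_lt_two_pi hK.ne' h ha
    have s1 := Real.sin_pos_of_pos_of_lt_pi (x := (nullP K q - nullP K p) / 2)
      (by linarith [hc.1]) (by linarith)
    have s2 := Real.sin_pos_of_pos_of_lt_pi (x := (nullM K q - nullM K p) / 2)
      (by linarith [hc.2]) (by linarith)
    have := Real.cosh_pos p.1
    have := Real.cosh_pos q.1
    rw [modDist_null_of_pos hK]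
    positivity

/-- While the null coordinate differences stay below 2π in absolute value, the sine of half a
difference has the sign of the difference. A positive product therefore means that both null
coordinates change in the same direction. -/
theorem chron_or_chron_of_modDist_pos {K : ℝ} {p q : ModelPlane}
    (h1 : K ≠ 0 → |nullP K q - nullP K p| < 2 * Real.pi)
    (h2 : K ≠ 0 → |nullM K q - nullM K p| < 2 * Real.pi) (h : 0 < modDist K p q) :
    chron K p q ∨ chron K q p := by
  have key : ∀ x y : ℝ, |x| < 2 * Real.pi → |y| < 2 * Real.pi →
      0 < Real.sin (x / 2) * Real.sin (y / 2) → (0 < x ∧ 0 < y) ∨ (x < 0 ∧ y < 0) := by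
    have pos : ∀ x : ℝ, |x| < 2 * Real.pi → 0 < Real.sin (x / 2) → 0 < x := by
      intro x hx hs
      by_contra! hc
      have := Real.sin_nonpos_of_nonpos_of_neg_pi_le (x := x / 2) (by linarith)
        (by linarith [(abs_lt.1 hx).1])
      linarith
    have neg : ∀ x : ℝ, |x| < 2 * Real.pi → Real.sin (x / 2) < 0 → x < 0 := by
      intro x hx hs
      by_contra! hc
      have := Real.sin_nonneg_of_nonneg_of_le_pi (x := x / 2) (by linarith)
        (by linarith [(abs_lt.1 hx).2])
      linarith
    intro x y hx hy h
    rcases pos_and_pos_or_neg_and_neg_of_mul_pos h with ⟨a, b⟩ | ⟨a, b⟩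
    · exact Or.inl ⟨pos x hx a, pos y hy b⟩
    · exact Or.inr ⟨neg x hx a, neg y hy b⟩
  have fin : (0 < nullP K q - nullP K p ∧ 0 < nullM K q - nullM K p) ∨
      (nullP K q - nullP K p < 0 ∧ nullM K q - nullM K p < 0) := by
    rcases lt_trichotomy K 0 with hK | hK | hK
    · refine key _ _ (h1 hK.ne) (h2 hK.ne) ?_
      rw [modDist_null_of_neg hK] at h
      have := Real.cosh_pos p.2
      have := Real.cosh_pos q.2
      by_contra! hc
      have : 2 * (Real.sin ((nullP K q - nullP K p) / 2) *
        Real.sin ((nullM K q - nullM K p) / 2)) * (Real.cosh p.2 * Real.cosh q.2) / (-K) ≤ 0 :=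
        div_nonpos_of_nonpos_of_nonneg
          (mul_nonpos_of_nonpos_of_nonneg (by linarith) (by positivity)) (by linarith)
      linarith
    · subst hK
      rw [modDist_null_of_eq_zero] at h
      exact pos_and_pos_or_neg_and_neg_of_mul_pos (by linarith)
    · refine key _ _ (h1 hK.ne') (h2 hK.ne') ?_
      rw [modDist_null_of_pos hK] at h
      have := Real.cosh_pos p.1
      have := Real.cosh_pos q.1
      by_contra! hc
      have : 2 * (Real.sin ((nullP K q - nullP K p) / 2) *
        Real.sin ((nullM K q - nullM K p) / 2)) * (Real.cosh p.1 * Real.cosh q.1) / K ≤ 0 :=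
        div_nonpos_of_nonpos_of_nonneg
          (mul_nonpos_of_nonpos_of_nonneg (by linarith) (by positivity)) (by linarith)
      linarith
  simp only [chron_iff]
  rcases fin with ⟨a, b⟩ | ⟨a, b⟩
  · exact Or.inl ⟨by linarith, by linarith⟩
  · exact Or.inr ⟨by linarith, by linarith⟩

end ModelPlane

/-! ### Monotonicity of the modified distance along causal relations -/

namespace ModelPlane

open Comparison

/-- After cross-multiplication the difference of the two sides is sin (a' - a) cos c. -/
theorem sin_div_cos_le {a a' c : ℝ} (ha : a ≤ a') (hpi : a' - a ≤ Real.pi)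
    (h0 : 0 < Real.cos c) (h1 : 0 < Real.cos (a + c)) (h2 : 0 < Real.cos (a' + c)) :
    Real.sin a / Real.cos (a + c) ≤ Real.sin a' / Real.cos (a' + c) := by
  rw [div_le_div_iff₀ h1 h2]
  have h3 : Real.sin a' * Real.cos (a + c) - Real.sin a * Real.cos (a' + c) =
      Real.sin (a' - a) * Real.cos c := by
    rw [Real.cos_add, Real.cos_add, Real.sin_sub]; ring
  have h4 := Real.sin_nonneg_of_nonneg_of_le_pi (x := a' - a) (by linarith) hpi
  linarith [mul_nonneg h4 h0.le]

theorem sin_div_cos_lt {a a' c : ℝ} (ha : a < a') (hpi : a' - a < Real.pi)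
    (h0 : 0 < Real.cos c) (h1 : 0 < Real.cos (a + c)) (h2 : 0 < Real.cos (a' + c)) :
    Real.sin a / Real.cos (a + c) < Real.sin a' / Real.cos (a' + c) := by
  rw [div_lt_div_iff₀ h1 h2]
  have h3 : Real.sin a' * Real.cos (a + c) - Real.sin a * Real.cos (a' + c) =
      Real.sin (a' - a) * Real.cos c := by
    rw [Real.cos_add, Real.cos_add, Real.sin_sub]; ring
  have h4 := Real.sin_pos_of_pos_of_lt_pi (x := a' - a) (by linarith) hpi
  linarith [mul_pos h4 h0]

/-- Monotonicity of the modified distance from `(x₀, y₀)` in null coordinates, for the conformal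
factor `cos ((x + ε y) / 2)`. -/
theorem null_mono {ε x₀ y₀ x y x' y' : ℝ} (hε : ε = 1 ∨ ε = -1) (hx : x₀ < x) (hy : y₀ < y)
    (hx' : x ≤ x') (hy' : y ≤ y') (hne : x < x' ∨ y < y') (hxp : x' - x₀ < 2 * Real.pi)
    (hyp : y' - y₀ < 2 * Real.pi)
    (c₁ : |x + ε * y| < Real.pi) (c₂ : |x' + ε * y'| < Real.pi) (c₃ : |x' + ε * y| < Real.pi)
    (c₄ : |x₀ + ε * y| < Real.pi) (c₅ : |x' + ε * y₀| < Real.pi) :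
    Real.sin ((x - x₀) / 2) * Real.sin ((y - y₀) / 2) / Real.cos ((x + ε * y) / 2) <
      Real.sin ((x' - x₀) / 2) * Real.sin ((y' - y₀) / 2) / Real.cos ((x' + ε * y') / 2) := by
  have hcos : ∀ z : ℝ, |z| < Real.pi → 0 < Real.cos (z / 2) := fun z hz =>
    Real.cos_pos_of_mem_Ioo ⟨by linarith [(abs_lt.1 hz).1], by linarith [(abs_lt.1 hz).2]⟩
  have hy1 : ∀ z w : ℝ, Real.cos ((z + ε * w) / 2) = Real.cos ((w + ε * z) / 2) := by
    intro z w
    rcases hε with rfl | rfl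
    · congr 1; ring
    · rw [← Real.cos_neg]; congr 1; ring
  have sy : 0 < Real.sin ((y - y₀) / 2) :=
    Real.sin_pos_of_pos_of_lt_pi (by linarith) (by linarith)
  have sx : 0 < Real.sin ((x' - x₀) / 2) :=
    Real.sin_pos_of_pos_of_lt_pi (by linarith) (by linarith)
  have ex : ∀ z : ℝ, (z + ε * y) / 2 = (z - x₀) / 2 + (x₀ + ε * y) / 2 := fun z => by ring
  have ey : ∀ z : ℝ, (z + ε * x') / 2 = (z - y₀) / 2 + (y₀ + ε * x') / 2 := fun z => by ring
  have k1 := hcos _ c₁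
  have k2 := hcos _ c₂
  have k3 := hcos _ c₃
  have k4 := hcos _ c₄
  have k5 := hcos _ c₅
  have mid : Real.sin ((x - x₀) / 2) * Real.sin ((y - y₀) / 2) / Real.cos ((x + ε * y) / 2) =
      Real.sin ((x - x₀) / 2) / Real.cos ((x + ε * y) / 2) * Real.sin ((y - y₀) / 2) := by ring
  have mid' : Real.sin ((x' - x₀) / 2) / Real.cos ((x' + ε * y) / 2) * Real.sin ((y - y₀) / 2) =
      Real.sin ((y - y₀) / 2) / Real.cos ((y + ε * x') / 2) * Real.sin ((x' - x₀) / 2) := by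
    rw [hy1 x' y]; ring
  have mid'' : Real.sin ((x' - x₀) / 2) * Real.sin ((y' - y₀) / 2) / Real.cos ((x' + ε * y') / 2) =
      Real.sin ((y' - y₀) / 2) / Real.cos ((y' + ε * x') / 2) * Real.sin ((x' - x₀) / 2) := by
    rw [hy1 x' y']; ring
  rw [hy1 x' y'] at k2
  have k3' := k3
  rw [hy1 x' y] at k3'
  rw [hy1 x' y₀] at k5
  rw [mid, mid'']
  rw [ex] at k1 k3
  rw [ey] at k2 k3'
  -- The move from (x, y) to (x', y') goes through the corner (x', y), changing one null coordinate
  -- at a time; `hne` makes one of the moves strict.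
  rcases hne with h | h
  · refine lt_of_lt_of_le (mul_lt_mul_of_pos_right ?_ sy)
      (mid'.le.trans (mul_le_mul_of_nonneg_right ?_ sx.le))
    · rw [ex x, ex x']
      exact sin_div_cos_lt (by linarith) (by linarith) k4 k1 k3
    · rw [ey y, ey y']
      exact sin_div_cos_le (by linarith) (by linarith) k5 k3' k2
  · refine lt_of_le_of_lt (mul_le_mul_of_nonneg_right ?_ sy.le)
      (mid'.trans_lt (mul_lt_mul_of_pos_right ?_ sx))
    · rw [ex x, ex x']
      exact sin_div_cos_le (by linarith) (by linarith) k4 k1 k3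
    · rw [ey y, ey y']
      exact sin_div_cos_lt (by linarith) (by linarith) k5 k3' k2

/-- The reverse triangle inequality: the modified distance from `o` is strictly increasing along
causal curves. -/
theorem modDist_lt_modDist {K : ℝ} {o r q : ModelPlane} (h1 : chron K o r) (h2 : causal K r q)
    (hne : r ≠ q) (ha : BeforeAntipode K o q) : modDist K o r < modDist K o q := by
  have hoq : chron K o q := by
    rw [chron_iff] at *; rw [causal_iff] at h2
    exact ⟨h1.1.trans_le h2.1, h1.2.trans_le h2.2⟩
  have g1 := chron_iff.1 h1
  have g2 := causal_iff.1 h2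
  have hne' : nullP K r < nullP K q ∨ nullM K r < nullM K q := by
    by_contra! hc
    exact hne (ext_null (le_antisymm g2.1 hc.1) (le_antisymm g2.2 hc.2))
  rcases lt_trichotomy K 0 with hK | hK | hK
  · obtain ⟨p1, p2⟩ := null_sub_lt_two_pi hK.ne hoq ha
    obtain ⟨a1, a2⟩ := ha hK
    have sr := abs_lt.1 (abs_nullP_sub_nullM_lt hK r)
    have sq := abs_lt.1 (abs_nullP_sub_nullM_lt hK q)
    have so := abs_lt.1 (abs_nullP_sub_nullM_lt hK o)
    have := null_mono (ε := -1) (Or.inr rfl) g1.1 g1.2 g2.1 g2.2 hne' p1 p2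
      (abs_lt.2 ⟨by linarith, by linarith⟩) (abs_lt.2 ⟨by linarith, by linarith⟩)
      (abs_lt.2 ⟨by linarith, by linarith⟩) (abs_lt.2 ⟨by linarith, by linarith⟩)
      (abs_lt.2 ⟨by linarith, by linarith⟩)
    have hc : ∀ p : ModelPlane, Real.cosh p.2 = 1 / Real.cos ((nullP K p + -1 * nullM K p) / 2) := by
      intro p
      have := cosh_mul_cos_arctan_sinh p.2
      simp only [nullP, nullM, conf_of_neg hK]
      rw [show (p.1 + Real.arctan (Real.sinh p.2) + -1 * (p.1 - Real.arctan (Real.sinh p.2))) / 2 =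
        Real.arctan (Real.sinh p.2) by ring]
      rw [eq_div_iff, this]
      intro h; rw [h] at this; simp at this
    have hw := Real.cosh_pos o.2
    have e : ∀ p, modDist K o p = (2 * Real.cosh o.2 / (-K)) * (Real.sin ((nullP K p - nullP K o) / 2) *
        Real.sin ((nullM K p - nullM K o) / 2) / Real.cos ((nullP K p + -1 * nullM K p) / 2)) := by
      intro p
      rw [modDist_null_of_neg hK, hc p]; ring
    rw [e, e]
    exact mul_lt_mul_of_pos_left this (div_pos (by linarith) (by linarith))
  · subst hK
    rw [modDist_null_of_eq_zero, modDist_null_of_eq_zero]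
    rcases hne' with h | h
    · nlinarith [mul_pos (sub_pos.2 h) (sub_pos.2 g1.2), mul_nonneg (sub_nonneg.2 g2.2)
        (sub_nonneg.2 (g1.1.le.trans g2.1))]
    · nlinarith [mul_pos (sub_pos.2 h) (sub_pos.2 g1.1), mul_nonneg (sub_nonneg.2 g2.1)
        (sub_nonneg.2 (g1.2.le.trans g2.2))]
  · obtain ⟨p1, p2⟩ := null_sub_lt_two_pi hK.ne' hoq ha
    have sr := abs_lt.1 (abs_nullP_add_nullM_lt hK r)
    have sq := abs_lt.1 (abs_nullP_add_nullM_lt hK q)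
    have so := abs_lt.1 (abs_nullP_add_nullM_lt hK o)
    have := null_mono (ε := 1) (Or.inl rfl) g1.1 g1.2 g2.1 g2.2 hne' p1 p2
      (abs_lt.2 ⟨by linarith, by linarith⟩) (abs_lt.2 ⟨by linarith, by linarith⟩)
      (abs_lt.2 ⟨by linarith, by linarith⟩) (abs_lt.2 ⟨by linarith, by linarith⟩)
      (abs_lt.2 ⟨by linarith, by linarith⟩)
    have hc : ∀ p : ModelPlane, Real.cosh p.1 = 1 / Real.cos ((nullP K p + 1 * nullM K p) / 2) := by
      intro p
      have := cosh_mul_cos_arctan_sinh p.1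
      simp only [nullP, nullM, conf_of_pos hK]
      rw [show (Real.arctan (Real.sinh p.1) + p.2 + 1 * (Real.arctan (Real.sinh p.1) - p.2)) / 2 =
        Real.arctan (Real.sinh p.1) by ring]
      rw [eq_div_iff, this]
      intro h; rw [h] at this; simp at this
    have hw := Real.cosh_pos o.1
    have e : ∀ p, modDist K o p = (2 * Real.cosh o.1 / K) * (Real.sin ((nullP K p - nullP K o) / 2) *
        Real.sin ((nullM K p - nullM K o) / 2) / Real.cos ((nullP K p + 1 * nullM K p) / 2)) := by
      intro p
      rw [modDist_null_of_pos hK, hc p]; ring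
    rw [e, e]
    exact mul_lt_mul_of_pos_left this (by positivity)

/-- The reflection of `𝕃²_K` in the line `x = 0`. -/
def reflect (p : ModelPlane) : ModelPlane := (p.1, -p.2)

/-- The time reflection of `𝕃²_K`. -/
def timeReflect (p : ModelPlane) : ModelPlane := (-p.1, p.2)

theorem conf_timeReflect (K : ℝ) (p : ModelPlane) :
    conf K (timeReflect p) = (-(conf K p).1, (conf K p).2) := by
  rcases lt_trichotomy K 0 with hK | hK | hK
  · simp [conf_of_neg hK, timeReflect]
  · subst hK; simp [conf_of_eq_zero, timeReflect]
  · simp [conf_of_pos hK, timeReflect, Real.arctan_neg]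

theorem nullP_timeReflect (K : ℝ) (p : ModelPlane) : nullP K (timeReflect p) = -nullM K p := by
  simp only [nullP, nullM, conf_timeReflect]; ring

theorem nullM_timeReflect (K : ℝ) (p : ModelPlane) : nullM K (timeReflect p) = -nullP K p := by
  simp only [nullP, nullM, conf_timeReflect]; ring

theorem modDist_timeReflect (K : ℝ) (p q : ModelPlane) :
    modDist K (timeReflect p) (timeReflect q) = modDist K p q := by
  rcases lt_trichotomy K 0 with hK | hK | hK
  · simp only [modDist_of_neg hK, timeReflect]
    rw [← Real.cos_neg, show -(-q.1 - -p.1) = q.1 - p.1 by ring]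
  · subst hK; simp only [modDist_of_eq_zero, timeReflect]; ring
  · simp only [modDist_of_pos hK, timeReflect]; simp

/-- The time reversal of `modDist_lt_modDist`, obtained with `timeReflect`, which negates and
exchanges the null coordinates. -/
theorem modDist_lt_modDist' {K : ℝ} {o r q : ModelPlane} (h1 : chron K r o) (h2 : causal K q r)
    (hne : r ≠ q) (ha : BeforeAntipode K q o) : modDist K r o < modDist K q o := by
  have := modDist_lt_modDist (K := K) (o := timeReflect o) (r := timeReflect r)
    (q := timeReflect q)
    (by rw [chron_iff] at *; simp only [nullP_timeReflect, nullM_timeReflect]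
        constructor <;> linarith [h1.1, h1.2])
    (by rw [causal_iff] at *; simp only [nullP_timeReflect, nullM_timeReflect]
        constructor <;> linarith [h2.1, h2.2])
    (by intro h; apply hne; unfold timeReflect at h; rw [Prod.mk.injEq] at h
        exact Prod.ext (neg_injective h.1) h.2)
    (by intro hK; obtain ⟨a, b⟩ := ha hK; simp only [nullP_timeReflect, nullM_timeReflect]
        constructor <;> linarith)
  rw [modDist_timeReflect, modDist_timeReflect] at this
  rwa [modDist_comm K r, modDist_comm K q]

/-! ### Time separation and modified distance -/

theorem causal_antipode_iff {K : ℝ} (hK : K < 0) {p q : ModelPlane} :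
    causal K q (p.1 + Real.pi, -p.2) ↔
      nullP K q - nullM K p ≤ Real.pi ∧ nullM K q - nullP K p ≤ Real.pi := by
  rw [causal_iff]
  simp only [nullP, nullM, conf_of_neg hK, Real.sinh_neg, Real.arctan_neg]
  constructor <;> rintro ⟨h1, h2⟩ <;> constructor <;> linarith

theorem tau_of_not_chron {K : ℝ} {p q : ModelPlane} (h : ¬ chron K p q) : tau K p q = 0 := by
  simp [tau, h]

/-- Strictly before the antipode the argument of the inverse function in `tau` is in its domain:
positivity of `modDist` gives one bound and, for K < 0, `mul_modDist_add_two` gives the other. So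
`md` really undoes `tau`. -/
theorem exists_tau_eq {K : ℝ} {p q : ModelPlane} (h : chron K p q) (ha : BeforeAntipode K p q) :
    ∃ d, 0 < d ∧ tau K p q = ENNReal.ofReal d ∧ md K d = modDist K p q ∧
      (K < 0 → √(-K) * d < Real.pi) := by
  have hpos := modDist_pos h ha
  rcases lt_trichotomy K 0 with hK | hK | hK
  · have hs : 0 < √(-K) := Real.sqrt_pos.2 (by linarith)
    obtain ⟨a1, a2⟩ := ha hK
    have hc : causal K q (p.1 + Real.pi, -p.2) := (causal_antipode_iff hK).2 ⟨a1.le, a2.le⟩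
    set G := Real.cosh p.2 * Real.cosh q.2 * Real.cos (q.1 - p.1)
        - Real.sinh p.2 * Real.sinh q.2 with hG
    have hm : modDist K p q = (G - 1) / K := modDist_of_neg hK p q
    have hKm : K * modDist K p q = G - 1 := by rw [hm, mul_div_cancel₀ _ hK.ne]
    have hG1 : G < 1 := by linarith [mul_neg_of_neg_of_pos hK hpos]
    have hG2 : -1 < G := by
      have e := mul_modDist_add_two hK p q
      have hcos : ∀ z : ℝ, |z| < Real.pi → 0 < Real.cos (z / 2) := fun z hz =>
        Real.cos_pos_of_mem_Ioo ⟨by linarith [(abs_lt.1 hz).1], by linarith [(abs_lt.1 hz).2]⟩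
      rw [chron_iff] at h
      have sp := abs_lt.1 (abs_nullP_sub_nullM_lt hK p)
      have c1 := hcos (nullP K q - nullM K p) (abs_lt.2 ⟨by linarith [h.1], a1⟩)
      have c2 := hcos (nullM K q - nullP K p) (abs_lt.2 ⟨by linarith [h.2], a2⟩)
      have := Real.cosh_pos p.2
      have := Real.cosh_pos q.2
      have : 0 < K * modDist K p q + 2 := by rw [e]; positivity
      linarith
    refine ⟨Real.arccos G / √(-K), div_pos (Real.arccos_pos.2 hG1) hs, ?_, ?_, fun _ => ?_⟩
    · simp [tau, h, hK.not_gt, hK.ne, hc, hG]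
    · rw [md_of_neg hK, mul_div_cancel₀ _ hs.ne', Real.cos_arccos hG2.le hG1.le, hm]
    · rw [mul_div_cancel₀ _ hs.ne']; exact Real.arccos_lt_pi.2 hG2
  · subst hK
    rw [modDist_of_eq_zero] at hpos
    refine ⟨√((q.1 - p.1) ^ 2 - (q.2 - p.2) ^ 2), Real.sqrt_pos.2 (by linarith), ?_, ?_, by simp⟩
    · simp [tau, h]
    · rw [md_of_eq_zero, Real.sq_sqrt (by linarith), modDist_of_eq_zero]
  · have hs : 0 < √K := Real.sqrt_pos.2 hK
    set G := Real.cosh p.1 * Real.cosh q.1 * Real.cos (q.2 - p.2)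
        - Real.sinh p.1 * Real.sinh q.1 with hG
    have hm : modDist K p q = (G - 1) / K := modDist_of_pos hK p q
    have hG1 : 1 < G := by
      rw [hm] at hpos
      have := (div_pos_iff_of_pos_right hK).1 hpos
      linarith
    refine ⟨Real.arcosh G / √K, div_pos (Real.arcosh_pos hG1) hs, ?_, ?_,
      fun h => absurd h hK.not_gt⟩
    · simp [tau, h, hK, hG]
    · rw [md_of_pos hK, mul_div_cancel₀ _ hs.ne', Real.cosh_arcosh hG1.le, hm]

/-- For K < 0, on the past light cone of the antipode the arccosine is taken at -1 and the
separation equals D_K; beyond it the separation is ∞. A separation below D_K excludes both. -/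
theorem beforeAntipode_of_tau {K d : ℝ} {p q : ModelPlane}
    (h : tau K p q = ENNReal.ofReal d) (hc : chron K p q) (hd : K < 0 → √(-K) * d < Real.pi) :
    BeforeAntipode K p q := by
  intro hK
  have hs : 0 < √(-K) := Real.sqrt_pos.2 (by linarith)
  by_cases hca : causal K q (p.1 + Real.pi, -p.2)
  · have hc' := (causal_antipode_iff hK).1 hca
    simp only [tau, hc, hK.not_gt, hK.ne, hca, if_true, if_false] at h
    have hd0 : ¬ d * √(-K) ≥ Real.pi := by linarith [hd hK]
    have key : Real.cos ((nullP K q - nullM K p) / 2) *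
        Real.cos ((nullM K q - nullP K p) / 2) ≠ 0 := by
      intro h0
      have e := mul_modDist_add_two hK p q
      rw [h0, modDist_of_neg hK, mul_div_cancel₀ _ hK.ne] at e
      rw [show Real.cosh p.2 * Real.cosh q.2 * Real.cos (q.1 - p.1)
        - Real.sinh p.2 * Real.sinh q.2 = -1 by linarith, Real.arccos_neg_one] at h
      have hpi : 0 < Real.pi / √(-K) := div_pos Real.pi_pos hs
      have hdpos : 0 < d := by
        by_contra! hcon
        rw [ENNReal.ofReal_of_nonpos hcon] at h
        exact absurd hpi (not_lt.2 (ENNReal.ofReal_eq_zero.1 h))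
      have := (ENNReal.ofReal_eq_ofReal_iff hpi.le hdpos.le).1 h
      rw [← this] at hd0
      rw [div_mul_cancel₀ _ hs.ne'] at hd0
      exact hd0 le_rfl
    have hne : ∀ z : ℝ, Real.cos (z / 2) ≠ 0 → z ≤ Real.pi → z < Real.pi := by
      intro z hz hle
      refine lt_of_le_of_ne hle ?_
      rintro rfl
      exact hz Real.cos_pi_div_two
    exact ⟨hne _ (left_ne_zero_of_mul key) hc'.1, hne _ (right_ne_zero_of_mul key) hc'.2⟩
  · simp [tau, hc, hK.not_gt, hK.ne, hca] at h

/-- Points with positive, small time separation. -/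
theorem of_tau_eq {K d : ℝ} {p q : ModelPlane} (h : tau K p q = ENNReal.ofReal d) (hd : 0 < d)
    (hdK : K < 0 → √(-K) * d < Real.pi) :
    chron K p q ∧ BeforeAntipode K p q ∧ modDist K p q = md K d := by
  have hc : chron K p q := by
    by_contra hc
    rw [tau_of_not_chron hc] at h
    exact absurd hd (not_lt.2 (ENNReal.ofReal_eq_zero.1 h.symm))
  have ha := beforeAntipode_of_tau h hc hdK
  obtain ⟨d', hd', h1, h2, -⟩ := exists_tau_eq hc ha
  rw [h1, ENNReal.ofReal_eq_ofReal_iff hd'.le hd.le] at h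
  exact ⟨hc, ha, by rw [← h2, h]⟩

theorem md_injective {K d d' : ℝ} (hd : 0 ≤ d) (hd' : 0 ≤ d') (h1 : K < 0 → √(-K) * d < Real.pi)
    (h2 : K < 0 → √(-K) * d' < Real.pi) (h : md K d = md K d') : d = d' :=
  le_antisymm (le_of_md_le_md hd' (fun hK => (h1 hK).le) h.le)
    (le_of_md_le_md hd (fun hK => (h2 hK).le) h.ge)

theorem tau_eq_of_modDist {K d : ℝ} {p q : ModelPlane} (hc : chron K p q)
    (ha : BeforeAntipode K p q) (hd : 0 ≤ d) (hdK : K < 0 → √(-K) * d < Real.pi)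
    (h : modDist K p q = md K d) : tau K p q = ENNReal.ofReal d := by
  obtain ⟨d', hd', h1, h2, h3⟩ := exists_tau_eq hc ha
  rw [h1, md_injective hd'.le hd h3 hdK (h2.trans h)]

end ModelPlane

namespace ModelPlane

open Comparison

/-! ### The Gram identity -/

/-- The product of the sides of the hinge `p`, `o`, `q` in `𝕃²_K`. -/
def hinge (K : ℝ) (o p q : ModelPlane) : ℝ :=
  modDist K o p + modDist K o q + K * modDist K o p * modDist K o q - modDist K p q

theorem hinge_eq {K x y z : ℝ} {o p q : ModelPlane} (h1 : modDist K o p = md K x)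
    (h2 : modDist K o q = md K y) (h3 : modDist K p q = md K z) :
    hinge K o p q = hingeProd K x y z := by
  rw [hinge, hingeProd, h1, h2, h3]

theorem side_eq (K : ℝ) (p q r : ModelPlane) : side K p q r =
    embed K p 0 * embed K q 1 * embed K r 2 - embed K p 0 * embed K q 2 * embed K r 1
      - embed K p 1 * embed K q 0 * embed K r 2 + embed K p 1 * embed K q 2 * embed K r 0
      + embed K p 2 * embed K q 0 * embed K r 1 - embed K p 2 * embed K q 1 * embed K r 0 := by
  rw [side, Matrix.det_fin_three]; rfl

/-- `1 + K * modDist` is the bilinear form diag (a, b, c) of the ambient vectors. Multiplicativity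
of the determinant equates the product of the two sides, up to the factor abc = -1, with a mixed 3 ×
3 Gram determinant, and the 2 × 2 minors of that Gram matrix are K times hinges. -/
theorem gram_of_form {K a b c : ℝ} (hK : K ≠ 0) (habc : a * b * c = -1)
    (hg : ∀ p q, 1 + K * modDist K p q = a * embed K p 0 * embed K q 0 +
      b * embed K p 1 * embed K q 1 + c * embed K p 2 * embed K q 2)
    (hu : ∀ p, modDist K p p = 0) (o p q r : ModelPlane) :
    (2 * modDist K o p + K * modDist K o p ^ 2) * hinge K o q r =
      hinge K o p q * hinge K o p r - (K ^ 2)⁻¹ * (side K p o q * side K p o r) := by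
  have g11 := hg o o
  have g22 := hg p p
  have g12 := hg o p
  have g13 := hg o q
  have g14 := hg o r
  have g23 := hg p q
  have g24 := hg p r
  have g34 := hg q r
  rw [hu] at g11 g22
  have key : K ^ 2 * ((2 * modDist K o p + K * modDist K o p ^ 2) * hinge K o q r) =
      K ^ 2 * (hinge K o p q * hinge K o p r) - side K p o q * side K p o r := by
    have e1 : K ^ 2 * ((2 * modDist K o p + K * modDist K o p ^ 2) * hinge K o q r) =
      ((1 + K * modDist K o p) ^ 2 - (1 + K * 0) * (1 + K * 0)) *
        ((1 + K * modDist K o q) * (1 + K * modDist K o r)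
          - (1 + K * 0) * (1 + K * modDist K q r)) := by unfold hinge; ring
    have e2 : K ^ 2 * (hinge K o p q * hinge K o p r) =
      ((1 + K * modDist K o p) * (1 + K * modDist K o q) - (1 + K * 0) * (1 + K * modDist K p q)) *
      ((1 + K * modDist K o p) * (1 + K * modDist K o r) - (1 + K * 0) * (1 + K * modDist K p r)) := by
      unfold hinge; ring
    rw [e1, e2]
    have G : (1 + K * 0) * ((1 + K * 0) * (1 + K * modDist K q r) -
          (1 + K * modDist K p r) * (1 + K * modDist K p q))
        - (1 + K * modDist K o p) * ((1 + K * modDist K o p) * (1 + K * modDist K q r) -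
          (1 + K * modDist K p r) * (1 + K * modDist K o q))
        + (1 + K * modDist K o r) * ((1 + K * modDist K o p) * (1 + K * modDist K p q) -
          (1 + K * 0) * (1 + K * modDist K o q)) = (a * b * c) * (side K p o q * side K p o r) := by
      nth_rewrite 1 [g11]
      rw [g22, g12, g13, g14, g23, g24, g34, side_eq, side_eq]
      ring
    rw [habc] at G
    linear_combination G
  have hK2 : K ^ 2 ≠ 0 := pow_ne_zero 2 hK
  field_simp
  linear_combination key

theorem modDist_self (K : ℝ) (p : ModelPlane) : modDist K p p = 0 := by
  rcases lt_trichotomy K 0 with h | h | h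
  · rw [modDist_of_neg h, sub_self, Real.cos_zero]
    rw [show Real.cosh p.2 * Real.cosh p.2 * 1 - Real.sinh p.2 * Real.sinh p.2 - 1 = 0 by
      linear_combination Real.cosh_sq p.2, zero_div]
  · subst h; rw [modDist_of_eq_zero]; ring
  · rw [modDist_of_pos h, sub_self, Real.cos_zero]
    rw [show Real.cosh p.1 * Real.cosh p.1 * 1 - Real.sinh p.1 * Real.sinh p.1 - 1 = 0 by
      linear_combination Real.cosh_sq p.1, zero_div]

/-- The identity of Lagrange for hinges at `o`. -/
theorem exists_gram (K : ℝ) : ∃ κ > 0, ∀ o p q r : ModelPlane,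
    (2 * modDist K o p + K * modDist K o p ^ 2) * hinge K o q r =
      hinge K o p q * hinge K o p r - κ * (side K p o q * side K p o r) := by
  rcases lt_trichotomy K 0 with h | h | h
  · refine ⟨(K ^ 2)⁻¹, inv_pos.2 (sq_pos_of_neg h), gram_of_form (a := 1) (b := 1) (c := -1) h.ne
      (by norm_num) (fun p q => ?_) (modDist_self K)⟩
    rw [modDist_of_neg h, mul_div_cancel₀ _ h.ne]
    simp [embed, h.not_gt, h.ne, Real.cos_sub]; ring
  · subst h
    refine ⟨1, one_pos, fun o p q r => ?_⟩
    simp [side_eq, embed, hinge, modDist_of_eq_zero]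
    ring
  · refine ⟨(K ^ 2)⁻¹, by positivity, gram_of_form (a := -1) (b := 1) (c := 1) h.ne'
      (by norm_num) (fun p q => ?_) (modDist_self K)⟩
    rw [modDist_of_pos h, mul_div_cancel₀ _ h.ne']
    simp [embed, h, Real.cos_sub]; ring

/-! ### Construction of comparison configurations -/

/-- The proper time scale of the line `x = 0`. -/
def scale (K : ℝ) : ℝ := if 0 < K then √K else if K = 0 then 1 else √(-K)

theorem scale_of_pos {K : ℝ} (hK : 0 < K) : scale K = √K := by simp [scale, hK]

theorem scale_of_eq_zero : scale 0 = 1 := by simp [scale]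

theorem scale_of_neg {K : ℝ} (hK : K < 0) : scale K = √(-K) := by
  simp [scale, hK.not_gt, hK.ne]

theorem scale_pos (K : ℝ) : 0 < scale K := by
  rcases lt_trichotomy K 0 with h | h | h
  · rw [scale_of_neg h]; exact Real.sqrt_pos.2 (by linarith)
  · subst h; rw [scale_of_eq_zero]; exact one_pos
  · rw [scale_of_pos h]; exact Real.sqrt_pos.2 h

/-- The line `x = 0`, parametrised by proper time. -/
def axis (K e : ℝ) : ModelPlane := (scale K * e, 0)

theorem modDist_axis (K e e' : ℝ) : modDist K (axis K e) (axis K e') = md K (e' - e) := by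
  rcases lt_trichotomy K 0 with h | h | h
  · rw [modDist_of_neg h, md_of_neg h]; simp [axis, scale_of_neg h, mul_sub]
  · subst h; rw [modDist_of_eq_zero, md_of_eq_zero]; simp [axis, scale_of_eq_zero]
  · rw [modDist_of_pos h, md_of_pos h]
    simp [axis, scale_of_pos h, mul_sub, Real.cosh_sub]; ring

theorem conf_axis_snd (K e : ℝ) : (conf K (axis K e)).2 = 0 := by
  rcases lt_trichotomy K 0 with h | h | h
  · simp [conf_of_neg h, axis]
  · subst h; simp [conf_of_eq_zero, axis]
  · simp [conf_of_pos h, axis]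

theorem conf_axis_fst_lt {K e e' : ℝ} (he : e < e') :
    (conf K (axis K e)).1 < (conf K (axis K e')).1 := by
  have hs : scale K * e < scale K * e' := mul_lt_mul_of_pos_left he (scale_pos K)
  rcases lt_trichotomy K 0 with h | h | h
  · simpa [conf_of_neg h, axis] using hs
  · subst h; simpa [conf_of_eq_zero, axis] using hs
  · simpa [conf_of_pos h, axis, Real.arctan_lt_arctan_iff] using hs

theorem conf_axis_zero_fst (K : ℝ) : (conf K (axis K 0)).1 = 0 := by
  rcases lt_trichotomy K 0 with h | h | h
  · simp [conf_of_neg h, axis]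
  · subst h; simp [conf_of_eq_zero, axis]
  · simp [conf_of_pos h, axis]

theorem chron_axis {K e e' : ℝ} (he : e < e') : chron K (axis K e) (axis K e') := by
  have := conf_axis_fst_lt (K := K) he
  rw [chron_iff]; unfold nullP nullM
  rw [conf_axis_snd, conf_axis_snd]; constructor <;> linarith

theorem tau_axis {K e e' : ℝ} (he : e < e') (hK : K < 0 → √(-K) * (e' - e) < Real.pi) :
    tau K (axis K e) (axis K e') = ENNReal.ofReal (e' - e) := by
  refine tau_eq_of_modDist (chron_axis he) (fun h => ?_) (by linarith) hK (modDist_axis K e e')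
  have := hK h
  simp only [nullP, nullM, conf_of_neg h, axis, scale_of_neg h]
  constructor <;> simp <;> linarith

/-- A region of `𝕃²_K` in which points of positive modified distance are timelike related. -/
def Near (K : ℝ) (p : ModelPlane) : Prop :=
  (0 < K → |p.2| < Real.pi / 2) ∧ (K < 0 → |p.1| < Real.pi / 2)

theorem near_axis {K e : ℝ} (he : K < 0 → √(-K) * |e| < Real.pi / 2) : Near K (axis K e) := by
  refine ⟨fun _ => by simp [axis, Real.pi_pos], fun h => ?_⟩
  simp only [axis, scale_of_neg h]
  rw [abs_mul, abs_of_nonneg (Real.sqrt_nonneg _)]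
  exact he h

theorem Near.chron_or {K : ℝ} {p q : ModelPlane} (hp : Near K p) (hq : Near K q)
    (h : 0 < modDist K p q) : chron K p q ∨ chron K q p := by
  have key : K ≠ 0 → |nullP K q - nullP K p| < 2 * Real.pi ∧
      |nullM K q - nullM K p| < 2 * Real.pi := by
    intro hK
    have hb : |(conf K p).1| < Real.pi / 2 ∧ |(conf K p).2| < Real.pi / 2 ∧
        |(conf K q).1| < Real.pi / 2 ∧ |(conf K q).2| < Real.pi / 2 := by
      have hat : ∀ x : ℝ, |Real.arctan x| < Real.pi / 2 := fun x =>
        abs_lt.2 ⟨by linarith [Real.neg_pi_div_two_lt_arctan x], Real.arctan_lt_pi_div_two x⟩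
      rcases hK.lt_or_gt with h | h
      · simp only [conf_of_neg h]; exact ⟨hp.2 h, hat _, hq.2 h, hat _⟩
      · simp only [conf_of_pos h]; exact ⟨hat _, hp.1 h, hat _, hq.1 h⟩
    simp only [abs_lt] at hb
    unfold nullP nullM
    simp only [abs_lt]
    refine ⟨⟨?_, ?_⟩, ?_, ?_⟩ <;> linarith [hb.1.1, hb.1.2, hb.2.1.1, hb.2.1.2, hb.2.2.1.1,
      hb.2.2.1.2, hb.2.2.2.1, hb.2.2.2.2]
  exact chron_or_chron_of_modDist_pos (fun h => (key h).1) (fun h => (key h).2) h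

/-- For K < 0 the modified distance alone does not tell on which side of the antipode's light cone q
lies. Distance below D_K makes the product of the two cosines in `mul_modDist_add_two` positive.
Their angles have sum less than π for points in the `Near` region, so neither can reach π/2. -/
theorem Near.tau_eq {K d : ℝ} {p q : ModelPlane} (hp : Near K p) (hq : Near K q)
    (hc : chron K p q) (hd : 0 ≤ d) (hdK : K < 0 → √(-K) * d < Real.pi)
    (h : modDist K p q = md K d) : tau K p q = ENNReal.ofReal d := by
  refine tau_eq_of_modDist hc (fun hK => ?_) hd hdK h
  have e := mul_modDist_add_two hK p q
  rw [h, show K * md K d + 2 = 1 + (1 + K * md K d) by ring, one_add_mul_md_of_neg hK] at e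
  have hcos : -1 < Real.cos (√(-K) * d) := by
    rw [← Real.cos_pi]
    exact Real.cos_lt_cos_of_nonneg_of_le_pi (by positivity) le_rfl (hdK hK)
  have c1 := Real.cosh_pos p.2
  have c2 := Real.cosh_pos q.2
  have hprod : 0 < Real.cos ((nullP K q - nullM K p) / 2) *
      Real.cos ((nullM K q - nullP K p) / 2) := by
    by_contra! hcon
    have := mul_nonpos_of_nonpos_of_nonneg hcon (mul_pos c1 c2).le
    linarith
  have u1 := abs_lt.1 (hp.2 hK)
  have u2 := abs_lt.1 (hq.2 hK)
  have sp := abs_lt.1 (abs_nullP_sub_nullM_lt hK p)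
  have sq := abs_lt.1 (abs_nullP_sub_nullM_lt hK q)
  have d1 : nullP K p + nullM K p = 2 * p.1 := by simp only [nullP, nullM, conf_of_neg hK]; ring
  have d2 : nullP K q + nullM K q = 2 * q.1 := by simp only [nullP, nullM, conf_of_neg hK]; ring
  have aux : ∀ A B : ℝ, A < 2 * Real.pi → -Real.pi < B → A + B < 2 * Real.pi →
      0 < Real.cos (A / 2) * Real.cos (B / 2) → A < Real.pi := by
    intro A B hA hB hAB hpos
    by_contra! hc
    have h1 : Real.cos (A / 2) ≤ 0 :=
      Real.cos_nonpos_of_pi_div_two_le_of_le (by linarith) (by linarith [Real.pi_pos])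
    have h2 : 0 < Real.cos (B / 2) :=
      Real.cos_pos_of_mem_Ioo ⟨by linarith, by linarith⟩
    linarith [mul_nonpos_of_nonpos_of_nonneg h1 h2.le]
  have hc' := chron_iff.1 hc
  constructor
  · refine aux _ (nullM K q - nullP K p) ?_ ?_ ?_ hprod <;> linarith [hc'.1, hc'.2]
  · refine aux _ (nullP K q - nullM K p) ?_ ?_ ?_ (by rw [mul_comm]; exact hprod) <;>
      linarith [hc'.1, hc'.2]

/-- Points with prescribed modified distances from the points of the line `x = 0`. -/
theorem exists_point (K : ℝ) {b w : ℝ} (hb : 0 ≤ b) (hbK : K < 0 → √(-K) * b < Real.pi / 2)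
    (hw : sn K b ^ 2 ≤ w ^ 2) :
    ∃ q : ModelPlane, Near K q ∧ (0 < w → 0 < (conf K q).1) ∧ (w < 0 → (conf K q).1 < 0) ∧
      ∀ e, modDist K (axis K e) q = md K e + md K b + K * md K e * md K b - sn K e * w := by
  -- The two embedding coordinates in the plane of the axis are prescribed: for K ≠ 0 the cosine of
  -- b in the sense of `1 + K * md K b`, and w times `scale K`; for K = 0 only the time coordinate
  -- w. The remaining coordinate comes from the quadric, respectively from w² - b², and `hw` makes
  -- it real.
  rcases lt_trichotomy K 0 with h | h | h
  · have hs : 0 < √(-K) := Real.sqrt_pos.2 (by linarith)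
    have hs2 : √(-K) ^ 2 = -K := Real.sq_sqrt (by linarith)
    have hc : 0 < Real.cos (√(-K) * b) := Real.cos_pos_of_mem_Ioo
      ⟨by have : 0 ≤ √(-K) * b := by positivity
          linarith [Real.pi_pos], hbK h⟩
    set C := Real.cos (√(-K) * b) with hC
    set y := √(-K) * w / C with hy
    have hr : 0 < √(1 + y ^ 2) := Real.sqrt_pos.2 (by positivity)
    have hr2 : √(1 + y ^ 2) ^ 2 = 1 + y ^ 2 := Real.sq_sqrt (by positivity)
    have hyC : y * C = √(-K) * w := by rw [hy, div_mul_cancel₀ _ hc.ne']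
    have hρ : 1 ≤ C * √(1 + y ^ 2) := by
      have h1 : Real.sin (√(-K) * b) ^ 2 ≤ (√(-K) * w) ^ 2 := by
        rw [sn_of_neg h, div_pow, div_le_iff₀ (by positivity)] at hw
        rw [mul_pow]; linarith
      have h2 : (1 : ℝ) ^ 2 ≤ (C * √(1 + y ^ 2)) ^ 2 := by
        rw [mul_pow, hr2]
        have := Real.sin_sq_add_cos_sq (√(-K) * b)
        rw [← hC] at this
        rw [← hyC] at h1
        linarith
      exact le_of_sq_le_sq h2 (by positivity)
    refine ⟨(Real.arctan y, Real.arcosh (C * √(1 + y ^ 2))), ⟨fun h' => absurd h' h.not_gt,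
      fun _ => ?_⟩, fun hw0 => ?_, fun hw0 => ?_, fun e => ?_⟩
    · exact abs_lt.2 ⟨by linarith [Real.neg_pi_div_two_lt_arctan y], Real.arctan_lt_pi_div_two y⟩
    · simp only [conf_of_neg h]
      exact Real.arctan_pos.2 (by positivity)
    · simp only [conf_of_neg h]
      exact Real.arctan_lt_zero.2 (div_neg_of_neg_of_pos (mul_neg_of_pos_of_neg hs hw0) hc)
    · rw [modDist_of_neg h]
      have e1 : 1 + K * md K e = Real.cos (√(-K) * e) := one_add_mul_md_of_neg h e
      have e2 : 1 + K * md K b = C := one_add_mul_md_of_neg h b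
      have e3 : Real.sin (√(-K) * e) = √(-K) * sn K e := by
        rw [sn_of_neg h, mul_div_cancel₀ _ hs.ne']
      simp only [axis, scale_of_neg h, Real.cosh_zero, Real.sinh_zero, Real.cosh_arcosh hρ,
        Real.cos_sub, Real.cos_arctan, Real.sin_arctan, ← e1, e3]
      rw [div_eq_iff h.ne]
      have e4 : ∀ A B : ℝ, C * √(1 + y ^ 2) * (1 / √(1 + y ^ 2) * A + y / √(1 + y ^ 2) * B) =
          C * A + y * C * B := fun A B => by field_simp
      rw [one_mul, e4, hyC, ← e2]
      linear_combination (w * sn K e) * hs2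
  · subst h
    rw [sn_of_eq_zero] at hw
    have h2 : √(w ^ 2 - b ^ 2) ^ 2 = w ^ 2 - b ^ 2 := Real.sq_sqrt (by linarith)
    refine ⟨(w, √(w ^ 2 - b ^ 2)), ⟨fun h' => absurd h' (lt_irrefl _),
      fun h' => absurd h' (lt_irrefl _)⟩, fun hw0 => ?_, fun hw0 => ?_, fun e => ?_⟩
    · simpa [conf_of_eq_zero] using hw0
    · simpa [conf_of_eq_zero] using hw0
    · simp only [modDist_of_eq_zero, axis, scale_of_eq_zero, md_of_eq_zero, sn_of_eq_zero]
      linear_combination (-1 / 2) * h2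
  · have hs : 0 < √K := Real.sqrt_pos.2 h
    have hs2 : √K ^ 2 = K := Real.sq_sqrt h.le
    set y := √K * w with hy
    have hr : 0 < √(1 + y ^ 2) := Real.sqrt_pos.2 (by positivity)
    have hr2 : √(1 + y ^ 2) ^ 2 = 1 + y ^ 2 := Real.sq_sqrt (by positivity)
    have hC : 0 < Real.cosh (√K * b) := Real.cosh_pos _
    set C := Real.cosh (√K * b) with hCdef
    have hCle : C ≤ √(1 + y ^ 2) := by
      refine le_of_sq_le_sq ?_ hr.le
      rw [hr2, hCdef, Real.cosh_sq]
      rw [sn_of_pos h, div_pow, div_le_iff₀ (by positivity)] at hw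
      rw [hy, mul_pow]; linarith
    have hq1 : C / √(1 + y ^ 2) ≤ 1 := (div_le_one hr).2 hCle
    have hq0 : 0 < C / √(1 + y ^ 2) := by positivity
    refine ⟨(Real.arsinh y, Real.arccos (C / √(1 + y ^ 2))), ⟨fun _ => ?_,
      fun h' => absurd h' h.not_gt⟩, fun hw0 => ?_, fun hw0 => ?_, fun e => ?_⟩
    · simp only
      rw [abs_of_nonneg (Real.arccos_nonneg _)]
      exact Real.arccos_lt_pi_div_two.2 hq0
    · simp only [conf_of_pos h, Real.sinh_arsinh]
      exact Real.arctan_pos.2 (by positivity)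
    · simp only [conf_of_pos h, Real.sinh_arsinh]
      exact Real.arctan_lt_zero.2 (mul_neg_of_pos_of_neg hs hw0)
    · rw [modDist_of_pos h]
      have e1 : 1 + K * md K e = Real.cosh (√K * e) := one_add_mul_md_of_pos h e
      have e2 : 1 + K * md K b = C := one_add_mul_md_of_pos h b
      have e3 : Real.sinh (√K * e) = √K * sn K e := by
        rw [sn_of_pos h, mul_div_cancel₀ _ hs.ne']
      simp only [axis, scale_of_pos h, sub_zero, Real.sinh_arsinh, Real.cosh_arsinh,
        Real.cos_arccos (by linarith) hq1, ← e1, e3]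
      rw [div_eq_iff h.ne']
      have e4 : (1 + K * md K e) * √(1 + y ^ 2) * (C / √(1 + y ^ 2)) = (1 + K * md K e) * C := by
        field_simp
      rw [e4, ← e2, hy]
      linear_combination (-(w * sn K e)) * hs2

theorem conf_reflect (K : ℝ) (p : ModelPlane) :
    conf K (reflect p) = ((conf K p).1, -(conf K p).2) := by
  rcases lt_trichotomy K 0 with hK | hK | hK
  · simp [conf_of_neg hK, reflect, Real.arctan_neg]
  · subst hK; simp [conf_of_eq_zero, reflect]
  · simp [conf_of_pos hK, reflect]

theorem Near.reflect {K : ℝ} {p : ModelPlane} (h : Near K p) : Near K (reflect p) := by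
  refine ⟨fun hK => ?_, fun hK => h.2 hK⟩
  simp only [ModelPlane.reflect, abs_neg]
  exact h.1 hK

theorem modDist_axis_reflect (K e : ℝ) (p : ModelPlane) :
    modDist K (axis K e) (reflect p) = modDist K (axis K e) p := by
  rcases lt_trichotomy K 0 with hK | hK | hK
  · simp [modDist_of_neg hK, reflect, axis]
  · subst hK; simp [modDist_of_eq_zero, reflect, axis]
  · simp [modDist_of_pos hK, reflect, axis]

theorem side_axis_reflect (K e e' : ℝ) (p : ModelPlane) :
    side K (axis K e) (axis K e') (reflect p) = -side K (axis K e) (axis K e') p := by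
  rcases lt_trichotomy K 0 with hK | hK | hK
  · simp [side_eq, embed, hK.not_gt, hK.ne, reflect, axis]; ring
  · subst hK; simp [side_eq, embed, reflect, axis]; ring
  · simp [side_eq, embed, hK, reflect, axis]; ring

end ModelPlane

/-! ### Comparison triangles and four-point configurations -/

namespace ModelPlane

open Comparison

theorem md_le_modDist {K X : ℝ} {p q : ModelPlane} (hc : chron K p q) (ha : BeforeAntipode K p q)
    (hX : 0 ≤ X) (h : ENNReal.ofReal X ≤ tau K p q) : md K X ≤ modDist K p q := by
  obtain ⟨d, hd, h1, h2, h3⟩ := exists_tau_eq hc ha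
  rw [h1, ENNReal.ofReal_le_ofReal_iff hd.le] at h
  rw [← h2]
  exact md_le_md hX h fun hK => (h3 hK).le

theorem modDist_le_md {K X : ℝ} {p q : ModelPlane} (hc : chron K p q) (ha : BeforeAntipode K p q)
    (hX : 0 ≤ X) (hXK : K < 0 → √(-K) * X < Real.pi) (h : tau K p q ≤ ENNReal.ofReal X) :
    modDist K p q ≤ md K X := by
  obtain ⟨d, hd, h1, h2, h3⟩ := exists_tau_eq hc ha
  rw [h1, ENNReal.ofReal_le_ofReal_iff hX] at h
  rw [← h2]
  exact md_le_md hd.le h fun hK => (hXK hK).le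

theorem tau_le_of_modDist_le {K X : ℝ} {p q : ModelPlane} (hX : 0 ≤ X)
    (ha : chron K p q → BeforeAntipode K p q) (h : modDist K p q ≤ md K X) :
    tau K p q ≤ ENNReal.ofReal X := by
  by_cases hc : chron K p q
  · obtain ⟨d, hd, h1, h2, h3⟩ := exists_tau_eq hc (ha hc)
    rw [h1]
    exact ENNReal.ofReal_le_ofReal
      (le_of_md_le_md hX (fun hK => (h3 hK).le) (h2.trans_le h))
  · rw [tau_of_not_chron hc]; exact bot_le

theorem chron_of_tau_pos {K : ℝ} {p q : ModelPlane} (h : 0 < tau K p q) : chron K p q := by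
  by_contra hc
  rw [tau_of_not_chron hc] at h
  exact lt_irrefl _ h

/-- Comparison configurations for a triangle with a point on a side. The length of the side is
`u + v`, and `Y`, `Z` are the distances of its endpoints from the opposite vertex. -/
theorem exists_triangle_config {K u v Y Z : ℝ} (hu : 0 < u) (hv : 0 < v) (hY : 0 < Y) (hZ : 0 < Z)
    (hℓK : K < 0 → √(-K) * (u + v) < Real.pi / 2) (hYK : K < 0 → √(-K) * Y < Real.pi / 2)
    (hZK : K < 0 → √(-K) * Z < Real.pi / 2)
    (hcase : Y + Z ≤ u + v ∨ u + v + Z ≤ Y ∨ u + v + Y ≤ Z) :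
    ∃ a m b c : ModelPlane, chron K a m ∧ chron K m b ∧ tau K a m = ENNReal.ofReal u ∧
      tau K m b = ENNReal.ofReal v ∧ tau K a b = ENNReal.ofReal (u + v) ∧
      (Y + Z ≤ u + v → tau K a c = ENNReal.ofReal Y ∧ tau K c b = ENNReal.ofReal Z) ∧
      (u + v + Z ≤ Y → tau K a c = ENNReal.ofReal Y ∧ tau K b c = ENNReal.ofReal Z) ∧
      (u + v + Y ≤ Z → tau K c a = ENNReal.ofReal Y ∧ tau K c b = ENNReal.ofReal Z) ∧
      ∀ X, 0 < X → (ENNReal.ofReal X ≤ tau K m c ∨ ENNReal.ofReal X ≤ tau K c m) →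
        sn K v * hingeProd K u X Y + sn K u * hingeProd K v X Z ≤ 0 := by
  have hpi := Real.pi_pos
  have hℓ : 0 < u + v := by linarith
  have hsℓ : 0 < sn K (u + v) := sn_pos hℓ fun h => by linarith [hℓK h]
  have hsY : 0 < sn K Y := sn_pos hY fun h => by linarith [hYK h]
  -- This w makes the formula of `exists_point` return md Y at parameter 0 and md Z at parameter u +
  -- v. The three orders of the vertices give w ≥ sn Y or w ≤ -sn Y, so c is in the future or in the
  -- past of the first endpoint.
  obtain ⟨w, hw⟩ : ∃ w, w = hingeProd K (u + v) Y Z / sn K (u + v) := ⟨_, rfl⟩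
  have hwℓ : sn K (u + v) * w = hingeProd K (u + v) Y Z := by
    rw [hw, mul_div_cancel₀ _ hsℓ.ne']
  have hw1 : Y + Z ≤ u + v → sn K Y ≤ w := by
    intro h
    rw [hw, le_div_iff₀ hsℓ, hingeProd_comm, hingeProd_eq_sub]
    have := md_le_md (K := K) hZ.le (by linarith : Z ≤ u + v - Y) fun hK => by
      have : √(-K) * (u + v - Y) ≤ √(-K) * (u + v) := by gcongr; linarith
      linarith [hℓK hK]
    linarith
  have hw2 : u + v + Z ≤ Y → sn K Y ≤ w := by
    intro h
    rw [hw, le_div_iff₀ hsℓ, hingeProd_eq_sub]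
    have := md_le_md (K := K) hZ.le (by linarith : Z ≤ Y - (u + v)) fun hK => by
      have : √(-K) * (Y - (u + v)) ≤ √(-K) * Y := by gcongr; linarith
      linarith [hYK hK]
    linarith
  have hw3 : u + v + Y ≤ Z → w ≤ -sn K Y := by
    intro h
    rw [hw, div_le_iff₀ hsℓ, hingeProd_eq_add]
    have := md_le_md (K := K) (by linarith : 0 ≤ u + v + Y) h fun hK => by linarith [hZK hK]
    linarith
  have hww : sn K Y ^ 2 ≤ w ^ 2 := by
    rcases hcase with h | h | h
    · have := hw1 h; gcongr
    · have := hw2 h; gcongr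
    · have := hw3 h
      rw [← neg_sq w]
      have : sn K Y ≤ -w := by linarith
      gcongr
  obtain ⟨c, hc, hcp, hcn, hF⟩ := exists_point K hY.le hYK hww
  have nℓ : K < 0 → √(-K) * |u + v| < Real.pi / 2 := by rwa [abs_of_pos hℓ]
  have n0 : Near K (axis K 0) := near_axis fun _ => by simpa using by linarith
  have nb : Near K (axis K (u + v)) := near_axis nℓ
  have hF0 : modDist K (axis K 0) c = md K Y := by rw [hF]; simp [md_zero, sn_zero]
  have hFℓ : modDist K (axis K (u + v)) c = md K Z := by rw [hF, hwℓ, hingeProd]; ring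
  have mY : 0 < md K Y := md_pos hY fun hK => by linarith [hYK hK]
  have mZ : 0 < md K Z := md_pos hZ fun hK => by linarith [hZK hK]
  have tab : tau K (axis K 0) (axis K (u + v)) = ENNReal.ofReal (u + v) := by
    rw [tau_axis hℓ (by intro hK; rw [sub_zero]; linarith [hℓK hK]), sub_zero]
  have tam : tau K (axis K 0) (axis K u) = ENNReal.ofReal u := by
    rw [tau_axis hu, sub_zero]
    intro hK
    have : √(-K) * (u - 0) ≤ √(-K) * (u + v) := by gcongr; linarith
    linarith [hℓK hK]
  have tmb : tau K (axis K u) (axis K (u + v)) = ENNReal.ofReal v := by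
    rw [tau_axis (by linarith), add_sub_cancel_left]
    intro hK
    have : √(-K) * (u + v - u) ≤ √(-K) * (u + v) := by gcongr; linarith
    linarith [hℓK hK]
  have cam : chron K (axis K 0) (axis K u) := chron_axis hu
  have cmb : chron K (axis K u) (axis K (u + v)) := chron_axis (by linarith)
  have bab := (of_tau_eq tab hℓ fun hK => by linarith [hℓK hK]).2.1
  have time : ∀ {p q : ModelPlane}, chron K p q → (conf K p).1 < (conf K q).1 := by
    intro p q h
    exact sub_pos.1 (lt_of_le_of_lt (abs_nonneg _) h)
  have oc : 0 < w → tau K (axis K 0) c = ENNReal.ofReal Y := by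
    intro h
    refine n0.tau_eq hc ?_ hY.le (fun hK => by linarith [hYK hK]) hF0
    rcases n0.chron_or hc (by rw [hF0]; exact mY) with h1 | h1
    · exact h1
    · have := time h1
      rw [conf_axis_zero_fst] at this
      linarith [hcp h]
  -- With the chosen w, `hinge_at_endpoint` says that the chord expression is -sn (u + v) times the
  -- difference of the modified distances.
  have ineq : ∀ X, md K X ≤ modDist K (axis K u) c →
      sn K v * hingeProd K u X Y + sn K u * hingeProd K v X Z ≤ 0 := by
    intro X hX
    have h1 := hinge_at_endpoint K u v X Y Z
    have h2 : hingeProd K Y u X = modDist K (axis K u) c + sn K u * w - md K X := by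
      rw [hF, hingeProd]; ring
    rw [h2, hingeProd_comm K Y (u + v), ← hwℓ] at h1
    have := mul_nonneg hsℓ.le (sub_nonneg.2 hX)
    linarith
  refine ⟨axis K 0, axis K u, axis K (u + v), c, cam, cmb, tam, tmb, tab, ?_, ?_, ?_, ?_⟩
  · intro h
    refine ⟨oc (by linarith [hw1 h]), hc.tau_eq nb ?_ hZ.le (fun hK => by linarith [hZK hK])
      (by rw [modDist_comm]; exact hFℓ)⟩
    rcases nb.chron_or hc (by rw [hFℓ]; exact mZ) with h1 | h1
    · exfalso
      obtain ⟨o1, o2, -⟩ := of_tau_eq (oc (by linarith [hw1 h])) hY fun hK => by linarith [hYK hK]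
      have := modDist_lt_modDist (chron_axis hℓ) h1.causal
        (by rintro h; rw [h, chron_iff] at h1; exact lt_irrefl _ h1.1) o2
      rw [hF0, modDist_axis, sub_zero] at this
      have h2 := md_le_md (K := K) hY.le (by linarith : Y ≤ u + v) fun hK => by
        linarith [hℓK hK]
      linarith
    · exact h1
  · intro h
    refine ⟨oc (by linarith [hw2 h]), nb.tau_eq hc ?_ hZ.le (fun hK => by linarith [hZK hK]) hFℓ⟩
    rcases nb.chron_or hc (by rw [hFℓ]; exact mZ) with h1 | h1
    · exact h1
    · exfalso
      obtain ⟨o1, o2, -⟩ := of_tau_eq (oc (by linarith [hw2 h])) hY fun hK => by linarith [hYK hK]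
      have := modDist_lt_modDist o1 h1.causal
        (by rintro h; rw [← h, chron_iff] at h1; exact lt_irrefl _ h1.1) bab
      rw [hF0, modDist_axis, sub_zero] at this
      have h2 := md_le_md (K := K) hℓ.le (by linarith : u + v ≤ Y) fun hK => by
        linarith [hYK hK]
      linarith
  · intro h
    have ca : chron K c (axis K 0) := by
      rcases n0.chron_or hc (by rw [hF0]; exact mY) with h1 | h1
      · have := time h1
        rw [conf_axis_zero_fst] at this
        linarith [hcn (by linarith [hw3 h])]
      · exact h1
    exact ⟨hc.tau_eq n0 ca hY.le (fun hK => by linarith [hYK hK])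
      (by rw [modDist_comm]; exact hF0), hc.tau_eq nb (chron_trans ca (chron_axis hℓ)) hZ.le
      (fun hK => by linarith [hZK hK]) (by rw [modDist_comm]; exact hFℓ)⟩
  · intro X hX hX2
    have rel : (chron K (axis K u) c ∧ ENNReal.ofReal X ≤ tau K (axis K u) c) ∨
        (chron K c (axis K u) ∧ ENNReal.ofReal X ≤ tau K c (axis K u)) := by
      have := ENNReal.ofReal_pos.2 hX
      rcases hX2 with h | h
      · exact Or.inl ⟨chron_of_tau_pos (this.trans_le h), h⟩
      · exact Or.inr ⟨chron_of_tau_pos (this.trans_le h), h⟩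
    apply ineq
    have yK : K < 0 → √(-K) * Y < Real.pi := fun hK => by linarith [hYK hK]
    have zK : K < 0 → √(-K) * Z < Real.pi := fun hK => by linarith [hZK hK]
    -- Both m and c lie causally between a' and b', so the antipode condition for a', b' passes to
    -- m, c in either order.
    have fin : ∀ a' b' : ModelPlane, BeforeAntipode K a' b' → causal K a' (axis K u) →
        causal K (axis K u) b' → causal K a' c → causal K c b' →
        md K X ≤ modDist K (axis K u) c := by
      intro a' b' hab h1 h2 h3 h4
      rcases rel with ⟨r1, r2⟩ | ⟨r1, r2⟩
      · exact md_le_modDist r1 (hab.mono h1 h4) hX.le r2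
      · rw [modDist_comm]; exact md_le_modDist r1 (hab.mono h3 h2) hX.le r2
    have refl : ∀ p, causal K p p := fun p => by rw [causal_iff]; exact ⟨le_rfl, le_rfl⟩
    rcases hcase with h | h | h
    · have h1 := oc (by linarith [hw1 h])
      obtain ⟨o1, -, -⟩ := of_tau_eq h1 hY yK
      rcases nb.chron_or hc (by rw [hFℓ]; exact mZ) with h2 | h2
      · obtain ⟨-, o2, -⟩ := of_tau_eq h1 hY yK
        exact fin _ _ o2 cam.causal (chron_trans cmb h2).causal o1.causal (refl c)
      · exact fin _ _ bab cam.causal cmb.causal o1.causal h2.causal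
    · have h1 := oc (by linarith [hw2 h])
      obtain ⟨o1, o2, -⟩ := of_tau_eq h1 hY yK
      rcases nb.chron_or hc (by rw [hFℓ]; exact mZ) with h2 | h2
      · exact fin _ _ o2 cam.causal (chron_trans cmb h2).causal o1.causal (refl c)
      · exact fin _ _ bab cam.causal cmb.causal o1.causal h2.causal
    · have ca : chron K c (axis K 0) := by
        rcases n0.chron_or hc (by rw [hF0]; exact mY) with h1 | h1
        · have := time h1
          rw [conf_axis_zero_fst] at this
          linarith [hcn (by linarith [hw3 h])]
        · exact h1
      have hcb := chron_trans ca (chron_axis hℓ)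
      have := hc.tau_eq nb hcb hZ.le zK (by rw [modDist_comm]; exact hFℓ)
      exact fin _ _ (of_tau_eq this hZ zK).2.1 (chron_trans ca cam).causal cmb.causal (refl c)
        hcb.causal

/-- The four-point inequality in terms of a comparison configuration. -/
theorem fourPointIneq_iff {K e x y X Y z : ℝ} {p o q r : ModelPlane} (he : 0 < sn K e)
    (hpo : modDist K o p = md K e) (hoq : modDist K o q = md K x) (hor : modDist K o r = md K y)
    (hpq : modDist K p q = md K X) (hpr : modDist K p r = md K Y)
    (hs : OppositeSides K p o q r) :
    FourPointIneq K e x y X Y z ↔ modDist K q r ≤ md K z := by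
  obtain ⟨κ, hκ, gram⟩ := exists_gram K
  have e1 := gram o p q r
  have e2 := gram o p q q
  have e3 := gram o p r r
  rw [hinge_eq hpo hoq hpq] at e1 e2
  rw [hinge_eq hpo hor hpr] at e1 e3
  rw [hpo, ← sn_sq] at e1 e2 e3
  have h2 : hinge K o q q = sn K x ^ 2 := by
    rw [hinge, hoq, modDist_self, sn_sq]; ring
  have h3 : hinge K o r r = sn K y ^ 2 := by
    rw [hinge, hor, modDist_self, sn_sq]; ring
  have h4 : hinge K o q r = hingeProd K x y z + (md K z - modDist K q r) := by
    rw [hinge, hingeProd, hoq, hor]; ring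
  rw [h2] at e2
  rw [h3] at e3
  rw [h4] at e1
  -- The diagonal cases of the Gram identity evaluate the two square roots as √κ |side|. On opposite
  -- sides their product equals -κ times the product of the sides, which turns the mixed Gram
  -- identity into equality in the four-point inequality.
  have s2 : √(hingeProd K e x X ^ 2 - sn K e ^ 2 * sn K x ^ 2) = √κ * |side K p o q| := by
    rw [e2, ← Real.sqrt_sq_eq_abs, ← Real.sqrt_mul hκ.le]; congr 1; ring
  have s3 : √(hingeProd K e y Y ^ 2 - sn K e ^ 2 * sn K y ^ 2) = √κ * |side K p o r| := by
    rw [e3, ← Real.sqrt_sq_eq_abs, ← Real.sqrt_mul hκ.le]; congr 1; ring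
  have hs' : |side K p o q| * |side K p o r| = -(side K p o q * side K p o r) := by
    rw [← abs_mul, abs_of_nonpos hs]
  have hκ2 : √κ * √κ = κ := Real.mul_self_sqrt hκ.le
  have e4 : √κ * |side K p o q| * (√κ * |side K p o r|) =
      -(κ * (side K p o q * side K p o r)) := by
    rw [show √κ * |side K p o q| * (√κ * |side K p o r|) =
      (√κ * √κ) * (|side K p o q| * |side K p o r|) by ring, hκ2, hs']; ring
  have he2 : 0 < sn K e ^ 2 := by positivity
  unfold FourPointIneq
  rw [s2, s3, e4]
  constructor
  · intro h
    by_contra! hc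
    have := mul_neg_of_pos_of_neg he2 (sub_neg.2 hc)
    linarith
  · intro h
    have := mul_nonneg he2.le (sub_nonneg.2 h)
    linarith

/-- Comparison configurations for four points. -/
theorem exists_fourPoint_config {K e x y X Y : ℝ} (he : 0 < e) (hx : 0 < x) (hxy : x ≤ y)
    (hX : e + x ≤ X) (hY : e + y ≤ Y) (hXK : K < 0 → √(-K) * X < Real.pi / 2)
    (hYK : K < 0 → √(-K) * Y < Real.pi / 2) :
    ∃ p o q r : ModelPlane, tau K p o = ENNReal.ofReal e ∧ tau K o q = ENNReal.ofReal x ∧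
      tau K o r = ENNReal.ofReal y ∧ tau K p q = ENNReal.ofReal X ∧
      tau K p r = ENNReal.ofReal Y ∧ OppositeSides K p o q r ∧
      ∀ z, 0 ≤ z → (K < 0 → √(-K) * z < Real.pi) → tau K q r ≤ ENNReal.ofReal z →
        FourPointIneq K e x y X Y z := by
  have hpi := Real.pi_pos
  have hy : 0 < y := hx.trans_le hxy
  have eK : K < 0 → √(-K) * e < Real.pi / 2 := fun hK => by
    have : √(-K) * e ≤ √(-K) * X := by gcongr; linarith
    linarith [hXK hK]
  have se : 0 < sn K e := sn_pos he fun hK => by linarith [eK hK]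
  have nearO : Near K (axis K 0) := near_axis fun _ => by simpa using by linarith
  have nearP : Near K (axis K (-e)) := near_axis fun hK => by
    rw [abs_neg, abs_of_pos he]; exact eK hK
  have cpo : chron K (axis K (-e)) (axis K 0) := chron_axis (by linarith)
  have tpo : tau K (axis K (-e)) (axis K 0) = ENNReal.ofReal e := by
    rw [tau_axis (by linarith) (by intro hK; simpa using by linarith [eK hK])]
    simp
  have build : ∀ x X : ℝ, 0 < x → e + x ≤ X → (K < 0 → √(-K) * X < Real.pi / 2) →
      ∃ q, Near K q ∧ 0 < (conf K q).1 ∧ modDist K (axis K 0) q = md K x ∧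
        modDist K (axis K (-e)) q = md K X := by
    intro x X hx hX hXK
    have xK : K < 0 → √(-K) * x < Real.pi / 2 := fun hK => by
      have : √(-K) * x ≤ √(-K) * X := by gcongr; linarith
      linarith [hXK hK]
    have sx : 0 < sn K x := sn_pos hx fun hK => by linarith [xK hK]
    have hA := ComparisonSpace.hingeProd_le_neg (K := K) he.le hx.le hX fun hK => by
      linarith [hXK hK]
    have hw : sn K x ≤ -hingeProd K e x X / sn K e := by
      rw [le_div_iff₀ se]; linarith
    obtain ⟨q, h1, h2, -, h4⟩ := exists_point K hx.le xK
      (w := -hingeProd K e x X / sn K e) (by gcongr)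
    refine ⟨q, h1, h2 (by linarith), ?_, ?_⟩
    · rw [h4]; simp [md_zero, sn_zero]
    · rw [h4, md_neg, sn_neg, neg_mul, mul_div_cancel₀ _ se.ne', hingeProd]; ring
  have build2 : ∀ (x X : ℝ) (q : ModelPlane), 0 < x → e + x ≤ X →
      (K < 0 → √(-K) * X < Real.pi / 2) → Near K q → 0 < (conf K q).1 →
      modDist K (axis K 0) q = md K x → modDist K (axis K (-e)) q = md K X →
      tau K (axis K 0) q = ENNReal.ofReal x ∧ tau K (axis K (-e)) q = ENNReal.ofReal X := by
    intro x X q hx hX hXK hq hq0 h1 h2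
    have xK : K < 0 → √(-K) * x < Real.pi := fun hK => by
      have : √(-K) * x ≤ √(-K) * X := by gcongr; linarith
      linarith [hXK hK]
    have coq : chron K (axis K 0) q := by
      rcases nearO.chron_or hq (by rw [h1]; exact md_pos hx fun hK => (xK hK).le) with h | h
      · exact h
      · have := sub_pos.1 (lt_of_le_of_lt (abs_nonneg _) h)
        rw [conf_axis_zero_fst] at this
        linarith
    exact ⟨nearO.tau_eq hq coq hx.le xK h1, nearP.tau_eq hq (chron_trans cpo coq) (by linarith)
      (fun hK => by linarith [hXK hK]) h2⟩
  obtain ⟨q, nq, tq, oq, pq⟩ := build x X hx hX hXK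
  obtain ⟨r', nr', tr', or', pr'⟩ := build y Y hy hY hYK
  -- If r' is on the same side as q, its mirror image in the axis is used: all distances to p and o
  -- are kept and the side changes sign.
  obtain ⟨r, nr, tr, or, pr, hs⟩ : ∃ r, Near K r ∧ 0 < (conf K r).1 ∧
      modDist K (axis K 0) r = md K y ∧ modDist K (axis K (-e)) r = md K Y ∧
      OppositeSides K (axis K (-e)) (axis K 0) q r := by
    by_cases h : OppositeSides K (axis K (-e)) (axis K 0) q r'
    · exact ⟨r', nr', tr', or', pr', h⟩
    · refine ⟨reflect r', nr'.reflect, by rw [conf_reflect]; exact tr',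
        by rw [modDist_axis_reflect]; exact or', by rw [modDist_axis_reflect]; exact pr', ?_⟩
      unfold OppositeSides at h ⊢
      rw [side_axis_reflect]
      linarith
  obtain ⟨t1, t2⟩ := build2 x X q hx hX hXK nq tq oq pq
  obtain ⟨t3, t4⟩ := build2 y Y r hy hY hYK nr tr or pr
  refine ⟨axis K (-e), axis K 0, q, r, tpo, t1, t3, t2, t4, hs, fun z hz hzK hle => ?_⟩
  have yK : K < 0 → √(-K) * y < Real.pi := fun hK => by
    have : √(-K) * y ≤ √(-K) * Y := by gcongr; linarith
    linarith [hYK hK]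
  have xK : K < 0 → √(-K) * x < Real.pi := fun hK => by
    have : √(-K) * x ≤ √(-K) * y := by gcongr
    linarith [yK hK]
  rw [fourPointIneq_iff se (by rw [modDist_axis, sub_zero, md_neg])
    oq or pq pr hs]
  -- A non-positive modified distance needs no argument, as md z ≥ 0. Otherwise q and r are related,
  -- and r ≪ q is impossible since it would make τ(o, r) smaller than τ(o, q).
  by_cases hpos : 0 < modDist K q r
  · obtain ⟨c1, b1, -⟩ := of_tau_eq t1 hx xK
    obtain ⟨c2, b2, -⟩ := of_tau_eq t3 hy yK
    rcases nq.chron_or nr hpos with h | h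
    · exact modDist_le_md h (b2.mono c1.causal (by rw [causal_iff]; exact ⟨le_rfl, le_rfl⟩))
        hz hzK hle
    · exfalso
      have := modDist_lt_modDist c2 h.causal
        (by rintro h'; rw [h', chron_iff] at h; exact lt_irrefl _ h.1) b1
      rw [oq, or] at this
      linarith [md_le_md (K := K) hx.le hxy fun hK => (yK hK).le]
  · exact (not_lt.1 hpos).trans (md_nonneg hz fun hK => (hzK hK).le)

theorem chron_timeReflect {K : ℝ} {p q : ModelPlane} :
    chron K (timeReflect q) (timeReflect p) ↔ chron K p q := by
  simp only [chron_iff, nullP_timeReflect, nullM_timeReflect]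
  constructor <;> rintro ⟨h1, h2⟩ <;> constructor <;> linarith

theorem tau_timeReflect (K : ℝ) (p q : ModelPlane) :
    tau K (timeReflect q) (timeReflect p) = tau K p q := by
  by_cases hc : chron K p q
  · have hc' := chron_timeReflect.2 hc
    rcases lt_trichotomy K 0 with hK | hK | hK
    · have e : causal K (timeReflect p) ((timeReflect q).1 + Real.pi, -(timeReflect q).2) ↔
          causal K q (p.1 + Real.pi, -p.2) := by
        rw [causal_antipode_iff hK, causal_antipode_iff hK]
        simp only [nullP_timeReflect, nullM_timeReflect]
        constructor <;> rintro ⟨h1, h2⟩ <;> constructor <;> linarith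
      have e1 : Real.cosh (timeReflect q).2 * Real.cosh (timeReflect p).2 *
            Real.cos ((timeReflect p).1 - (timeReflect q).1)
            - Real.sinh (timeReflect q).2 * Real.sinh (timeReflect p).2 =
          Real.cosh p.2 * Real.cosh q.2 * Real.cos (q.1 - p.1) - Real.sinh p.2 * Real.sinh q.2 := by
        simp only [timeReflect]
        rw [show -p.1 - -q.1 = q.1 - p.1 by ring]; ring
      unfold tau
      rw [if_pos hc, if_pos hc', if_neg hK.not_gt, if_neg hK.ne, if_neg hK.not_gt, if_neg hK.ne, e1]
      by_cases h : causal K q (p.1 + Real.pi, -p.2)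
      · rw [if_pos h, if_pos (e.2 h)]
      · rw [if_neg h, if_neg (mt e.1 h)]
    · subst hK
      simp only [tau, hc, hc', lt_irrefl, if_true, if_false]
      simp only [timeReflect]
      congr 2; ring
    · simp only [tau, hc, hc', hK, if_true]
      simp only [timeReflect, Real.cosh_neg, Real.sinh_neg]
      rw [← Real.cos_neg, show -(p.2 - q.2) = q.2 - p.2 by ring, mul_comm (Real.cosh q.1)]
      congr 3; ring
  · rw [tau_of_not_chron hc, tau_of_not_chron (mt chron_timeReflect.1 hc)]

theorem side_timeReflect (K : ℝ) (p q r : ModelPlane) :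
    side K (timeReflect p) (timeReflect q) (timeReflect r) = -side K p q r := by
  rcases lt_trichotomy K 0 with hK | hK | hK
  · simp [side_eq, embed, hK.not_gt, hK.ne, timeReflect]; ring
  · subst hK; simp [side_eq, embed, timeReflect]; ring
  · simp [side_eq, embed, hK, timeReflect]; ring

theorem oppositeSides_swap {K : ℝ} {p o q r : ModelPlane} :
    OppositeSides K o p q r ↔ OppositeSides K p o q r := by
  unfold OppositeSides
  have : ∀ s, side K o p s = -side K p o s := fun s => by rw [side_eq, side_eq]; ring
  rw [this, this, neg_mul_neg]

theorem oppositeSides_comm {K : ℝ} {p o q r : ModelPlane} :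
    OppositeSides K p o q r ↔ OppositeSides K p o r q := by
  unfold OppositeSides
  rw [mul_comm]

theorem oppositeSides_timeReflect {K : ℝ} {p o q r : ModelPlane} :
    OppositeSides K (timeReflect p) (timeReflect o) (timeReflect q) (timeReflect r) ↔
      OppositeSides K p o q r := by
  unfold OppositeSides
  rw [side_timeReflect, side_timeReflect, neg_mul_neg]

end ModelPlane

namespace LorentzianPreLengthSpace

variable {X : Type*} [MetricSpace X] (L : LorentzianPreLengthSpace X)

/-! ### Distance realizers -/

variable {L}

theorem IsPartition.le_of_le {n : ℕ} {t : ℕ → ℝ} (h : IsPartition n t) {i j : ℕ} (hij : i ≤ j)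
    (hj : j ≤ n) : t i ≤ t j := by
  induction j, hij using Nat.le_induction with
  | base => exact le_rfl
  | succ k _ ih => exact (ih (by omega)).trans (h.2.2 k (by omega)).le

theorem IsPartition.mem_Icc {n : ℕ} {t : ℕ → ℝ} (h : IsPartition n t) {i : ℕ} (hi : i ≤ n) :
    t i ∈ Icc (0 : ℝ) 1 :=
  ⟨h.1 ▸ h.le_of_le (Nat.zero_le i) hi, h.2.1 ▸ h.le_of_le hi le_rfl⟩

theorem curveLength_le {γ : ℝ → X} {n : ℕ} {t : ℕ → ℝ} (h : IsPartition n t) :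
    L.curveLength γ ≤ ∑ i ∈ Finset.range n, L.tau (γ (t i)) (γ (t (i + 1))) :=
  (iInf_le _ n).trans ((iInf_le _ t).trans (iInf_le _ h))

theorem curveLength_le_tau (γ : ℝ → X) : L.curveLength γ ≤ L.tau (γ 0) (γ 1) := by
  have h : IsPartition 1 (fun i => (i : ℝ)) := ⟨by simp, by simp, fun i hi => by simp⟩
  simpa using curveLength_le (L := L) (γ := γ) h

theorem curveLength_le_two (γ : ℝ → X) {s : ℝ} (h0 : 0 < s) (h1 : s < 1) :
    L.curveLength γ ≤ L.tau (γ 0) (γ s) + L.tau (γ s) (γ 1) := by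
  have h : IsPartition 2 (fun i => if i = 0 then 0 else if i = 1 then s else 1) := by
    refine ⟨by simp, by simp, fun i hi => ?_⟩
    interval_cases i <;> simp [h0, h1]
  simpa [Finset.sum_range_succ] using curveLength_le (L := L) (γ := γ) h

theorem curveLength_le_three (γ : ℝ → X) {s t : ℝ} (h0 : 0 < s) (hst : s < t) (h1 : t < 1) :
    L.curveLength γ ≤ L.tau (γ 0) (γ s) + L.tau (γ s) (γ t) + L.tau (γ t) (γ 1) := by
  have h : IsPartition 3
      (fun i => if i = 0 then 0 else if i = 1 then s else if i = 2 then t else 1) := by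
    refine ⟨by simp, by simp, fun i hi => ?_⟩
    interval_cases i <;> simp [h0, h1, hst]
  simpa [Finset.sum_range_succ] using curveLength_le (L := L) (γ := γ) h

theorem tau_self_eq_zero {x y : X} (h : L.causal x y) (ht : L.tau x y ≠ ⊤) : L.tau x x = 0 := by
  have h1 := L.tau_triangle x x y (L.causal_refl x) h
  by_contra h0
  rw [add_comm] at h1
  exact absurd h1 (not_le.2 (ENNReal.lt_add_right ht h0))

theorem IsCausalCurve.causal_of_le {γ : ℝ → X} (h : L.IsCausalCurve γ) {s t : ℝ} (hs : 0 ≤ s)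
    (hst : s ≤ t) (ht : t ≤ 1) : L.causal (γ s) (γ t) := by
  rcases hst.eq_or_lt with rfl | hlt
  · exact L.causal_refl _
  · exact h.2.1 s ⟨hs, hst.trans ht⟩ t ⟨hs.trans hst, ht⟩ hlt

/-- Time separations along a distance realizer, measured from its starting point. -/
theorem IsDistanceRealizer.tau_zero_add {γ : ℝ → X} {x y : X} (h : L.IsDistanceRealizer γ x y)
    (hfin : L.tau x y ≠ ⊤) {s t : ℝ} (hs : 0 ≤ s) (hst : s < t) (ht : t ≤ 1) :
    L.tau (γ 0) (γ s) + L.tau (γ s) (γ t) = L.tau (γ 0) (γ t) := by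
  obtain ⟨hc, rfl, rfl, hlen⟩ := h
  have tri := fun {a b c : ℝ} (h1 : 0 ≤ a) (h2 : a ≤ b) (h3 : b ≤ c) (h4 : c ≤ 1) =>
    L.tau_triangle _ _ _ (hc.causal_of_le h1 h2 (h3.trans h4))
      (hc.causal_of_le (h1.trans h2) h3 h4)
  have two : ∀ r, 0 < r → r < 1 →
      L.tau (γ 0) (γ r) + L.tau (γ r) (γ 1) = L.tau (γ 0) (γ 1) := fun r h0 h1 =>
    le_antisymm (tri le_rfl h0.le h1.le le_rfl) (hlen ▸ curveLength_le_two γ h0 h1)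
  rcases hs.eq_or_lt with rfl | hs0
  · rw [tau_self_eq_zero (hc.causal_of_le le_rfl zero_le_one le_rfl) hfin, zero_add]
  rcases ht.eq_or_lt with rfl | ht1
  · exact two s hs0 hst
  -- The partition 0, s, t, 1 cannot have a smaller sum than the partition 0, t, 1, which already
  -- attains the length. The common last summand is finite and can be cancelled.
  have h3 : L.tau (γ 0) (γ s) + L.tau (γ s) (γ t) + L.tau (γ t) (γ 1) =
      L.tau (γ 0) (γ t) + L.tau (γ t) (γ 1) := by
    refine le_antisymm (add_le_add_left (tri le_rfl hs hst.le ht) _) ?_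
    rw [two t (hs0.trans hst) ht1]
    exact hlen ▸ curveLength_le_three γ hs0 hst ht1
  have hfin' : L.tau (γ t) (γ 1) ≠ ⊤ :=
    ne_top_of_le_ne_top hfin ((two t (hs0.trans hst) ht1) ▸ le_add_self)
  exact (ENNReal.add_left_inj hfin').1 h3

theorem IsDistanceRealizer.tau_zero_ne_top {γ : ℝ → X} {x y : X} (h : L.IsDistanceRealizer γ x y)
    (hfin : L.tau x y ≠ ⊤) {s : ℝ} (hs : 0 ≤ s) (hs1 : s ≤ 1) : L.tau (γ 0) (γ s) ≠ ⊤ := by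
  have h' := h
  obtain ⟨hc, rfl, rfl, hlen⟩ := h'
  rcases hs1.eq_or_lt with rfl | hs1
  · exact hfin
  · exact ne_top_of_le_ne_top hfin ((h.tau_zero_add hfin hs hs1 le_rfl) ▸ le_self_add)

theorem IsDistanceRealizer.tau_add {γ : ℝ → X} {x y : X} (h : L.IsDistanceRealizer γ x y)
    (hfin : L.tau x y ≠ ⊤) {r s t : ℝ} (hr : 0 ≤ r) (hrs : r < s) (hst : s < t) (ht : t ≤ 1) :
    L.tau (γ r) (γ s) + L.tau (γ s) (γ t) = L.tau (γ r) (γ t) := by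
  have h1 := h.tau_zero_add hfin hr hrs (hst.le.trans ht)
  have h2 := h.tau_zero_add hfin (hr.trans hrs.le) hst ht
  have h3 := h.tau_zero_add hfin hr (hrs.trans hst) ht
  have h4 := h.tau_zero_ne_top hfin hr ((hrs.trans hst).le.trans ht)
  rw [← h1, add_assoc, ← h3] at h2
  exact (ENNReal.add_right_inj h4).1 h2

theorem IsDistanceRealizer.tau_ne_top {γ : ℝ → X} {x y : X} (h : L.IsDistanceRealizer γ x y)
    (hfin : L.tau x y ≠ ⊤) {s t : ℝ} (hs : 0 ≤ s) (hst : s < t) (ht : t ≤ 1) :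
    L.tau (γ s) (γ t) ≠ ⊤ :=
  ne_top_of_le_ne_top (h.tau_zero_ne_top hfin (hs.trans hst.le) ht)
    ((h.tau_zero_add hfin hs hst ht) ▸ le_add_self)

/-- Subsegments of distance realizers are distance realizers. -/
theorem IsDistanceRealizer.subsegment {γ : ℝ → X} {x y : X} (h : L.IsDistanceRealizer γ x y)
    (hfin : L.tau x y ≠ ⊤) {a b : ℝ} (ha : 0 ≤ a) (hab : a < b) (hb : b ≤ 1) :
    L.IsDistanceRealizer (fun u => γ (a + (b - a) * u)) (γ a) (γ b) := by
  have hba : 0 < b - a := by linarith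
  have mem : ∀ u ∈ Icc (0 : ℝ) 1, a + (b - a) * u ∈ Icc (0 : ℝ) 1 := by
    intro u hu
    have h1 := mul_nonneg hba.le hu.1
    have h2 : (b - a) * u ≤ b - a := mul_le_of_le_one_right hba.le hu.2
    exact ⟨by linarith, by linarith⟩
  have lt : ∀ {u v : ℝ}, u < v → a + (b - a) * u < a + (b - a) * v := fun huv => by gcongr
  obtain ⟨⟨C, hC⟩, hmon, hnc⟩ := h.1
  refine ⟨⟨⟨C * Real.toNNReal (b - a), ?_⟩, ?_, ?_⟩, by simp, by simp, ?_⟩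
  · have hl : LipschitzOnWith (Real.toNNReal (b - a)) (fun u : ℝ => a + (b - a) * u)
        (Icc 0 1) := by
      refine LipschitzOnWith.of_dist_le_mul fun u _ v _ => ?_
      rw [Real.dist_eq, Real.dist_eq, Real.coe_toNNReal _ hba.le,
        show a + (b - a) * u - (a + (b - a) * v) = (b - a) * (u - v) by ring, abs_mul,
        abs_of_pos hba]
    exact hC.comp hl mem
  · exact fun s hs t ht hst => hmon _ (mem s hs) _ (mem t ht) (lt hst)
  · intro s hs t ht hst
    obtain ⟨r, hr, hne⟩ := hnc _ (mem s hs) _ (mem t ht) (lt hst)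
    refine ⟨(r - a) / (b - a), ⟨?_, ?_⟩, ?_⟩
    · rw [le_div_iff₀ hba]; linarith [hr.1]
    · rw [div_le_iff₀ hba]; linarith [hr.2]
    · simp only
      rw [mul_div_cancel₀ _ hba.ne', add_sub_cancel]
      exact hne
  · refine le_antisymm ?_ ?_
    · simpa using curveLength_le_tau (L := L) (fun u => γ (a + (b - a) * u))
    · refine le_iInf fun n => le_iInf fun t => le_iInf fun ht => ?_
      -- By additivity every partition of the subsegment gives the same sum, so the infimum is
      -- attained by each of them.
      have key : ∀ k ≤ n, ∑ i ∈ Finset.range k, L.tau (γ (a + (b - a) * t i))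
          (γ (a + (b - a) * t (i + 1))) = L.tau (γ a) (γ (a + (b - a) * t k)) := by
        intro k
        induction k with
        | zero =>
          intro _
          have h1 : L.causal (γ a) (γ b) := h.1.causal_of_le ha hab.le hb
          simp [ht.1, tau_self_eq_zero h1 (h.tau_ne_top hfin ha hab hb)]
        | succ k ih =>
          intro hk
          rw [Finset.sum_range_succ, ih (by omega)]
          rcases Nat.eq_zero_or_pos k with rfl | hk0
          · have h1 : L.causal (γ a) (γ b) := h.1.causal_of_le ha hab.le hb
            simp [ht.1, tau_self_eq_zero h1 (h.tau_ne_top hfin ha hab hb)]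
          · have h0k : t 0 < t k :=
              (ht.2.2 0 (by omega)).trans_le (ht.le_of_le (by omega) (by omega))
            rw [ht.1] at h0k
            have := h.tau_add hfin ha (s := a + (b - a) * t k) (t := a + (b - a) * t (k + 1))
              (by linarith [mul_pos hba h0k]) (lt (ht.2.2 k (by omega)))
              (mem _ (ht.mem_Icc hk)).2
            exact this
      rw [key n le_rfl, ht.2.1]
      simp

theorem IsDistanceRealizer.congr {γ γ' : ℝ → X} {x y : X} (h : L.IsDistanceRealizer γ x y)
    (heq : EqOn γ γ' (Icc 0 1)) : L.IsDistanceRealizer γ' x y := by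
  obtain ⟨⟨⟨C, hC⟩, hmon, hnc⟩, h0, h1, hlen⟩ := h
  refine ⟨⟨⟨C, ?_⟩, ?_, ?_⟩, ?_, ?_, ?_⟩
  · intro s hs t ht
    rw [← heq hs, ← heq ht]; exact hC hs ht
  · intro s hs t ht hst
    rw [← heq hs, ← heq ht]; exact hmon s hs t ht hst
  · intro s hs t ht hst
    obtain ⟨r, hr, hne⟩ := hnc s hs t ht hst
    exact ⟨r, hr, by rwa [← heq hs, ← heq ⟨hs.1.trans hr.1, hr.2.trans ht.2⟩]⟩
  · rw [← heq ⟨le_rfl, zero_le_one⟩]; exact h0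
  · rw [← heq ⟨zero_le_one, le_rfl⟩]; exact h1
  · rw [← hlen]
    unfold curveLength
    refine iInf_congr fun n => iInf_congr fun t => iInf_congr fun ht => ?_
    refine Finset.sum_congr rfl fun i hi => ?_
    rw [Finset.mem_range] at hi
    rw [heq (ht.mem_Icc hi.le), heq (ht.mem_Icc hi)]

/-! ### Good neighbourhoods -/

/-- An upper bound for the time separations in the neighbourhoods used for comparison. -/
def smallRadius (K : ℝ) : ℝ := if K < 0 then Real.pi / (4 * √(-K)) else 1

theorem smallRadius_pos (K : ℝ) : 0 < smallRadius K := by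
  unfold smallRadius
  split_ifs with h
  · have : 0 < √(-K) := Real.sqrt_pos.2 (by linarith)
    have := Real.pi_pos
    positivity
  · exact one_pos

theorem sqrt_mul_lt_of_lt_smallRadius {K d : ℝ} (hd : d < smallRadius K) (hK : K < 0) :
    √(-K) * d < Real.pi / 4 := by
  have h : 0 < √(-K) := Real.sqrt_pos.2 (by linarith)
  rw [smallRadius, if_pos hK, lt_div_iff₀ (by positivity)] at hd
  linarith

theorem ofReal_smallRadius_lt (K : ℝ) : ENNReal.ofReal (smallRadius K) < diamBound K := by
  unfold smallRadius diamBound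
  split_ifs with h
  · have : 0 < √(-K) := Real.sqrt_pos.2 (by linarith)
    rw [ENNReal.ofReal_lt_ofReal_iff (div_pos Real.pi_pos this)]
    have := Real.pi_pos
    exact div_lt_div_of_pos_left Real.pi_pos (by positivity) (by linarith)
  · exact ENNReal.ofReal_lt_top

variable (L)

/-- Open, causally convex neighbourhoods with small, continuous time separation. -/
structure IsGood (K : ℝ) (W : Set X) : Prop where
  isOpen : IsOpen W
  convex : ∀ x ∈ W, ∀ y ∈ W, ∀ z, L.causal x z → L.causal z y → z ∈ W
  small : ∀ x ∈ W, ∀ y ∈ W, L.tau x y < ENNReal.ofReal (smallRadius K)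
  cont : ContinuousOn (fun p : X × X => L.tau p.1 p.2) (W ×ˢ W)

variable {L}

/-- The push-up property, a consequence of the reverse triangle inequality and positivity of τ on ≪.
-/
theorem chron_of_chron_of_causal {x y z : X} (h1 : L.chron x y) (h2 : L.causal y z) :
    L.chron x z := by
  rw [← L.tau_pos_iff] at *
  exact (h1.trans_le le_self_add).trans_le (L.tau_triangle x y z (L.chron_causal x y
    ((L.tau_pos_iff x y).1 h1)) h2)

theorem chron_of_causal_of_chron {x y z : X} (h1 : L.causal x y) (h2 : L.chron y z) :
    L.chron x z := by
  rw [← L.tau_pos_iff] at *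
  exact (h2.trans_le le_add_self).trans_le (L.tau_triangle x y z h1 (L.chron_causal y z
    ((L.tau_pos_iff y z).1 h2)))

theorem tau_self_of_not_chron {x : X} (h : ¬ L.chron x x) : L.tau x x = 0 := by
  rw [← L.tau_pos_iff] at h
  exact le_antisymm (not_lt.1 h) bot_le

/-- From 2 τ(x, x) ≤ τ(x, x), the value is 0 or ∞, and x ≪ x excludes 0. -/
theorem tau_self_eq_top {x : X} (h : L.chron x x) : L.tau x x = ⊤ := by
  by_contra ht
  have := tau_self_eq_zero (L.causal_refl x) ht
  rw [← L.tau_pos_iff, this] at h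
  exact lt_irrefl _ h

/-- In a strongly causal space, points with `p ≪ p` are isolated. -/
theorem StronglyCausal.isOpen_singleton (hsc : L.StronglyCausal) {p : X} (hp : L.chron p p) :
    IsOpen ({p} : Set X) := by
  have hopen : IsOpen (L.diamond p p) := by
    have : IsOpen[TopologicalSpace.generateFrom {s : Set X | ∃ x y, s = L.diamond x y}]
        (L.diamond p p) := TopologicalSpace.isOpen_generateFrom_of_mem ⟨p, p, rfl⟩
    rwa [hsc] at this
  have heq : L.diamond p p = {p} := by
    refine Subset.antisymm (fun z hz => ?_) (singleton_subset_iff.2 ⟨hp, hp⟩)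
    -- For p ≪ z ≪ p, the points z and p lie in the same diamonds, hence have the same
    -- neighbourhoods. A metric space separates points.
    have hn : 𝓝 z = 𝓝 p := by
      have e : ∀ a : X, 𝓝 a = @nhds X (TopologicalSpace.generateFrom
          {s : Set X | ∃ x y, s = L.diamond x y}) a := fun a => by rw [hsc]
      rw [e, e, TopologicalSpace.nhds_generateFrom, TopologicalSpace.nhds_generateFrom]
      have : ∀ s : Set X, (z ∈ s ∧ s ∈ {s : Set X | ∃ x y, s = L.diamond x y}) ↔
          (p ∈ s ∧ s ∈ {s : Set X | ∃ x y, s = L.diamond x y}) := by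
        intro s
        refine and_congr_left ?_
        rintro ⟨x, y, rfl⟩
        exact ⟨fun h => ⟨L.chron_trans _ _ _ h.1 hz.2, L.chron_trans _ _ _ hz.1 h.2⟩,
          fun h => ⟨L.chron_trans _ _ _ h.1 hz.1, L.chron_trans _ _ _ hz.2 h.2⟩⟩
      simp only [mem_ofPred_eq] at this ⊢
      simp only [this]
    exact mem_singleton_iff.2 (nhds_injective hn)
  rwa [heq] at hopen

theorem IsGood.tauContinuousBelow {K : ℝ} {W : Set X} (h : L.IsGood K W) :
    L.TauContinuousBelow K W := by
  have e : (W ×ˢ W) ∩ {p : X × X | L.tau p.1 p.2 < diamBound K} = W ×ˢ W :=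
    inter_eq_left.2 fun p hp => (h.small _ hp.1 _ hp.2).trans (ofReal_smallRadius_lt K)
  unfold TauContinuousBelow
  rw [e]
  exact ⟨h.cont, h.isOpen.prod h.isOpen⟩

/-- Causally convex open sets form a basis of a strongly causal space. -/
theorem StronglyCausal.exists_convex (hsc : L.StronglyCausal) {p : X} {V : Set X} (hV : IsOpen V)
    (hp : p ∈ V) : ∃ W ⊆ V, p ∈ W ∧ IsOpen W ∧
      ∀ x ∈ W, ∀ y ∈ W, ∀ z, L.causal x z → L.causal z y → z ∈ W := by
  have hb := TopologicalSpace.isTopologicalBasis_of_subbasis (α := X)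
    (s := {s : Set X | ∃ x y, s = L.diamond x y}) hsc.symm
  obtain ⟨W, hW, hpW, hWV⟩ := hb.exists_subset_of_mem_open hp hV
  refine ⟨W, hWV, hpW, hb.isOpen hW, ?_⟩
  obtain ⟨F, ⟨-, hF⟩, rfl⟩ := hW
  intro x hx y hy z hxz hzy s hs
  obtain ⟨a, b, rfl⟩ := hF hs
  exact ⟨chron_of_chron_of_causal (hx _ hs).1 hxz, chron_of_causal_of_chron hzy (hy _ hs).2⟩

/-- Since p ≪ p fails, τ(p, p) = 0. By continuity τ stays below the bound on a product neighbourhood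
of (p, p), which is then shrunk to a causally convex one. -/
theorem StronglyCausal.exists_isGood (hsc : L.StronglyCausal) {K : ℝ} {p : X} {U : Set X}
    (hp : ¬ L.chron p p) (hpU : p ∈ U) (h : L.TauContinuousBelow K U) :
    ∃ W ⊆ U, p ∈ W ∧ L.IsGood K W := by
  have h0 : L.tau p p = 0 := tau_self_of_not_chron hp
  have hr := ENNReal.ofReal_pos.2 (smallRadius_pos K)
  have hmem : (p, p) ∈ (U ×ˢ U) ∩ {q : X × X | L.tau q.1 q.2 < diamBound K} :=
    ⟨⟨hpU, hpU⟩, by simp only [mem_ofPred_eq, h0]; exact hr.trans (ofReal_smallRadius_lt K)⟩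
  have hopen : IsOpen (((U ×ˢ U) ∩ {q : X × X | L.tau q.1 q.2 < diamBound K}) ∩
      (fun q : X × X => L.tau q.1 q.2) ⁻¹' Iio (ENNReal.ofReal (smallRadius K))) :=
    h.1.isOpen_inter_preimage h.2 isOpen_Iio
  obtain ⟨V₁, V₂, hV₁, hV₂, hp₁, hp₂, hV⟩ := isOpen_prod_iff.1 hopen p p
    ⟨hmem, by simp only [mem_preimage, h0]; exact hr⟩
  obtain ⟨W, hWV, hpW, hWo, hWc⟩ := hsc.exists_convex (hV₁.inter hV₂) ⟨hp₁, hp₂⟩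
  have sub : W ×ˢ W ⊆ (((U ×ˢ U) ∩ {q : X × X | L.tau q.1 q.2 < diamBound K}) ∩
      (fun q : X × X => L.tau q.1 q.2) ⁻¹' Iio (ENNReal.ofReal (smallRadius K))) :=
    fun q hq => hV ⟨(hWV hq.1).1, (hWV hq.2).2⟩
  refine ⟨W, fun x hx => (sub (mk_mem_prod hx hx)).1.1.1, hpW, hWo, hWc, fun x hx y hy => ?_, ?_⟩
  · exact (sub (mk_mem_prod hx hy)).2
  · exact h.1.mono fun q hq => (sub hq).1

theorem IsGood.inter {K : ℝ} {W : Set X} (hsc : L.StronglyCausal) (h : L.IsGood K W) {p : X}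
    {V : Set X} (hpW : p ∈ W) (hV : IsOpen V) (hp : p ∈ V) :
    ∃ W' ⊆ W, W' ⊆ V ∧ p ∈ W' ∧ L.IsGood K W' := by
  obtain ⟨W', h1, h2, h3, h4⟩ := hsc.exists_convex (h.isOpen.inter hV) ⟨hpW, hp⟩
  exact ⟨W', fun x hx => (h1 hx).1, fun x hx => (h1 hx).2, h2, h3, h4,
    fun x hx y hy => h.small x (h1 hx).1 y (h1 hy).1,
    h.cont.mono (prod_mono (fun x hx => (h1 hx).1) fun x hx => (h1 hx).1)⟩

end LorentzianPreLengthSpace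

namespace LorentzianPreLengthSpace

open Comparison

variable {X : Type*} [MetricSpace X] {L : LorentzianPreLengthSpace X}

/-! ### From triangle comparison to the four-point condition -/

variable {K : ℝ} {W : Set X}

namespace IsGood

theorem ne_top (h : L.IsGood K W) {x y : X} (hx : x ∈ W) (hy : y ∈ W) : L.tau x y ≠ ⊤ :=
  (h.small x hx y hy).ne_top

theorem ofReal_toReal (h : L.IsGood K W) {x y : X} (hx : x ∈ W) (hy : y ∈ W) :
    ENNReal.ofReal (L.tau x y).toReal = L.tau x y :=
  ENNReal.ofReal_toReal (h.ne_top hx hy)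

theorem toReal_lt (h : L.IsGood K W) {x y : X} (hx : x ∈ W) (hy : y ∈ W) :
    (L.tau x y).toReal < smallRadius K := by
  have := h.small x hx y hy
  rw [← h.ofReal_toReal hx hy, ENNReal.ofReal_lt_ofReal_iff (smallRadius_pos K)] at this
  exact this

theorem sqrt_mul_lt (h : L.IsGood K W) {x y : X} (hx : x ∈ W) (hy : y ∈ W) (hK : K < 0) :
    √(-K) * (L.tau x y).toReal < Real.pi / 4 :=
  sqrt_mul_lt_of_lt_smallRadius (h.toReal_lt hx hy) hK

theorem sqrt_mul_lt_half (h : L.IsGood K W) {x y : X} (hx : x ∈ W) (hy : y ∈ W) (hK : K < 0) :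
    √(-K) * (L.tau x y).toReal < Real.pi / 2 := by
  linarith [h.sqrt_mul_lt hx hy hK, Real.pi_pos]

theorem sqrt_mul_lt_pi (h : L.IsGood K W) {x y : X} (hx : x ∈ W) (hy : y ∈ W) (hK : K < 0) :
    √(-K) * (L.tau x y).toReal < Real.pi := by
  linarith [h.sqrt_mul_lt hx hy hK, Real.pi_pos]

theorem lt_diamBound (h : L.IsGood K W) {x y : X} (hx : x ∈ W) (hy : y ∈ W) :
    L.tau x y < diamBound K :=
  (h.small x hx y hy).trans (ofReal_smallRadius_lt K)

theorem toReal_pos_iff (h : L.IsGood K W) {x y : X} (hx : x ∈ W) (hy : y ∈ W) :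
    0 < (L.tau x y).toReal ↔ L.chron x y := by
  rw [← L.tau_pos_iff, ENNReal.toReal_pos_iff]
  exact ⟨fun h => h.1, fun h' => ⟨h', (h.ne_top hx hy).lt_top⟩⟩

theorem toReal_add_le_of_causal (h : L.IsGood K W) {x y z : X} (hx : x ∈ W) (hy : y ∈ W)
    (hz : z ∈ W) (h1 : L.causal x y) (h2 : L.causal y z) :
    (L.tau x y).toReal + (L.tau y z).toReal ≤ (L.tau x z).toReal := by
  rw [← ENNReal.toReal_add (h.ne_top hx hy) (h.ne_top hy hz)]
  exact ENNReal.toReal_mono (h.ne_top hx hz) (L.tau_triangle x y z h1 h2)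

theorem toReal_add_le (h : L.IsGood K W) {x y z : X} (hx : x ∈ W) (hy : y ∈ W) (hz : z ∈ W)
    (h1 : L.chron x y) (h2 : L.chron y z) :
    (L.tau x y).toReal + (L.tau y z).toReal ≤ (L.tau x z).toReal :=
  h.toReal_add_le_of_causal hx hy hz (L.chron_causal _ _ h1) (L.chron_causal _ _ h2)

theorem not_chron_self (h : L.IsGood K W) {x : X} (hx : x ∈ W) : ¬ L.chron x x := fun hc =>
  h.ne_top hx hx (tau_self_eq_top hc)

theorem tau_eq_zero_of_chron (h : L.IsGood K W) {x y : X} (hx : x ∈ W)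
    (hc : L.chron x y) : L.tau y x = 0 := by
  by_contra h0
  have h1 : L.chron y x := (L.tau_pos_iff y x).1 (pos_iff_ne_zero.2 h0)
  exact h.not_chron_self hx (L.chron_trans _ _ _ hc h1)

theorem continuousOn_toReal (h : L.IsGood K W) :
    ContinuousOn (fun p : X × X => (L.tau p.1 p.2).toReal) (W ×ˢ W) := fun p hp =>
  (ENNReal.tendsto_toReal (h.ne_top hp.1 hp.2)).comp (h.cont p hp)

/-- One-sided triangle comparison in terms of the generalised trigonometric functions. -/
theorem compare (h : L.IsGood K W) (hT : L.IsTriangleNeighbourhood K W) {γ : ℝ → X} {a b c : X}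
    (hγ : L.IsDistanceRealizer γ a b) (hγW : ∀ s ∈ Icc (0 : ℝ) 1, γ s ∈ W) (hc : c ∈ W) {s : ℝ}
    (hs : 0 < s) (hs1 : s < 1) (ham : L.chron a (γ s)) (hmb : L.chron (γ s) b)
    (hrel : L.chron b c ∨ L.chron c a ∨
      (L.chron a c ∧ L.chron c b ∧ (L.chron (γ s) c ∨ L.chron c (γ s)))) :
    sn K (L.tau (γ s) b).toReal * hingeProd K (L.tau a (γ s)).toReal
        ((L.tau (γ s) c).toReal + (L.tau c (γ s)).toReal)
        ((L.tau a c).toReal + (L.tau c a).toReal) +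
      sn K (L.tau a (γ s)).toReal * hingeProd K (L.tau (γ s) b).toReal
        ((L.tau (γ s) c).toReal + (L.tau c (γ s)).toReal)
        ((L.tau b c).toReal + (L.tau c b).toReal) ≤ 0 := by
  have hs' : s ∈ Icc (0 : ℝ) 1 := ⟨hs.le, hs1.le⟩
  have ha : a ∈ W := hγ.2.1 ▸ hγW 0 ⟨le_rfl, zero_le_one⟩
  have hb : b ∈ W := hγ.2.2.1 ▸ hγW 1 ⟨zero_le_one, le_rfl⟩
  have hm := hγW s hs'
  have hab := L.chron_trans _ _ _ ham hmb
  have hadd : (L.tau a b).toReal = (L.tau a (γ s)).toReal + (L.tau (γ s) b).toReal := by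
    have := hγ.tau_add (h.ne_top ha hb) le_rfl hs hs1 le_rfl
    rw [hγ.2.1, hγ.2.2.1] at this
    rw [← this, ENNReal.toReal_add (h.ne_top ha hm) (h.ne_top hm hb)]
  have hmc : L.chron (γ s) c ∨ L.chron c (γ s) := by
    rcases hrel with h1 | h1 | h1
    · exact Or.inl (L.chron_trans _ _ _ hmb h1)
    · exact Or.inr (L.chron_trans _ _ _ h1 ham)
    · exact h1.2.2
  have hup := (h.toReal_pos_iff ha hm).2 ham
  have hvp := (h.toReal_pos_iff hm hb).2 hmb
  have hℓK : K < 0 → √(-K) * ((L.tau a (γ s)).toReal + (L.tau (γ s) b).toReal) < Real.pi / 2 := by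
    rw [← hadd]; exact h.sqrt_mul_lt_half ha hb
  -- Only one of τ(m, c), τ(c, m) is nonzero; it is the X to be inserted, and triangle comparison
  -- bounds it by the model separation.
  have fin : ∀ (m' c' : ModelPlane) (Y Z : ℝ), L.tau c (γ s) ≤ ModelPlane.tau K c' m' →
      L.tau (γ s) c ≤ ModelPlane.tau K m' c' →
      (∀ X, 0 < X → (ENNReal.ofReal X ≤ ModelPlane.tau K m' c' ∨
        ENNReal.ofReal X ≤ ModelPlane.tau K c' m') →
        sn K (L.tau (γ s) b).toReal * hingeProd K (L.tau a (γ s)).toReal X Y +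
          sn K (L.tau a (γ s)).toReal * hingeProd K (L.tau (γ s) b).toReal X Z ≤ 0) →
      sn K (L.tau (γ s) b).toReal * hingeProd K (L.tau a (γ s)).toReal
        ((L.tau (γ s) c).toReal + (L.tau c (γ s)).toReal) Y +
      sn K (L.tau a (γ s)).toReal * hingeProd K (L.tau (γ s) b).toReal
        ((L.tau (γ s) c).toReal + (L.tau c (γ s)).toReal) Z ≤ 0 := by
    intro m' c' Y Z h1 h2 H
    rcases hmc with hr | hr
    · rw [h.tau_eq_zero_of_chron hm hr, ENNReal.toReal_zero, add_zero]
      exact H _ ((h.toReal_pos_iff hm hc).2 hr) (Or.inl (by rwa [h.ofReal_toReal hm hc]))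
    · rw [h.tau_eq_zero_of_chron hc hr, ENNReal.toReal_zero, zero_add]
      exact H _ ((h.toReal_pos_iff hc hm).2 hr) (Or.inr (by rwa [h.ofReal_toReal hc hm]))
  rcases hrel with h1 | h1 | ⟨h1, h2, -⟩
  · have hac := L.chron_trans _ _ _ hab h1
    obtain ⟨a', m', b', c', k1, k2, k3, k4, k5, -, k6, -, k7⟩ :=
      ModelPlane.exists_triangle_config hup hvp ((h.toReal_pos_iff ha hc).2 hac)
      ((h.toReal_pos_iff hb hc).2 h1) hℓK (h.sqrt_mul_lt_half ha hc) (h.sqrt_mul_lt_half hb hc)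
      (Or.inr (Or.inl (hadd ▸ h.toReal_add_le ha hb hc hab h1)))
    obtain ⟨k8, k9⟩ := k6 (hadd ▸ h.toReal_add_le ha hb hc hab h1)
    rw [← hadd] at k5
    rw [h.ofReal_toReal ha hm] at k3
    rw [h.ofReal_toReal hm hb] at k4
    rw [h.ofReal_toReal ha hb] at k5
    rw [h.ofReal_toReal ha hc] at k8
    rw [h.ofReal_toReal hb hc] at k9
    rw [h.tau_eq_zero_of_chron ha hac, h.tau_eq_zero_of_chron hb h1, ENNReal.toReal_zero, add_zero,
      add_zero]
    obtain ⟨t1, t2⟩ := hT.2.2 ![a, b, c] ![a', b', c']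
      ⟨by intro i; fin_cases i <;> assumption, hab, h1, h.lt_diamBound ha hc⟩
      (by intro i j hij; fin_cases i <;> fin_cases j <;> first | assumption | simp at hij)
      0 1 2 (by decide) (by decide) (by decide) γ hγ hγW s hs' m' ⟨k1.causal, k2.causal, k3, k4⟩
    exact fin m' c' _ _ t1 t2 k7
  · have hcb := L.chron_trans _ _ _ h1 hab
    have hle : (L.tau a (γ s)).toReal + (L.tau (γ s) b).toReal + (L.tau c a).toReal ≤
        (L.tau c b).toReal := by linarith [h.toReal_add_le hc ha hb h1 hab]
    obtain ⟨a', m', b', c', k1, k2, k3, k4, k5, -, -, k6, k7⟩ :=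
      ModelPlane.exists_triangle_config hup hvp ((h.toReal_pos_iff hc ha).2 h1)
      ((h.toReal_pos_iff hc hb).2 hcb) hℓK (h.sqrt_mul_lt_half hc ha) (h.sqrt_mul_lt_half hc hb)
      (Or.inr (Or.inr hle))
    obtain ⟨k8, k9⟩ := k6 hle
    rw [← hadd] at k5
    rw [h.ofReal_toReal ha hm] at k3
    rw [h.ofReal_toReal hm hb] at k4
    rw [h.ofReal_toReal ha hb] at k5
    rw [h.ofReal_toReal hc ha] at k8
    rw [h.ofReal_toReal hc hb] at k9
    rw [h.tau_eq_zero_of_chron hc h1, h.tau_eq_zero_of_chron hc hcb, ENNReal.toReal_zero, zero_add,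
      zero_add]
    obtain ⟨t1, t2⟩ := hT.2.2 ![c, a, b] ![c', a', b']
      ⟨by intro i; fin_cases i <;> assumption, h1, hab, h.lt_diamBound hc hb⟩
      (by intro i j hij; fin_cases i <;> fin_cases j <;> first | assumption | simp at hij)
      1 2 0 (by decide) (by decide) (by decide) γ hγ hγW s hs' m' ⟨k1.causal, k2.causal, k3, k4⟩
    exact fin m' c' _ _ t1 t2 k7
  · have hle : (L.tau a c).toReal + (L.tau c b).toReal ≤
        (L.tau a (γ s)).toReal + (L.tau (γ s) b).toReal := by
      linarith [h.toReal_add_le ha hc hb h1 h2]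
    obtain ⟨a', m', b', c', k1, k2, k3, k4, k5, k6, -, -, k7⟩ :=
      ModelPlane.exists_triangle_config hup hvp ((h.toReal_pos_iff ha hc).2 h1)
      ((h.toReal_pos_iff hc hb).2 h2) hℓK (h.sqrt_mul_lt_half ha hc) (h.sqrt_mul_lt_half hc hb)
      (Or.inl hle)
    obtain ⟨k8, k9⟩ := k6 hle
    rw [← hadd] at k5
    rw [h.ofReal_toReal ha hm] at k3
    rw [h.ofReal_toReal hm hb] at k4
    rw [h.ofReal_toReal ha hb] at k5
    rw [h.ofReal_toReal ha hc] at k8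
    rw [h.ofReal_toReal hc hb] at k9
    rw [h.tau_eq_zero_of_chron ha h1, h.tau_eq_zero_of_chron hc h2, ENNReal.toReal_zero, add_zero,
      zero_add]
    obtain ⟨t1, t2⟩ := hT.2.2 ![a, c, b] ![a', c', b']
      ⟨by intro i; fin_cases i <;> assumption, h1, h2, h.lt_diamBound ha hb⟩
      (by intro i j hij; fin_cases i <;> fin_cases j <;> first | assumption | simp at hij)
      0 2 1 (by decide) (by decide) (by decide) γ hγ hγW s hs' m' ⟨k1.causal, k2.causal, k3, k4⟩
    exact fin m' c' _ _ t1 t2 k7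

/-- A good neighbourhood with triangle comparison as a comparison space. -/
def comparisonSpace (h : L.IsGood K W) (hreg : L.Regular) (hT : L.IsTriangleNeighbourhood K W) :
    ComparisonSpace K W where
  τ x y := (L.tau x y).toReal
  nonneg _ _ := ENNReal.toReal_nonneg
  small x y := h.sqrt_mul_lt x.2 y.2
  tri x y z h1 h2 := h.toReal_add_le x.2 y.2 z.2 ((h.toReal_pos_iff x.2 y.2).1 h1)
    ((h.toReal_pos_iff y.2 z.2).1 h2)
  seg γ := L.IsDistanceRealizer (fun s => (γ s : X)) (γ 0) (γ 1) ∧ L.chron (γ 0) (γ 1)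
  seg_exists x y hxy := by
    have hc := (h.toReal_pos_iff x.2 y.2).1 hxy
    obtain ⟨γ, hγ, hγW⟩ := hT.2.1 x x.2 y y.2 hc (h.lt_diamBound x.2 y.2)
    have e : ∀ s (hs : s ∈ Icc (0 : ℝ) 1), (projIcc (0 : ℝ) 1 zero_le_one s : ℝ) = s :=
      fun s hs => by rw [projIcc_of_mem zero_le_one hs]
    have e0 : γ (projIcc (0 : ℝ) 1 zero_le_one 0) = x := by
      rw [e 0 ⟨le_rfl, zero_le_one⟩]; exact hγ.2.1
    have e1 : γ (projIcc (0 : ℝ) 1 zero_le_one 1) = y := by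
      rw [e 1 ⟨zero_le_one, le_rfl⟩]; exact hγ.2.2.1
    -- Segments are maps from all of ℝ into W, so the realizer is extended by its endpoint values
    -- outside [0, 1].
    refine ⟨fun s => ⟨γ (projIcc (0 : ℝ) 1 zero_le_one s), hγW _ (Subtype.coe_prop _)⟩,
      ⟨?_, ?_⟩, Subtype.ext e0, Subtype.ext e1⟩
    · simp only [e0, e1]
      exact hγ.congr fun s hs => by simp only [e s hs]
    · simp only [e0, e1]
      exact hc
  seg_pos γ hγ s t hs hst ht := (h.toReal_pos_iff (γ s).2 (γ t).2).2
    (hreg _ _ _ hγ.2 hγ.1 s ⟨hs, hst.le.trans ht⟩ t ⟨hs.trans hst.le, ht⟩ hst)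
  seg_add γ hγ r s t hr hrs hst ht := by
    rw [← ENNReal.toReal_add (h.ne_top (γ r).2 (γ s).2) (h.ne_top (γ s).2 (γ t).2),
      hγ.1.tau_add (h.ne_top (γ 0).2 (γ 1).2) hr hrs hst ht]
  seg_cont_left γ hγ w := by
    obtain ⟨C, hC⟩ := hγ.1.1.1
    exact h.continuousOn_toReal.comp (f := fun s => ((γ s : X), (w : X)))
      (hC.continuousOn.prodMk continuousOn_const) fun s _ => ⟨(γ s).2, w.2⟩
  seg_cont_right γ hγ w := by
    obtain ⟨C, hC⟩ := hγ.1.1.1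
    exact h.continuousOn_toReal.comp (f := fun s => ((w : X), (γ s : X)))
      (continuousOn_const.prodMk hC.continuousOn) fun s _ => ⟨w.2, (γ s).2⟩
  compare γ hγ r s t hr hrs hst ht c hc := by
    have hsub := hγ.1.subsegment (h.ne_top (γ 0).2 (γ 1).2) hr (hrs.trans hst) ht
    have hrt : 0 < t - r := by linarith
    have hreg' := fun {s t : ℝ} (h1 : 0 ≤ s) (h2 : s < t) (h3 : t ≤ 1) =>
      hreg _ _ _ hγ.2 hγ.1 s ⟨h1, h2.le.trans h3⟩ t ⟨h1.trans h2.le, h3⟩ h2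
    -- Comparison is applied to the piece of γ between r and t, rescaled to [0, 1]; this is the
    -- parameter of γ s on it.
    have e : r + (t - r) * ((s - r) / (t - r)) = s := by
      rw [mul_div_cancel₀ _ hrt.ne']; ring
    have := h.compare hT hsub (fun u _ => (γ _).2) c.2 (s := (s - r) / (t - r))
      (div_pos (by linarith) hrt) ((div_lt_one hrt).2 (by linarith))
    simp only [e] at this
    refine this (hreg' hr hrs (hst.le.trans ht)) (hreg' (hr.trans hrs.le) hst ht) ?_
    simpa only [h.toReal_pos_iff (Subtype.coe_prop _) (Subtype.coe_prop _)] using hc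

/-! ### The four-point condition as an inequality -/

/-- The four-point inequality in a good neighbourhood, in both time orientations. -/
def FourPoint (_ : L.IsGood K W) : Prop :=
  (∀ p ∈ W, ∀ o ∈ W, ∀ q ∈ W, ∀ r ∈ W, L.chron p o → L.chron o q → L.causal q r →
    FourPointIneq K (L.tau p o).toReal (L.tau o q).toReal (L.tau o r).toReal (L.tau p q).toReal
      (L.tau p r).toReal (L.tau q r).toReal) ∧
  (∀ p ∈ W, ∀ o ∈ W, ∀ q ∈ W, ∀ r ∈ W, L.chron o p → L.chron q o → L.causal r q →
    FourPointIneq K (L.tau o p).toReal (L.tau q o).toReal (L.tau r o).toReal (L.tau q p).toReal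
      (L.tau r p).toReal (L.tau r q).toReal)

/-- The past half is the future half in the time-reversed comparison space. -/
theorem fourPoint_of_triangle (h : L.IsGood K W) (hreg : L.Regular)
    (hT : L.IsTriangleNeighbourhood K W) : h.FourPoint := by
  constructor
  · intro p hp o ho q hq r hr h1 h2 h3
    exact (h.comparisonSpace hreg hT).fourPoint (x₁ := ⟨p, hp⟩) (x₂ := ⟨o, ho⟩) (x₃ := ⟨q, hq⟩)
      (x₄ := ⟨r, hr⟩) ((h.toReal_pos_iff hp ho).2 h1) ((h.toReal_pos_iff ho hq).2 h2)
      fun y hy => (h.toReal_pos_iff y.2 hr).2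
        (chron_of_chron_of_causal ((h.toReal_pos_iff y.2 hq).1 hy) h3)
  · intro p hp o ho q hq r hr h1 h2 h3
    exact (h.comparisonSpace hreg hT).reverse.fourPoint (x₁ := ⟨p, hp⟩) (x₂ := ⟨o, ho⟩)
      (x₃ := ⟨q, hq⟩) (x₄ := ⟨r, hr⟩) ((h.toReal_pos_iff ho hp).2 h1)
      ((h.toReal_pos_iff hq ho).2 h2) fun y hy => (h.toReal_pos_iff hr y.2).2
        (chron_of_causal_of_chron h3 ((h.toReal_pos_iff hq y.2).1 hy))

/-- The distances in a comparison configuration with positive time separations. -/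
theorem of_tau_eq (h : L.IsGood K W) {x y : X} (hx : x ∈ W) (hy : y ∈ W) (hc : L.chron x y)
    {p q : ModelPlane} (ht : ModelPlane.tau K p q = L.tau x y) :
    ModelPlane.chron K p q ∧ ModelPlane.BeforeAntipode K p q ∧
      ModelPlane.modDist K p q = md K (L.tau x y).toReal := by
  rw [← h.ofReal_toReal hx hy] at ht
  exact ModelPlane.of_tau_eq ht ((h.toReal_pos_iff hx hy).2 hc) (h.sqrt_mul_lt_pi hx hy)

theorem isFourPointNeighbourhood (h : L.IsGood K W) (hF : h.FourPoint) :
    L.IsFourPointNeighbourhood K W := by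
  refine ⟨h.tauContinuousBelow, ?_, ?_⟩
  · intro x y hx h01 h12 h23 _ hy hs
    have h02 := L.chron_trans _ _ _ h01 h12
    have h13 := chron_of_chron_of_causal h12 h23
    have h03 := chron_of_chron_of_causal h02 h23
    obtain ⟨-, -, m01⟩ := h.of_tau_eq (hx 0) (hx 1) h01 (hy 0 1 (by decide) (by decide))
    obtain ⟨-, -, m02⟩ := h.of_tau_eq (hx 0) (hx 2) h02 (hy 0 2 (by decide) (by decide))
    obtain ⟨-, -, m03⟩ := h.of_tau_eq (hx 0) (hx 3) h03 (hy 0 3 (by decide) (by decide))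
    obtain ⟨c12, -, m12⟩ := h.of_tau_eq (hx 1) (hx 2) h12 (hy 1 2 (by decide) (by decide))
    obtain ⟨-, b13, m13⟩ := h.of_tau_eq (hx 1) (hx 3) h13 (hy 1 3 (by decide) (by decide))
    have hF' := hF.1 _ (hx 0) _ (hx 1) _ (hx 2) _ (hx 3) h01 h12 h23
    rw [ModelPlane.fourPointIneq_iff (sn_pos ((h.toReal_pos_iff (hx 0) (hx 1)).2 h01)
      (h.sqrt_mul_lt_pi (hx 0) (hx 1))) (by rw [ModelPlane.modDist_comm]; exact m01) m12 m13 m02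
      m03 hs] at hF'
    rw [← h.ofReal_toReal (hx 2) (hx 3)]
    refine ModelPlane.tau_le_of_modDist_le ENNReal.toReal_nonneg (fun _ => ?_) hF'
    exact b13.mono c12.causal (by rw [ModelPlane.causal_iff]; exact ⟨le_rfl, le_rfl⟩)
  · intro x y hx h01 h12 h23 _ hy hs
    have h13 := L.chron_trans _ _ _ h12 h23
    have h02 := chron_of_causal_of_chron h01 h12
    have h03 := chron_of_causal_of_chron h01 h13
    obtain ⟨-, -, m23⟩ := h.of_tau_eq (hx 2) (hx 3) h23 (hy 2 3 (by decide) (by decide))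
    obtain ⟨-, b02, m02⟩ := h.of_tau_eq (hx 0) (hx 2) h02 (hy 0 2 (by decide) (by decide))
    obtain ⟨-, -, m03⟩ := h.of_tau_eq (hx 0) (hx 3) h03 (hy 0 3 (by decide) (by decide))
    obtain ⟨c12, -, m12⟩ := h.of_tau_eq (hx 1) (hx 2) h12 (hy 1 2 (by decide) (by decide))
    obtain ⟨-, -, m13⟩ := h.of_tau_eq (hx 1) (hx 3) h13 (hy 1 3 (by decide) (by decide))
    have hF' := hF.2 _ (hx 3) _ (hx 2) _ (hx 1) _ (hx 0) h23 h12 h01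
    rw [ModelPlane.modDist_comm] at m02 m03 m12 m13
    rw [ModelPlane.fourPointIneq_iff (sn_pos ((h.toReal_pos_iff (hx 2) (hx 3)).2 h23)
      (h.sqrt_mul_lt_pi (hx 2) (hx 3))) m23 m12 m02 m13 m03
      (ModelPlane.oppositeSides_swap.1 (ModelPlane.oppositeSides_comm.1 hs)),
      ModelPlane.modDist_comm] at hF'
    rw [← h.ofReal_toReal (hx 0) (hx 1)]
    refine ModelPlane.tau_le_of_modDist_le ENNReal.toReal_nonneg (fun _ => ?_) hF'
    exact b02.mono (by rw [ModelPlane.causal_iff]; exact ⟨le_rfl, le_rfl⟩) c12.causal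

/-- The condition speaks about all given comparison configurations, so one has to be constructed in
order to extract the inequality. -/
theorem fourPoint_of_isFourPointNeighbourhood (h : L.IsGood K W)
    (hN : L.IsFourPointNeighbourhood K W) : h.FourPoint := by
  constructor
  · intro p hp o ho q hq r hr h1 h2 h3
    have hpq := L.chron_trans _ _ _ h1 h2
    have hor := chron_of_chron_of_causal h2 h3
    have hpr := chron_of_chron_of_causal hpq h3
    obtain ⟨p', o', q', r', k1, k2, k3, k4, k5, hs, H⟩ := ModelPlane.exists_fourPoint_config
      (K := K) ((h.toReal_pos_iff hp ho).2 h1) ((h.toReal_pos_iff ho hq).2 h2)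
      (y := (L.tau o r).toReal)
      (le_trans (le_add_of_nonneg_right ENNReal.toReal_nonneg)
        (h.toReal_add_le_of_causal ho hq hr (L.chron_causal _ _ h2) h3))
      (h.toReal_add_le hp ho hq h1 h2) (h.toReal_add_le hp ho hr h1 hor)
      (h.sqrt_mul_lt_half hp hq) (h.sqrt_mul_lt_half hp hr)
    refine H _ ENNReal.toReal_nonneg (h.sqrt_mul_lt_pi hq hr) ?_
    rw [h.ofReal_toReal hp ho] at k1
    rw [h.ofReal_toReal ho hq] at k2
    rw [h.ofReal_toReal ho hr] at k3
    rw [h.ofReal_toReal hp hq] at k4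
    rw [h.ofReal_toReal hp hr] at k5
    rw [h.ofReal_toReal hq hr]
    exact hN.2.1 ![p, o, q, r] ![p', o', q', r'] (by intro i; fin_cases i <;> assumption) h1 h2 h3
      (h.lt_diamBound hp hr)
      (by intro i j hij hne; fin_cases i <;> fin_cases j <;>
            first | assumption | exact absurd rfl hne | simp at hij) hs
  · intro p hp o ho q hq r hr h1 h2 h3
    have hqp := L.chron_trans _ _ _ h2 h1
    have hro := chron_of_causal_of_chron h3 h2
    have hrp := chron_of_causal_of_chron h3 hqp
    obtain ⟨p', o', q', r', k1, k2, k3, k4, k5, hs, H⟩ := ModelPlane.exists_fourPoint_config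
      (K := K) ((h.toReal_pos_iff ho hp).2 h1) ((h.toReal_pos_iff hq ho).2 h2)
      (y := (L.tau r o).toReal) (X := (L.tau q p).toReal) (Y := (L.tau r p).toReal)
      (le_trans (le_add_of_nonneg_left ENNReal.toReal_nonneg)
        (h.toReal_add_le_of_causal hr hq ho h3 (L.chron_causal _ _ h2)))
      (by linarith [h.toReal_add_le hq ho hp h2 h1]) (by linarith [h.toReal_add_le hr ho hp hro h1])
      (h.sqrt_mul_lt_half hq hp) (h.sqrt_mul_lt_half hr hp)
    refine H _ ENNReal.toReal_nonneg (h.sqrt_mul_lt_pi hr hq) ?_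
    -- The configuration was built future-directed; its time reflection realises the past version.
    rw [h.ofReal_toReal ho hp, ← ModelPlane.tau_timeReflect] at k1
    rw [h.ofReal_toReal hq ho, ← ModelPlane.tau_timeReflect] at k2
    rw [h.ofReal_toReal hr ho, ← ModelPlane.tau_timeReflect] at k3
    rw [h.ofReal_toReal hq hp, ← ModelPlane.tau_timeReflect] at k4
    rw [h.ofReal_toReal hr hp, ← ModelPlane.tau_timeReflect] at k5
    rw [h.ofReal_toReal hr hq, ← ModelPlane.tau_timeReflect]
    exact hN.2.2 ![r, q, o, p] ![r'.timeReflect, q'.timeReflect, o'.timeReflect, p'.timeReflect]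
      (by intro i; fin_cases i <;> assumption) h3 h2 h1 (h.lt_diamBound hr hp)
      (by intro i j hij hne; fin_cases i <;> fin_cases j <;>
            first | assumption | exact absurd rfl hne | simp at hij)
      (ModelPlane.oppositeSides_timeReflect.2
        (ModelPlane.oppositeSides_swap.2 (ModelPlane.oppositeSides_comm.2 hs)))

end IsGood

end LorentzianPreLengthSpace

namespace LorentzianPreLengthSpace

open Comparison

variable {X : Type*} [MetricSpace X] {L : LorentzianPreLengthSpace X} {K : ℝ} {U W : Set X}

/-! ### Restriction to small neighbourhoods -/

/-- Causal curves between points of a good neighbourhood stay in it. -/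
theorem IsGood.mem_of_isDistanceRealizer (h : L.IsGood K W) {γ : ℝ → X} {x y : X} (hx : x ∈ W)
    (hy : y ∈ W) (hγ : L.IsDistanceRealizer γ x y) {s : ℝ} (hs : s ∈ Icc (0 : ℝ) 1) : γ s ∈ W := by
  obtain ⟨hc, rfl, rfl, -⟩ := hγ
  exact h.convex _ hx _ hy _ (hc.causal_of_le le_rfl hs.1 hs.2) (hc.causal_of_le hs.1 hs.2 le_rfl)

theorem IsTimelikeTriangle.mono {x : Fin 3 → X} (hWU : W ⊆ U) (hx : L.IsTimelikeTriangle K W x) :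
    L.IsTimelikeTriangle K U x :=
  ⟨fun i => hWU (hx.1 i), hx.2⟩

theorem IsTimelikeTriangle.chron {x : Fin 3 → X} (hx : L.IsTimelikeTriangle K U x) {i j : Fin 3}
    (hij : i < j) : L.chron (x i) (x j) := by
  have h02 := L.chron_trans _ _ _ hx.2.1 hx.2.2.1
  fin_cases i <;> fin_cases j <;> first | exact absurd hij (by decide) | skip
  exacts [hx.2.1, h02, hx.2.2.1]

theorem IsTriangleNeighbourhood.restrict (hU : L.IsTriangleNeighbourhood K U) (h : L.IsGood K W)
    (hWU : W ⊆ U) : L.IsTriangleNeighbourhood K W := by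
  refine ⟨h.tauContinuousBelow, fun x hx y hy hc ht => ?_,
    fun x y hx hy i j k hij hki hkj γ hγ hγW => ?_⟩
  · obtain ⟨γ, hγ, -⟩ := hU.2.1 x (hWU hx) y (hWU hy) hc ht
    exact ⟨γ, hγ, fun s hs => h.mem_of_isDistanceRealizer hx hy hγ hs⟩
  · exact hU.2.2 x y (hx.mono hWU) hy i j k hij hki hkj γ hγ fun s hs => hWU (hγW s hs)

theorem IsFourPointNeighbourhood.restrict (hU : L.IsFourPointNeighbourhood K U) (h : L.IsGood K W)
    (hWU : W ⊆ U) : L.IsFourPointNeighbourhood K W :=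
  ⟨h.tauContinuousBelow, fun x y hx => hU.2.1 x y fun i => hWU (hx i),
    fun x y hx => hU.2.2 x y fun i => hWU (hx i)⟩

/-- At p ≪ p the separation is ∞, so the size bound fails for all pairs in {p} and the neighbourhood
conditions become vacuous. -/
theorem not_tau_lt_diamBound_of_mem_singleton {p x y : X} (hp : L.chron p p)
    (hx : x ∈ ({p} : Set X)) (hy : y ∈ ({p} : Set X)) : ¬ L.tau x y < diamBound K := by
  rw [mem_singleton_iff.1 hx, mem_singleton_iff.1 hy, tau_self_eq_top hp]
  exact not_top_lt

theorem tauContinuousBelow_singleton {p : X} (hp : L.chron p p) :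
    L.TauContinuousBelow K {p} := by
  have e : (({p} : Set X) ×ˢ {p}) ∩ {q : X × X | L.tau q.1 q.2 < diamBound K} = ∅ :=
    eq_empty_of_forall_notMem fun q hq =>
      not_tau_lt_diamBound_of_mem_singleton hp hq.1.1 hq.1.2 hq.2
  unfold TauContinuousBelow
  rw [e]
  exact ⟨continuousOn_empty _, isOpen_empty⟩

theorem isTriangleNeighbourhood_singleton {p : X} (hp : L.chron p p) :
    L.IsTriangleNeighbourhood K {p} :=
  ⟨tauContinuousBelow_singleton hp,
    fun _ hx _ hy _ ht => (not_tau_lt_diamBound_of_mem_singleton hp hx hy ht).elim,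
    fun _ _ hx => (not_tau_lt_diamBound_of_mem_singleton hp (hx.1 0) (hx.1 2) hx.2.2.2).elim⟩

theorem isFourPointNeighbourhood_singleton {p : X} (hp : L.chron p p) :
    L.IsFourPointNeighbourhood K {p} :=
  ⟨tauContinuousBelow_singleton hp,
    fun _ _ hx _ _ _ ht => (not_tau_lt_diamBound_of_mem_singleton hp (hx 0) (hx 3) ht).elim,
    fun _ _ hx _ _ _ ht => (not_tau_lt_diamBound_of_mem_singleton hp (hx 0) (hx 3) ht).elim⟩

theorem isEpsMuNeighbourhood_singleton {p : X} (hp : L.chron p p) :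
    L.IsEpsMuNeighbourhood K {p} :=
  ⟨tauContinuousBelow_singleton hp,
    fun _ hx => (not_tau_lt_diamBound_of_mem_singleton hp (hx.1 0) (hx.1 2) hx.2.2.2).elim⟩

theorem TriangleCurvatureBoundedBelow.fourPoint (hsc : L.StronglyCausal) (hreg : L.Regular)
    (h : L.TriangleCurvatureBoundedBelow K) : L.FourPointCurvatureBoundedBelow K := by
  intro p
  by_cases hp : L.chron p p
  · exact ⟨{p}, hsc.isOpen_singleton hp, rfl, isFourPointNeighbourhood_singleton hp⟩
  obtain ⟨U, -, hpU, hU⟩ := h p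
  obtain ⟨W, hWU, hpW, hW⟩ := hsc.exists_isGood hp hpU hU.1
  exact ⟨W, hW.isOpen, hpW, hW.isFourPointNeighbourhood
    (hW.fourPoint_of_triangle hreg (hU.restrict hW hWU))⟩

theorem TriangleCurvatureBoundedBelow.locallyTimelikeGeodesic (hsc : L.StronglyCausal)
    (h : L.TriangleCurvatureBoundedBelow K) : L.LocallyTimelikeGeodesic := by
  intro p
  by_cases hp : L.chron p p
  · exact ⟨{p}, hsc.isOpen_singleton hp, rfl, fun x hx y hy hne => (hne (hx.trans hy.symm)).elim⟩
  obtain ⟨U, -, hpU, hU⟩ := h p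
  obtain ⟨W, hWU, hpW, hW⟩ := hsc.exists_isGood hp hpU hU.1
  refine ⟨W, hW.isOpen, hpW, fun x hx y hy _ hc => ?_⟩
  obtain ⟨γ, hγ, -⟩ := hU.2.1 x (hWU hx) y (hWU hy) hc (hW.lt_diamBound hx hy)
  exact ⟨γ, hγ⟩

end LorentzianPreLengthSpace

/-! ### From the four-point condition to almost-midpoints -/

namespace Comparison

theorem FourPointIneq.symm {K e x y X Y z : ℝ} (h : FourPointIneq K e x y X Y z) :
    FourPointIneq K e y x Y X z := by
  unfold FourPointIneq at *
  rw [hingeProd_comm K y x, mul_comm (hingeProd K e y Y), mul_comm (√(hingeProd K e y Y ^ 2 - _))]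
  exact h

/-- The four-point inequality for points `p, o, q` on a line. -/
theorem FourPointIneq.chord_le {K s t X Y Z : ℝ} (hs : 0 < sn K s)
    (h : FourPointIneq K s t X (s + t) Y Z) :
    sn K t * hingeProd K s X Y + sn K s * hingeProd K t X Z ≤ 0 := by
  -- The hinge at o towards p and q is degenerate, so the first square root vanishes.
  have e : hingeProd K s t (s + t) = -(sn K s * sn K t) := by rw [hingeProd_eq_add]; ring
  have e2 : (-(sn K s * sn K t)) ^ 2 - sn K s ^ 2 * sn K t ^ 2 = 0 := by ring
  unfold FourPointIneq at h
  rw [e, e2, Real.sqrt_zero, zero_mul, add_zero] at h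
  have : sn K s * (sn K t * hingeProd K s X Y + sn K s * hingeProd K t X Z) ≤ sn K s * 0 := by
    linarith
  exact le_of_mul_le_mul_left this hs

/-- For points close to the segment from `p` to `q`, the four-point inequality almost implies the
comparison inequality of a point of the segment. -/
theorem exists_forall_chord_lt {K s t Y Z R η : ℝ} (hs : 0 < s) (ht : 0 < t)
    (hK : K < 0 → √(-K) * (s + t) < Real.pi) (hR : K < 0 → √(-K) * R ≤ Real.pi) (hη : 0 < η) :
    ∃ δ > 0, ∀ S T X, |S - s| < δ → |T - t| < δ → η ≤ X → X ≤ R →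
      FourPointIneq K S T X (s + t) Y Z →
      sn K t * hingeProd K s (X - η) Y + sn K s * hingeProd K t (X - η) Z < 0 := by
  -- Compactness: counterexamples with S → s, T → t have a subsequence with X → x in [η, R]. In the
  -- limit the chord expression is ≤ 0 at x but ≥ 0 at x - η, contradicting its strict growth with
  -- `md`.
  by_contra! hcon
  have hpos : ∀ n : ℕ, (0 : ℝ) < 1 / (n + 1) := fun n => by positivity
  choose S T X h1 h2 h3 h4 h5 h6 using fun n : ℕ => hcon _ (hpos n)
  have lim : ∀ {F : ℕ → ℝ} {f : ℝ}, (∀ n : ℕ, |F n - f| < 1 / (n + 1)) →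
      Tendsto F atTop (𝓝 f) := fun {F f} hF =>
    tendsto_iff_dist_tendsto_zero.2 (squeeze_zero (fun n => dist_nonneg)
      (fun n => by rw [Real.dist_eq]; exact (hF n).le) tendsto_one_div_add_atTop_nhds_zero_nat)
  obtain ⟨x, hx, φ, hφ, hlim⟩ := isCompact_Icc.tendsto_subseq (fun n => (⟨h3 n, h4 n⟩ : X n ∈ Icc η R))
  have hsub := hφ.tendsto_atTop
  have hF := FourPointIneq.of_tendsto ((lim h1).comp hsub) ((lim h2).comp hsub) hlim
    tendsto_const_nhds tendsto_const_nhds tendsto_const_nhds (Eventually.of_forall fun n => h5 (φ n))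
  have hsK : K < 0 → √(-K) * s < Real.pi := fun h =>
    (mul_le_mul_of_nonneg_left (by linarith) (Real.sqrt_nonneg _)).trans_lt (hK h)
  have hle := hF.chord_le (sn_pos hs hsK)
  have hge : 0 ≤ sn K t * hingeProd K s (x - η) Y + sn K s * hingeProd K t (x - η) Z := by
    have hc : Continuous fun u : ℝ => sn K t * hingeProd K s (u - η) Y +
        sn K s * hingeProd K t (u - η) Z := by
      have := (continuous_md K).comp (continuous_id.sub (continuous_const (y := η)))
      unfold hingeProd
      simp only [Function.comp_def] at this
      fun_prop
    exact ge_of_tendsto ((hc.tendsto x).comp hlim) (Eventually.of_forall fun n => h6 (φ n))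
  have hlt : md K (x - η) < md K x := md_lt_md (by linarith [hx.1]) (by linarith) fun h =>
    (mul_le_mul_of_nonneg_left hx.2 (Real.sqrt_nonneg _)).trans (hR h)
  have := mul_pos (sn_pos (by linarith) hK) (sub_pos.2 hlt)
  rw [chord_identity] at hle hge
  linarith

end Comparison

/-! ### Points on a segment of the model plane -/

namespace ModelPlane

open Comparison

/-- The distance from `c` to a point `m` of the segment from `a` to `b`. -/
theorem hinge_add_hinge_eq_zero {K s t : ℝ} {a b c m : ModelPlane} (hs : 0 < sn K s)
    (ham : modDist K a m = md K s) (hmb : modDist K m b = md K t)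
    (hab : modDist K a b = md K (s + t)) :
    sn K t * hinge K m a c + sn K s * hinge K m b c = 0 := by
  obtain ⟨κ, hκ, hg⟩ := exists_gram K
  rw [modDist_comm] at ham
  have e1 : hinge K m a b = -(sn K s * sn K t) := by
    rw [hinge_eq ham hmb hab, hingeProd_eq_add]; ring
  have e2 : hinge K m b b = sn K t ^ 2 := by
    rw [hinge_eq (z := 0) hmb hmb (by rw [modDist_self, md_zero]), sn_sq, hingeProd, md_zero]; ring
  have g1 := hg m a b b
  have g2 := hg m a b c
  rw [ham, ← sn_sq, e1] at g1 g2
  rw [e2] at g1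
  have h0 : side K a m b * side K a m b = 0 := by
    have : κ * (side K a m b * side K a m b) = 0 := by linarith
    exact (mul_eq_zero.1 this).resolve_left hκ.ne'
  rw [mul_self_eq_zero.1 h0, zero_mul, mul_zero, sub_zero] at g2
  have : sn K s * (sn K t * hinge K m a c + sn K s * hinge K m b c) = 0 := by linarith
  exact (mul_eq_zero.1 this).resolve_left hs.ne'

/-- The chord expression vanishes at the actual modified distance of m and c and is nondecreasing in
`md K X`. -/
theorem chord_nonneg {K s t X Y Z : ℝ} {a b c m : ModelPlane} (hs : 0 < sn K s)
    (hst : 0 ≤ sn K (s + t)) (ham : modDist K a m = md K s) (hmb : modDist K m b = md K t)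
    (hab : modDist K a b = md K (s + t)) (hac : modDist K a c = md K Y)
    (hbc : modDist K b c = md K Z) (hmc : modDist K m c ≤ md K X) :
    0 ≤ sn K t * hingeProd K s X Y + sn K s * hingeProd K t X Z := by
  have h := hinge_add_hinge_eq_zero (c := c) hs ham hmb hab
  rw [modDist_comm] at ham
  unfold hinge at h
  rw [ham, hmb, hac, hbc] at h
  have := mul_nonneg hst (sub_nonneg.2 hmc)
  rw [sn_add] at this
  unfold hingeProd
  linarith

/-- Points of a chronological diamond that are not causally related have non-positive `modDist`. -/
theorem chron_or_chron_of_mem_diamond {K : ℝ} {a b p q : ModelPlane} (hab : BeforeAntipode K a b)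
    (hap : chron K a p) (hpb : chron K p b) (haq : chron K a q) (hqb : chron K q b)
    (h : 0 < modDist K p q) : chron K p q ∨ chron K q p := by
  have key : K ≠ 0 → |nullP K q - nullP K p| < 2 * Real.pi ∧
      |nullM K q - nullM K p| < 2 * Real.pi := by
    intro hK
    have := null_sub_lt_two_pi hK (chron_trans hap hpb) hab
    rw [chron_iff] at *
    constructor <;> rw [abs_lt] <;> constructor <;> linarith [this.1, this.2, hap.1, hap.2, hpb.1, hpb.2, haq.1, haq.2, hqb.1, hqb.2]
  exact chron_or_chron_of_modDist_pos (fun hK => (key hK).1) (fun hK => (key hK).2) h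

end ModelPlane

/-! ### Almost-midpoints in a good neighbourhood -/

namespace LorentzianPreLengthSpace

open Comparison

variable {X : Type*} [MetricSpace X] {L : LorentzianPreLengthSpace X} {K : ℝ} {W : Set X}

namespace IsGood

theorem abs_sub_lt_of_isEpsMuMidpoint (h : L.IsGood K W) {a b m : X} (ha : a ∈ W) (hb : b ∈ W)
    (hm : m ∈ W) {ε μ : ℝ} (hε : 0 < ε) (hμ : μ ∈ Ioo (0 : ℝ) 1)
    (hmid : L.IsEpsMuMidpoint ε μ a b m) :
    |(L.tau a m).toReal - μ * (L.tau a b).toReal| < ε ∧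
      |(L.tau m b).toReal - (1 - μ) * (L.tau a b).toReal| < ε := by
  obtain ⟨h1, h2, h3, h4⟩ := hmid
  have n : ∀ {x y : X}, 0 ≤ (L.tau x y).toReal := ENNReal.toReal_nonneg
  have hμ1 : 0 ≤ 1 - μ := by linarith [hμ.2]
  rw [← h.ofReal_toReal ha hb, ← h.ofReal_toReal ha hm] at h1 h2
  rw [← h.ofReal_toReal ha hb, ← h.ofReal_toReal hm hb] at h3 h4
  rw [← ENNReal.ofReal_mul hμ.1.le] at h1 h2
  rw [← ENNReal.ofReal_mul hμ1] at h3 h4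
  have p1 := mul_nonneg hμ.1.le (n (x := a) (y := b))
  have p2 := mul_nonneg hμ1 (n (x := a) (y := b))
  rw [← ENNReal.ofReal_add p1 hε.le, ENNReal.ofReal_lt_ofReal_iff (by linarith)] at h1
  rw [← ENNReal.ofReal_add n hε.le, ENNReal.ofReal_lt_ofReal_iff (by linarith [n (x := a) (y := m)])]
    at h2
  rw [← ENNReal.ofReal_add p2 hε.le, ENNReal.ofReal_lt_ofReal_iff (by linarith)] at h3
  rw [← ENNReal.ofReal_add n hε.le, ENNReal.ofReal_lt_ofReal_iff (by linarith [n (x := m) (y := b)])]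
    at h4
  rw [abs_lt, abs_lt]
  exact ⟨⟨by linarith, by linarith⟩, by linarith, by linarith⟩

theorem eventually_chron_of_isEpsMuMidpoint (h : L.IsGood K W) {a b : X} (ha : a ∈ W) (hb : b ∈ W)
    (hab : L.chron a b) {μ : ℝ} (hμ : μ ∈ Ioo (0 : ℝ) 1) :
    ∀ᶠ ε in 𝓝[>] (0 : ℝ), ∀ m ∈ W, L.IsEpsMuMidpoint ε μ a b m → L.chron a m ∧ L.chron m b := by
  have hℓ := (h.toReal_pos_iff ha hb).2 hab
  have h1 : 0 < μ * (L.tau a b).toReal := mul_pos hμ.1 hℓ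
  have h2 : 0 < (1 - μ) * (L.tau a b).toReal := mul_pos (by linarith [hμ.2]) hℓ
  filter_upwards [Ioo_mem_nhdsGT h1, Ioo_mem_nhdsGT h2] with ε he1 he2 m hm hmid
  obtain ⟨k1, k2⟩ := h.abs_sub_lt_of_isEpsMuMidpoint ha hb hm he1.1 hμ hmid
  rw [abs_lt] at k1 k2
  exact ⟨(h.toReal_pos_iff ha hm).1 (by linarith [he1.2]),
    (h.toReal_pos_iff hm hb).1 (by linarith [he2.2])⟩

/-- The estimate of `exists_forall_chord_lt`, uniform over all ε-μ-midpoints. Here d m stands for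
the separation of m from c, and Q for the causal relation under which a four-point inequality is
available. The two alternatives in `hF` are its future and past versions, which exchange the roles
of a and b. -/
theorem eventually_chord_lt (h : L.IsGood K W) {a b : X} (ha : a ∈ W) (hb : b ∈ W)
    (hab : L.chron a b) {μ Y Z η : ℝ} (hμ : μ ∈ Ioo (0 : ℝ) 1) (hη : 0 < η) {Q : X → Prop}
    {d : X → ℝ} (hd : ∀ m ∈ W, d m ≤ smallRadius K)
    (hF : ∀ m ∈ W, L.chron a m → L.chron m b → Q m →
      FourPointIneq K (L.tau a m).toReal (L.tau m b).toReal (d m) (L.tau a b).toReal Y Z ∨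
      FourPointIneq K (L.tau m b).toReal (L.tau a m).toReal (d m) (L.tau a b).toReal Z Y) :
    ∀ᶠ ε in 𝓝[>] (0 : ℝ), ∀ m ∈ W, L.IsEpsMuMidpoint ε μ a b m → Q m → η ≤ d m →
      sn K ((1 - μ) * (L.tau a b).toReal) * hingeProd K (μ * (L.tau a b).toReal) (d m - η) Y +
        sn K (μ * (L.tau a b).toReal) * hingeProd K ((1 - μ) * (L.tau a b).toReal) (d m - η) Z < 0 := by
  have hℓ := (h.toReal_pos_iff ha hb).2 hab
  have h1 : 0 < μ * (L.tau a b).toReal := mul_pos hμ.1 hℓ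
  have h2 : 0 < (1 - μ) * (L.tau a b).toReal := mul_pos (by linarith [hμ.2]) hℓ
  have e1 : μ * (L.tau a b).toReal + (1 - μ) * (L.tau a b).toReal = (L.tau a b).toReal := by ring
  have e2 : (1 - μ) * (L.tau a b).toReal + μ * (L.tau a b).toReal = (L.tau a b).toReal := by ring
  have hR : K < 0 → √(-K) * smallRadius K ≤ Real.pi := fun hK => by
    have : 0 < √(-K) := Real.sqrt_pos.2 (by linarith)
    rw [smallRadius, if_pos hK]
    field_simp
    linarith [Real.pi_pos]
  obtain ⟨δ₁, hδ₁, H1⟩ := exists_forall_chord_lt (Y := Y) (Z := Z) h1 h2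
    (by rw [e1]; exact h.sqrt_mul_lt_pi ha hb) hR hη
  obtain ⟨δ₂, hδ₂, H2⟩ := exists_forall_chord_lt (Y := Z) (Z := Y) h2 h1
    (by rw [e2]; exact h.sqrt_mul_lt_pi ha hb) hR hη
  filter_upwards [Ioo_mem_nhdsGT hδ₁, Ioo_mem_nhdsGT hδ₂,
    h.eventually_chron_of_isEpsMuMidpoint ha hb hab hμ] with ε he1 he2 hc m hm hmid hQ hle
  obtain ⟨k1, k2⟩ := h.abs_sub_lt_of_isEpsMuMidpoint ha hb hm he1.1 hμ hmid
  obtain ⟨c1, c2⟩ := hc m hm hmid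
  rcases hF m hm c1 c2 hQ with hF | hF
  · exact H1 _ _ _ (k1.trans he1.2) (k2.trans he1.2) hle (hd m hm) (by rwa [e1])
  · rw [add_comm]
    exact H2 _ _ _ (k2.trans he2.2) (k1.trans he2.2) hle (hd m hm) (by rwa [e2])

end IsGood

end LorentzianPreLengthSpace

namespace LorentzianPreLengthSpace

open Comparison

variable {X : Type*} [MetricSpace X] {L : LorentzianPreLengthSpace X} {K : ℝ} {W : Set X}

namespace IsGood

theorem of_isMuMidpoint (h : L.IsGood K W) {a b : X} (ha : a ∈ W) (hb : b ∈ W) (hab : L.chron a b)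
    {μ : ℝ} (hμ : μ ∈ Ioo (0 : ℝ) 1) {a' b' m' : ModelPlane}
    (ht : ModelPlane.tau K a' b' = L.tau a b) (hm : ModelPlane.IsMuMidpoint K μ a' b' m') :
    (ModelPlane.chron K a' m' ∧ ModelPlane.BeforeAntipode K a' m' ∧
      ModelPlane.modDist K a' m' = md K (μ * (L.tau a b).toReal)) ∧
    (ModelPlane.chron K m' b' ∧ ModelPlane.BeforeAntipode K m' b' ∧
      ModelPlane.modDist K m' b' = md K ((1 - μ) * (L.tau a b).toReal)) := by
  have hℓ := (h.toReal_pos_iff ha hb).2 hab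
  have key : ∀ {p q : ModelPlane} {ν : ℝ}, 0 < ν → ν < 1 →
      ModelPlane.tau K p q = ENNReal.ofReal ν * ModelPlane.tau K a' b' →
      ModelPlane.chron K p q ∧ ModelPlane.BeforeAntipode K p q ∧
        ModelPlane.modDist K p q = md K (ν * (L.tau a b).toReal) := by
    intro p q ν h0 h1 hpq
    rw [ht, ← h.ofReal_toReal ha hb, ← ENNReal.ofReal_mul h0.le] at hpq
    refine ModelPlane.of_tau_eq hpq (mul_pos h0 hℓ) fun hK => ?_
    refine lt_of_le_of_lt ?_ (h.sqrt_mul_lt_pi ha hb hK)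
    exact mul_le_mul_of_nonneg_left (mul_le_of_le_one_left hℓ.le h1.le) (Real.sqrt_nonneg _)
  exact ⟨key hμ.1 hμ.2 hm.1, key (by linarith [hμ.2]) (by linarith [hμ.1]) hm.2⟩

/-- If the bound fails, the model separation T is at most the real number τ - η ≥ 0. This is the
value at which the chord expression gets contradictory signs from the space and from the model. -/
theorem tau_le_add (h : L.IsGood K W) {x y : X} (hx : x ∈ W) (hy : y ∈ W) {T : ℝ≥0∞} {η : ℝ}
    (hη : 0 < η) (H : η ≤ (L.tau x y).toReal → T ≤ ENNReal.ofReal ((L.tau x y).toReal - η) →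
      (K < 0 → √(-K) * ((L.tau x y).toReal - η) < Real.pi) → False) :
    L.tau x y ≤ T + ENNReal.ofReal η := by
  by_contra! hlt
  rw [← h.ofReal_toReal hx hy] at hlt
  have h1 : η < (L.tau x y).toReal := by
    have := le_add_self.trans_lt hlt
    exact (ENNReal.ofReal_lt_ofReal_iff_of_nonneg hη.le).1 this
  refine H h1.le ?_ fun hK => ?_
  · rw [← sub_add_cancel (L.tau x y).toReal η, ENNReal.ofReal_add (by linarith) hη.le] at hlt
    exact (lt_of_add_lt_add_right hlt).le
  · exact (mul_le_mul_of_nonneg_left (by linarith) (Real.sqrt_nonneg _)).trans_lt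
      (h.sqrt_mul_lt_pi hx hy hK)

theorem sn_mul_pos (h : L.IsGood K W) {a b : X} (ha : a ∈ W) (hb : b ∈ W) (hab : L.chron a b)
    {μ : ℝ} (hμ : μ ∈ Ioo (0 : ℝ) 1) : 0 < sn K (μ * (L.tau a b).toReal) := by
  have hℓ := (h.toReal_pos_iff ha hb).2 hab
  refine sn_pos (mul_pos hμ.1 hℓ) fun hK => ?_
  refine lt_of_le_of_lt ?_ (h.sqrt_mul_lt_pi ha hb hK)
  exact mul_le_mul_of_nonneg_left (mul_le_of_le_one_left hℓ.le hμ.2.le) (Real.sqrt_nonneg _)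

/-- The model side of the comparison: the chord function is nonnegative at the comparison
distance. -/
theorem chord_nonneg_of_isMuMidpoint (h : L.IsGood K W) {a b : X} (ha : a ∈ W) (hb : b ∈ W)
    (hab : L.chron a b) {μ : ℝ} (hμ : μ ∈ Ioo (0 : ℝ) 1) {a' b' c' m' : ModelPlane}
    (ht : ModelPlane.tau K a' b' = L.tau a b) (hm : ModelPlane.IsMuMidpoint K μ a' b' m')
    {u Y Z : ℝ} (hac : ModelPlane.modDist K a' c' = md K Y)
    (hbc : ModelPlane.modDist K b' c' = md K Z) (hmc : ModelPlane.modDist K m' c' ≤ md K u) :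
    0 ≤ sn K ((1 - μ) * (L.tau a b).toReal) * hingeProd K (μ * (L.tau a b).toReal) u Y +
        sn K (μ * (L.tau a b).toReal) * hingeProd K ((1 - μ) * (L.tau a b).toReal) u Z := by
  have e1 : μ * (L.tau a b).toReal + (1 - μ) * (L.tau a b).toReal = (L.tau a b).toReal := by ring
  obtain ⟨⟨-, -, m1⟩, -, -, m2⟩ := h.of_isMuMidpoint ha hb hab hμ ht hm
  obtain ⟨-, -, m3⟩ := h.of_tau_eq ha hb hab ht
  refine ModelPlane.chord_nonneg (h.sn_mul_pos ha hb hab hμ) ?_ m1 m2 (by rw [e1, m3]) hac hbc hmc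
  rw [e1]
  exact (sn_pos ((h.toReal_pos_iff ha hb).2 hab) (h.sqrt_mul_lt_pi ha hb)).le

/-- For m ≪ c the future four-point inequality applies: to a ≪ m ≪ b ≪ c if c is the last vertex,
and to a ≪ m ≪ c ≪ b if c is the middle one, where `FourPointIneq.symm` exchanges c and b. It makes
the chord expression negative at τ(m, c) - η, while in the model it is nonnegative from the
comparison distance on. -/
theorem eventually_tau_le_right (h : L.IsGood K W) (hF : h.FourPoint) {a b c : X} (ha : a ∈ W)
    (hb : b ∈ W) (hc : c ∈ W) (hab : L.chron a b)
    (hrel : L.chron b c ∨ (L.chron a c ∧ L.chron c b)) {μ η : ℝ} (hμ : μ ∈ Ioo (0 : ℝ) 1)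
    (hη : 0 < η) :
    ∀ᶠ ε in 𝓝[>] (0 : ℝ), ∀ a' b' c' m' : ModelPlane, ModelPlane.tau K a' b' = L.tau a b →
      ModelPlane.tau K a' c' = L.tau a c → (L.chron b c → ModelPlane.tau K b' c' = L.tau b c) →
      (L.chron c b → ModelPlane.tau K c' b' = L.tau c b) → ModelPlane.IsMuMidpoint K μ a' b' m' →
      ∀ m ∈ W, L.IsEpsMuMidpoint ε μ a b m → L.chron m c →
        L.tau m c ≤ ModelPlane.tau K m' c' + ENNReal.ofReal η := by
  rcases hrel with hbc | ⟨hac, hcb⟩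
  · have hac := L.chron_trans _ _ _ hab hbc
    filter_upwards [h.eventually_chord_lt ha hb hab (Y := (L.tau a c).toReal)
      (Z := (L.tau b c).toReal) hμ hη (Q := fun m => L.chron m c) (d := fun m => (L.tau m c).toReal)
      (fun m hm => (h.toReal_lt hm hc).le) fun m hm h1 h2 _ => Or.inl
        (hF.1 a ha m hm b hb c hc h1 h2 (L.chron_causal _ _ hbc))]
      with ε hε a' b' c' m' t1 t2 t3 _ hm' m hm hmid hmc
    refine h.tau_le_add hm hc hη fun hle hT hTK => (hε m hm hmid hmc hle).not_ge ?_
    obtain ⟨⟨k1, -, -⟩, ⟨k2, -, -⟩⟩ := h.of_isMuMidpoint ha hb hab hμ t1 hm'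
    obtain ⟨-, b1, n1⟩ := h.of_tau_eq ha hc hac t2
    obtain ⟨c2, -, n2⟩ := h.of_tau_eq hb hc hbc (t3 hbc)
    refine h.chord_nonneg_of_isMuMidpoint ha hb hab hμ t1 hm' n1 n2 ?_
    exact ModelPlane.modDist_le_md (ModelPlane.chron_trans k2 c2)
      (b1.mono k1.causal (ModelPlane.causal_iff.2 ⟨le_rfl, le_rfl⟩)) (by linarith) hTK hT
  -- If the μ-midpoint is farther from a than c is, almost-midpoints with small ε satisfy τ(a, m) >
  -- τ(a, c), so m ≪ c cannot occur.
  · by_cases hs : μ * (L.tau a b).toReal ≤ (L.tau a c).toReal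
    · filter_upwards [h.eventually_chord_lt ha hb hab (Y := (L.tau a c).toReal)
        (Z := (L.tau c b).toReal) hμ hη (Q := fun m => L.chron m c)
        (d := fun m => (L.tau m c).toReal)
        (fun m hm => (h.toReal_lt hm hc).le) fun m hm h1 h2 h3 => Or.inl
          (hF.1 a ha m hm c hc b hb h1 h3 (L.chron_causal _ _ hcb)).symm]
        with ε hε a' b' c' m' t1 t2 _ t3 hm' m hm hmid hmc
      refine h.tau_le_add hm hc hη fun hle hT hTK => (hε m hm hmid hmc hle).not_ge ?_
      obtain ⟨⟨k1, b1, m1⟩, ⟨k2, -, -⟩⟩ := h.of_isMuMidpoint ha hb hab hμ t1 hm'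
      obtain ⟨-, b0, -⟩ := h.of_tau_eq ha hb hab t1
      obtain ⟨c1, bc1, n1⟩ := h.of_tau_eq ha hc hac t2
      obtain ⟨c2, -, n2⟩ := h.of_tau_eq hc hb hcb (t3 hcb)
      refine h.chord_nonneg_of_isMuMidpoint ha hb hab hμ t1 hm' n1
        (by rw [ModelPlane.modDist_comm]; exact n2) ?_
      by_cases hch : ModelPlane.chron K m' c'
      · exact ModelPlane.modDist_le_md hch
          (bc1.mono k1.causal (ModelPlane.causal_iff.2 ⟨le_rfl, le_rfl⟩)) (by linarith) hTK hT
      -- If m' ≪ c' fails, the modified distance is not positive: otherwise c' ≪ m', and the reverse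
      -- triangle inequality would give τ(a', c') < τ(a', m'), against `hs`.
      · refine le_trans (not_lt.1 fun hpos => ?_) (md_nonneg (by linarith) fun hK => (hTK hK).le)
        have hcm := (ModelPlane.chron_or_chron_of_mem_diamond b0 k1 k2 c1 c2 hpos).resolve_left hch
        have hlt := ModelPlane.modDist_lt_modDist c1 hcm.causal
          (by rintro rfl; exact hch hcm) b1
        rw [n1, m1] at hlt
        exact hlt.not_ge (md_le_md (mul_nonneg hμ.1.le ENNReal.toReal_nonneg) hs
          fun hK => (h.sqrt_mul_lt_pi ha hc hK).le)
    · filter_upwards [Ioo_mem_nhdsGT (sub_pos.2 (not_le.1 hs)),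
        h.eventually_chron_of_isEpsMuMidpoint ha hb hab hμ]
        with ε hε hch a' b' c' m' _ _ _ _ _ m hm hmid hmc
      have h1 := (abs_lt.1 (h.abs_sub_lt_of_isEpsMuMidpoint ha hb hm hε.1 hμ hmid).1).1
      have h2 := h.toReal_add_le ha hm hc (hch m hm hmid).1 hmc
      have h3 : 0 ≤ (L.tau m c).toReal := ENNReal.toReal_nonneg
      linarith [hε.2]

/-- Time-symmetric to `eventually_tau_le_right`: the past four-point inequality, with distances
measured to b instead of from a. -/
theorem eventually_tau_le_left (h : L.IsGood K W) (hF : h.FourPoint) {a b c : X} (ha : a ∈ W)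
    (hb : b ∈ W) (hc : c ∈ W) (hab : L.chron a b)
    (hrel : L.chron c a ∨ (L.chron a c ∧ L.chron c b)) {μ η : ℝ} (hμ : μ ∈ Ioo (0 : ℝ) 1)
    (hη : 0 < η) :
    ∀ᶠ ε in 𝓝[>] (0 : ℝ), ∀ a' b' c' m' : ModelPlane, ModelPlane.tau K a' b' = L.tau a b →
      ModelPlane.tau K c' b' = L.tau c b → (L.chron c a → ModelPlane.tau K c' a' = L.tau c a) →
      (L.chron a c → ModelPlane.tau K a' c' = L.tau a c) → ModelPlane.IsMuMidpoint K μ a' b' m' →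
      ∀ m ∈ W, L.IsEpsMuMidpoint ε μ a b m → L.chron c m →
        L.tau c m ≤ ModelPlane.tau K c' m' + ENNReal.ofReal η := by
  rcases hrel with hca | ⟨hac, hcb⟩
  · have hcb := L.chron_trans _ _ _ hca hab
    filter_upwards [h.eventually_chord_lt ha hb hab (Y := (L.tau c a).toReal)
      (Z := (L.tau c b).toReal) hμ hη (Q := fun m => L.chron c m) (d := fun m => (L.tau c m).toReal)
      (fun m hm => (h.toReal_lt hc hm).le) fun m hm h1 h2 _ => Or.inr
        (hF.2 b hb m hm a ha c hc h2 h1 (L.chron_causal _ _ hca))]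
      with ε hε a' b' c' m' t1 t2 t3 _ hm' m hm hmid hmc
    refine h.tau_le_add hc hm hη fun hle hT hTK => (hε m hm hmid hmc hle).not_ge ?_
    obtain ⟨⟨k1, -, -⟩, ⟨k2, -, -⟩⟩ := h.of_isMuMidpoint ha hb hab hμ t1 hm'
    obtain ⟨-, b1, n1⟩ := h.of_tau_eq hc hb hcb t2
    obtain ⟨c2, -, n2⟩ := h.of_tau_eq hc ha hca (t3 hca)
    rw [ModelPlane.modDist_comm] at n1 n2
    refine h.chord_nonneg_of_isMuMidpoint ha hb hab hμ t1 hm' n2 n1 ?_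
    rw [ModelPlane.modDist_comm]
    exact ModelPlane.modDist_le_md (ModelPlane.chron_trans c2 k1)
      (b1.mono (ModelPlane.causal_iff.2 ⟨le_rfl, le_rfl⟩) k2.causal) (by linarith) hTK hT
  · by_cases hs : (1 - μ) * (L.tau a b).toReal ≤ (L.tau c b).toReal
    · filter_upwards [h.eventually_chord_lt ha hb hab (Y := (L.tau a c).toReal)
        (Z := (L.tau c b).toReal) hμ hη (Q := fun m => L.chron c m)
        (d := fun m => (L.tau c m).toReal)
        (fun m hm => (h.toReal_lt hc hm).le) fun m hm h1 h2 h3 => Or.inr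
          (hF.2 b hb m hm c hc a ha h2 h3 (L.chron_causal _ _ hac)).symm]
        with ε hε a' b' c' m' t1 t2 _ t3 hm' m hm hmid hmc
      refine h.tau_le_add hc hm hη fun hle hT hTK => (hε m hm hmid hmc hle).not_ge ?_
      obtain ⟨⟨k1, -, -⟩, ⟨k2, b2, m2⟩⟩ := h.of_isMuMidpoint ha hb hab hμ t1 hm'
      obtain ⟨-, b0, -⟩ := h.of_tau_eq ha hb hab t1
      obtain ⟨c2, bc2, n2⟩ := h.of_tau_eq hc hb hcb t2
      obtain ⟨c1, -, n1⟩ := h.of_tau_eq ha hc hac (t3 hac)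
      refine h.chord_nonneg_of_isMuMidpoint ha hb hab hμ t1 hm' n1
        (by rw [ModelPlane.modDist_comm]; exact n2) ?_
      rw [ModelPlane.modDist_comm]
      by_cases hch : ModelPlane.chron K c' m'
      · exact ModelPlane.modDist_le_md hch
          (bc2.mono (ModelPlane.causal_iff.2 ⟨le_rfl, le_rfl⟩) k2.causal) (by linarith) hTK hT
      · refine le_trans (not_lt.1 fun hpos => ?_) (md_nonneg (by linarith) fun hK => (hTK hK).le)
        have hcm := (ModelPlane.chron_or_chron_of_mem_diamond b0 c1 c2 k1 k2 hpos).resolve_left hch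
        have hlt := ModelPlane.modDist_lt_modDist' c2 hcm.causal
          (by rintro rfl; exact hch hcm) b2
        rw [n2, m2] at hlt
        exact hlt.not_ge (md_le_md (mul_nonneg (by linarith [hμ.2]) ENNReal.toReal_nonneg) hs
          fun hK => (h.sqrt_mul_lt_pi hc hb hK).le)
    · filter_upwards [Ioo_mem_nhdsGT (sub_pos.2 (not_le.1 hs)),
        h.eventually_chron_of_isEpsMuMidpoint ha hb hab hμ]
        with ε hε hch a' b' c' m' _ _ _ _ _ m hm hmid hmc
      have h1 := (abs_lt.1 (h.abs_sub_lt_of_isEpsMuMidpoint ha hb hm hε.1 hμ hmid).2).1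
      have h2 := h.toReal_add_le hc hm hb hmc (hch m hm hmid).2
      have h3 : 0 ≤ (L.tau c m).toReal := ENNReal.toReal_nonneg
      linarith [hε.2]

end IsGood

/-- A modulus function from bounds that hold eventually. -/
theorem exists_modulus {A : ℝ → ℝ≥0 → Prop} (hmono : ∀ ε η η', η ≤ η' → A ε η → A ε η')
    (hex : ∀ ε, ∃ η, A ε η) (hev : ∀ η > 0, ∀ᶠ ε in 𝓝[>] (0 : ℝ), A ε η) :
    ∃ f : ℝ → ℝ≥0, Tendsto f (𝓝[>] 0) (𝓝 0) ∧ ∀ ε > 0, A ε (f ε) := by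
  -- The infimum need not be attained; adding ε moves strictly above it without changing the limit.
  refine ⟨fun ε => sInf {η | A ε η} + ε.toNNReal, ?_, fun ε hε => ?_⟩
  · have h1 : Tendsto (fun ε : ℝ => sInf {η | A ε η}) (𝓝[>] 0) (𝓝 0) := by
      rw [tendsto_order]
      refine ⟨fun a ha => absurd ha not_lt_zero, fun a ha => ?_⟩
      filter_upwards [hev (a / 2) (half_pos ha)] with ε hε
      exact (csInf_le (OrderBot.bddBelow _) hε).trans_lt (NNReal.half_lt_self ha.ne')
    have h2 : Tendsto (fun ε : ℝ => ε.toNNReal) (𝓝[>] 0) (𝓝 0) := by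
      have := (continuous_real_toNNReal.tendsto 0).mono_left (nhdsWithin_le_nhds (s := Ioi 0))
      simpa using this
    simpa using h1.add h2
  · obtain ⟨η, hη, hlt⟩ := exists_lt_of_csInf_lt (hex ε)
      (lt_add_of_pos_right (sInf {η | A ε η}) (Real.toNNReal_pos.2 hε))
    exact hmono ε η _ hlt.le hη

/-- The modulus must serve all sides and all comparison triangles at once. The earlier bounds are
already uniform in the comparison triangle, and there are only finitely many choices of side and
vertex. -/
theorem IsGood.isEpsMuNeighbourhood (h : L.IsGood K W) (hF : h.FourPoint) :
    L.IsEpsMuNeighbourhood K W := by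
  refine ⟨h.tauContinuousBelow, fun x hx μ hμ => ?_⟩
  refine (exists_modulus (A := fun ε η =>
    ∀ i j k : Fin 3, i < j → k ≠ i → k ≠ j →
      ∀ y : Fin 3 → ModelPlane, L.IsComparisonTriangle K x y →
      ∀ m' : ModelPlane, ModelPlane.IsMuMidpoint K μ (y i) (y j) m' →
      ∀ m ∈ W, L.IsEpsMuMidpoint ε μ (x i) (x j) m →
        (L.chron m (x k) ∨ L.chron (x k) m) →
        L.tau (x k) m ≤ ModelPlane.tau K (y k) m' + η ∧
        L.tau m (x k) ≤ ModelPlane.tau K m' (y k) + η) ?_ ?_ ?_).imp fun f hf =>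
    ⟨hf.1, fun y hy i j k hij hki hkj m' hm' ε hε m hm =>
      hf.2 ε hε i j k hij hki hkj y hy m' hm' m hm⟩
  · intro ε η η' hle H i j k hij hki hkj y hy m' hm' m hm hmid hc
    have hle' : (η : ℝ≥0∞) ≤ η' := ENNReal.coe_le_coe.2 hle
    obtain ⟨h1, h2⟩ := H i j k hij hki hkj y hy m' hm' m hm hmid hc
    exact ⟨h1.trans (by gcongr), h2.trans (by gcongr)⟩
  -- For arbitrary ε the crude bound by the size of the neighbourhood suffices.
  · refine fun ε => ⟨(smallRadius K).toNNReal, fun i j k _ _ _ y _ m' _ m hm _ _ => ?_⟩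
    exact ⟨(h.small _ (hx.1 k) _ hm).le.trans le_add_self,
      (h.small _ hm _ (hx.1 k)).le.trans le_add_self⟩
  · intro η hη
    simp only [eventually_all]
    intro i j k hij hki hkj
    have hη' : (0 : ℝ) < η := hη
    have hηe : ENNReal.ofReal η = η := ENNReal.ofReal_coe_nnreal
    have hab := hx.chron hij
    have hch := h.eventually_chron_of_isEpsMuMidpoint (hx.1 i) (hx.1 j) hab hμ
    have hcases : j < k ∨ k < i ∨ (i < k ∧ k < j) := by omega
    have fin : ∀ {m : X} {T T' : ℝ≥0∞}, m ∈ W → (L.chron m (x k) ∨ L.chron (x k) m) →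
        (L.chron m (x k) → L.tau m (x k) ≤ T + ENNReal.ofReal η) →
        (L.chron (x k) m → L.tau (x k) m ≤ T' + ENNReal.ofReal η) →
        L.tau (x k) m ≤ T' + η ∧ L.tau m (x k) ≤ T + η := by
      intro m T T' hm hc h1 h2
      rw [hηe] at h1 h2
      rcases hc with hc | hc
      · exact ⟨by rw [h.tau_eq_zero_of_chron hm hc]; exact zero_le, h1 hc⟩
      · exact ⟨h2 hc, by rw [h.tau_eq_zero_of_chron (hx.1 k) hc]; exact zero_le⟩
    rcases hcases with hk | hk | ⟨hk1, hk2⟩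
    · have hbc := hx.chron hk
      filter_upwards [hch, h.eventually_tau_le_right hF (hx.1 i) (hx.1 j) (hx.1 k) hab
        (Or.inl hbc) hμ hη'] with ε e1 e2 y hy m' hm' m hm hmid hc
      refine fin hm hc (e2 _ _ _ m' (hy i j hij) (hy i k (hij.trans hk)) (fun _ => hy j k hk)
        (fun hcb => (h.not_chron_self (hx.1 j) (L.chron_trans _ _ _ hbc hcb)).elim) hm' m hm hmid)
        fun hcm => (h.not_chron_self hm (L.chron_trans _ _ _ (e1 m hm hmid).2
          (L.chron_trans _ _ _ hbc hcm))).elim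
    · have hca := hx.chron hk
      filter_upwards [hch, h.eventually_tau_le_left hF (hx.1 i) (hx.1 j) (hx.1 k) hab
        (Or.inl hca) hμ hη'] with ε e1 e2 y hy m' hm' m hm hmid hc
      refine fin hm hc (fun hmc => (h.not_chron_self hm (L.chron_trans _ _ _ hmc
          (L.chron_trans _ _ _ hca (e1 m hm hmid).1))).elim)
        (e2 _ _ _ m' (hy i j hij) (hy k j (hk.trans hij)) (fun _ => hy k i hk)
        (fun hac => (h.not_chron_self (hx.1 i) (L.chron_trans _ _ _ hac hca)).elim) hm' m hm hmid)
    · have hac := hx.chron hk1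
      have hcb := hx.chron hk2
      filter_upwards [h.eventually_tau_le_left hF (hx.1 i) (hx.1 j) (hx.1 k) hab
        (Or.inr ⟨hac, hcb⟩) hμ hη', h.eventually_tau_le_right hF (hx.1 i) (hx.1 j) (hx.1 k) hab
        (Or.inr ⟨hac, hcb⟩) hμ hη'] with ε e1 e2 y hy m' hm' m hm hmid hc
      exact fin hm hc
        (e2 _ _ _ m' (hy i j hij) (hy i k hk1)
        (fun hbc => (h.not_chron_self (hx.1 j) (L.chron_trans _ _ _ hbc hcb)).elim)
        (fun _ => hy k j hk2) hm' m hm hmid)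
        (e1 _ _ _ m' (hy i j hij) (hy k j hk2)
        (fun hca => (h.not_chron_self (hx.1 i) (L.chron_trans _ _ _ hac hca)).elim)
        (fun _ => hy i k hk1) hm' m hm hmid)

theorem FourPointCurvatureBoundedBelow.epsMu (hsc : L.StronglyCausal)
    (h : L.FourPointCurvatureBoundedBelow K) : L.EpsMuCurvatureBoundedBelow K := by
  intro p
  by_cases hp : L.chron p p
  · exact ⟨{p}, hsc.isOpen_singleton hp, rfl, isEpsMuNeighbourhood_singleton hp⟩
  obtain ⟨U, -, hpU, hU⟩ := h p
  obtain ⟨W, hWU, hpW, hW⟩ := hsc.exists_isGood hp hpU hU.1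
  exact ⟨W, hW.isOpen, hpW, hW.isEpsMuNeighbourhood
    (hW.fourPoint_of_isFourPointNeighbourhood (hU.restrict hW hWU))⟩

end LorentzianPreLengthSpace

namespace LorentzianPreLengthSpace

open Comparison

variable {X : Type*} [MetricSpace X] {L : LorentzianPreLengthSpace X} {K : ℝ} {U W : Set X}

/-! ### From almost-midpoints to triangle comparison -/

theorem IsGood.tau_vertex_le (h : L.IsGood K W) {x : Fin 3 → X} {y : Fin 3 → ModelPlane}
    (hx : L.IsTimelikeTriangle K W x) (hy : L.IsComparisonTriangle K x y) {i k : Fin 3}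
    (hki : k ≠ i) : L.tau (x k) (x i) ≤ ModelPlane.tau K (y k) (y i) := by
  rcases lt_or_gt_of_ne hki with hlt | hlt
  · exact (hy k i hlt).ge
  · rw [h.tau_eq_zero_of_chron (hx.1 i) (hx.chron hlt)]
    exact zero_le

/-- A comparison point at the distance of an endpoint of the segment is that endpoint. -/
theorem IsGood.eq_left_of_isComparisonPoint (h : L.IsGood K W) {a b : X} (ha : a ∈ W) (hb : b ∈ W)
    (hab : L.chron a b) {a' b' m' : ModelPlane} (ht : ModelPlane.tau K a' b' = L.tau a b)
    (hm : L.IsComparisonPoint K a a b a' m' b') : m' = a' := by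
  by_contra hne
  obtain ⟨-, b1, n1⟩ := h.of_tau_eq ha hb hab ht
  obtain ⟨c2, -, n2⟩ := h.of_tau_eq ha hb hab hm.2.2.2
  have := ModelPlane.modDist_lt_modDist' c2 hm.1 hne b1
  rw [n1, n2] at this
  exact lt_irrefl _ this

theorem IsGood.eq_right_of_isComparisonPoint (h : L.IsGood K W) {a b : X} (ha : a ∈ W)
    (hb : b ∈ W) (hab : L.chron a b) {a' b' m' : ModelPlane}
    (ht : ModelPlane.tau K a' b' = L.tau a b) (hm : L.IsComparisonPoint K a b b a' m' b') :
    m' = b' := by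
  by_contra hne
  obtain ⟨-, b1, n1⟩ := h.of_tau_eq ha hb hab ht
  obtain ⟨c2, -, n2⟩ := h.of_tau_eq ha hb hab hm.2.2.1
  have := ModelPlane.modDist_lt_modDist c2 hm.2.1 hne b1
  rw [n1, n2] at this
  exact lt_irrefl _ this

theorem isEpsMuMidpoint_of_tau_eq {a b m : X} {μ ε : ℝ} (hε : 0 < ε) (hfin : L.tau a b ≠ ⊤)
    (h1 : L.tau a m = ENNReal.ofReal μ * L.tau a b)
    (h2 : L.tau m b = ENNReal.ofReal (1 - μ) * L.tau a b) : L.IsEpsMuMidpoint ε μ a b m := by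
  have key : ∀ ν : ℝ, ENNReal.ofReal ν * L.tau a b <
      ENNReal.ofReal ν * L.tau a b + ENNReal.ofReal ε := fun ν =>
    ENNReal.lt_add_right (ENNReal.mul_ne_top ENNReal.ofReal_ne_top hfin)
      (ENNReal.ofReal_pos.2 hε).ne'
  unfold IsEpsMuMidpoint
  rw [h1, h2]
  exact ⟨key μ, key μ, key _, key _⟩

/-- An interior point of a realizer divides the separation in a ratio μ, and regularity gives 0 < μ
< 1. So it is an exact μ-midpoint, and its comparison point is the model μ-midpoint. -/
theorem IsEpsMuNeighbourhood.isTriangleNeighbourhood (hU : L.IsEpsMuNeighbourhood K U)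
    (hreg : L.Regular) (h : L.IsGood K W) (hWU : W ⊆ U)
    (hgeo : ∀ x ∈ W, ∀ y ∈ W, x ≠ y → L.chron x y → ∃ γ : ℝ → X, L.IsDistanceRealizer γ x y) :
    L.IsTriangleNeighbourhood K W := by
  refine ⟨h.tauContinuousBelow, fun x hx y hy hc _ => ?_,
    fun x y hx hy i j k hij hki hkj γ hγ hγW s hs m' hm' => ?_⟩
  · obtain ⟨γ, hγ⟩ := hgeo x hx y hy (by rintro rfl; exact h.not_chron_self hx hc) hc
    exact ⟨γ, hγ, fun s hs => h.mem_of_isDistanceRealizer hx hy hγ hs⟩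
  have hab := hx.chron hij
  -- The endpoints would correspond to μ = 0 and μ = 1, which the ε-μ condition does not cover;
  -- there the comparison point is a vertex.
  rcases hs.1.eq_or_lt with rfl | h0
  · rw [hγ.2.1] at hm' ⊢
    rw [h.eq_left_of_isComparisonPoint (hx.1 i) (hx.1 j) hab (hy i j hij) hm']
    exact ⟨h.tau_vertex_le hx hy hki, h.tau_vertex_le hx hy hki.symm⟩
  rcases hs.2.eq_or_lt with rfl | h1
  · rw [hγ.2.2.1] at hm' ⊢
    rw [h.eq_right_of_isComparisonPoint (hx.1 i) (hx.1 j) hab (hy i j hij) hm']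
    exact ⟨h.tau_vertex_le hx hy hkj, h.tau_vertex_le hx hy hkj.symm⟩
  by_cases hrel : L.chron (γ s) (x k) ∨ L.chron (x k) (γ s)
  swap
  -- The ε-μ condition only concerns points timelike related to the opposite vertex; otherwise both
  -- separations are 0.
  · rw [not_or, ← L.tau_pos_iff, ← L.tau_pos_iff, not_lt, not_lt] at hrel
    exact ⟨hrel.2.trans zero_le, hrel.1.trans zero_le⟩
  have hm := hγW s hs
  have ham : L.chron (x i) (γ s) := hγ.2.1 ▸ hreg _ _ _ hab hγ 0 ⟨le_rfl, zero_le_one⟩ s hs h0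
  have hmb : L.chron (γ s) (x j) := hγ.2.2.1 ▸ hreg _ _ _ hab hγ s hs 1 ⟨zero_le_one, le_rfl⟩ h1
  have hfin := h.ne_top (hx.1 i) (hx.1 j)
  have hadd : (L.tau (x i) (γ s)).toReal + (L.tau (γ s) (x j)).toReal =
      (L.tau (x i) (x j)).toReal := by
    have := hγ.tau_add hfin le_rfl h0 h1 le_rfl
    rw [hγ.2.1, hγ.2.2.1] at this
    rw [← this, ENNReal.toReal_add (h.ne_top (hx.1 i) hm) (h.ne_top hm (hx.1 j))]
  have p1 := (h.toReal_pos_iff (hx.1 i) hm).2 ham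
  have p2 := (h.toReal_pos_iff hm (hx.1 j)).2 hmb
  have p3 := (h.toReal_pos_iff (hx.1 i) (hx.1 j)).2 hab
  obtain ⟨μ, hμ⟩ : ∃ μ, μ = (L.tau (x i) (γ s)).toReal / (L.tau (x i) (x j)).toReal := ⟨_, rfl⟩
  have hμ1 : μ ∈ Ioo (0 : ℝ) 1 := by
    rw [hμ]
    exact ⟨div_pos p1 p3, (div_lt_one p3).2 (by linarith)⟩
  have e1 : μ * (L.tau (x i) (x j)).toReal = (L.tau (x i) (γ s)).toReal := by
    rw [hμ, div_mul_cancel₀ _ p3.ne']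
  have t1 : L.tau (x i) (γ s) = ENNReal.ofReal μ * L.tau (x i) (x j) := by
    rw [← h.ofReal_toReal (hx.1 i) (hx.1 j), ← ENNReal.ofReal_mul hμ1.1.le, e1,
      h.ofReal_toReal (hx.1 i) hm]
  have t2 : L.tau (γ s) (x j) = ENNReal.ofReal (1 - μ) * L.tau (x i) (x j) := by
    rw [← h.ofReal_toReal (hx.1 i) (hx.1 j), ← ENNReal.ofReal_mul (by linarith [hμ1.2]),
      show (1 - μ) * (L.tau (x i) (x j)).toReal = (L.tau (γ s) (x j)).toReal by linarith,
      h.ofReal_toReal hm (hx.1 j)]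
  obtain ⟨f, hf, H⟩ := hU.2 x (hx.mono hWU) μ hμ1
  have hmid : ModelPlane.IsMuMidpoint K μ (y i) (y j) m' := by
    constructor
    · rw [hm'.2.2.1, hy i j hij, t1]
    · rw [hm'.2.2.2, hy i j hij, t2]
  -- The same point is admissible for every ε > 0, so the error f ε can be sent to 0.
  have hbd := fun ε (hε : (0 : ℝ) < ε) => H y hy i j k hij hki hkj m' hmid ε hε (γ s) (hWU hm)
    (isEpsMuMidpoint_of_tau_eq hε hfin t1 t2) hrel
  have hlim : ∀ T : ℝ≥0∞, Tendsto (fun ε : ℝ => T + f ε) (𝓝[>] 0) (𝓝 T) := fun T => by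
    have : Tendsto (fun ε : ℝ => (f ε : ℝ≥0∞)) (𝓝[>] 0) (𝓝 0) := by
      rw [← ENNReal.coe_zero]
      exact ENNReal.tendsto_coe.2 hf
    simpa using tendsto_const_nhds.add this
  exact ⟨ge_of_tendsto (hlim _) (eventually_nhdsWithin_of_forall fun ε hε => (hbd ε hε).1),
    ge_of_tendsto (hlim _) (eventually_nhdsWithin_of_forall fun ε hε => (hbd ε hε).2)⟩

theorem EpsMuCurvatureBoundedBelow.triangle (hsc : L.StronglyCausal) (hreg : L.Regular)
    (h : L.EpsMuCurvatureBoundedBelow K) (hgeo : L.LocallyTimelikeGeodesic) :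
    L.TriangleCurvatureBoundedBelow K := by
  intro p
  by_cases hp : L.chron p p
  · exact ⟨{p}, hsc.isOpen_singleton hp, rfl, isTriangleNeighbourhood_singleton hp⟩
  obtain ⟨U, -, hpU, hU⟩ := h p
  obtain ⟨V, hVo, hpV, hV⟩ := hgeo p
  obtain ⟨W, hWU, hpW, hW⟩ := hsc.exists_isGood hp hpU hU.1
  obtain ⟨W', hW'W, hW'V, hpW', hW'⟩ := hW.inter hsc hpW hVo hpV
  exact ⟨W', hW'.isOpen, hpW', hU.isTriangleNeighbourhood hreg hW' (hW'W.trans hWU)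
    fun x hx y hy => hV x (hW'V hx) y (hW'V hy)⟩

end LorentzianPreLengthSpace

end

/-! ### The equivalence of the three curvature bounds -/

theorem mainTheorem2 {X : Type*} [MetricSpace X] (L : LorentzianPreLengthSpace X)
    (hsc : L.StronglyCausal) (hreg : L.Regular) (K : ℝ) :
    List.TFAE [
      L.TriangleCurvatureBoundedBelow K,
      L.FourPointCurvatureBoundedBelow K ∧ L.LocallyTimelikeGeodesic,
      L.EpsMuCurvatureBoundedBelow K ∧ L.LocallyTimelikeGeodesic] := by
  tfae_have 1 → 2 := fun h => ⟨h.fourPoint hsc hreg, h.locallyTimelikeGeodesic hsc⟩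
  tfae_have 2 → 3 := fun h => ⟨h.1.epsMu hsc, h.2⟩
  tfae_have 3 → 1 := fun h => h.1.triangle hsc hreg h.2
  tfae_finish
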